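/- **Theorem (second-order convergence of the auxiliary bulk--surface splitting scheme in the weak norms).** Let $\Omega\subset\mathbb R^d$, $d\in\{2,3\}$, be a bounded Lipschitz domain with boundary $\Gamma$, let $\alpha\in L^\infty(\Omega)$ and $\kappa\in L^\infty(\Gamma)$ be uniformly positive, and let $T>0$, $k\ge 1$, $\rho>0$. *Discretization.* Let $\mathcal T$ be a conforming simplicial triangulation of $\overline\Omega$ with maximal mesh width $h$, quasi-uniform in the sense that every simplex contains a ball of radius $h/\rho$. Let $V_h=P_k(\mathcal T)$ be the Lagrange space with nodal basis $(\varphi_i)$, the nodes on $\Gamma$ ordered last, and let $M_h=V_h|_\Gamma$ with the traces of the boundary nodal functions as basis. Let $Q_h=\operatorname{span}(\psi_j)$, with linearly independent $\psi_j$, be a space of continuous piecewise polynomials on a conforming triangulation of $\Gamma$ that refines $\mathcal T|_\Gamma$. Let $M_u=(\int_\Omega\varphi_i\varphi_j)$, $K_u=(\int_\Omega\alpha\nabla\varphi_i\cdot\nabla\varphi_j)$, $M_p=(\int_\Gamma\psi_i\psi_j)$, $K_p=(\int_\Gamma\kappa\nabla_\Gamma\psi_i\cdot\nabla_\Gamma\psi_j)$.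 With $\varphi_i$ running over the boundary nodal functions, let $B_u=(\int_\Gamma\varphi_i\varphi_j)=[\,0\ \ M_\lambda\,]$ and $B_p=(\int_\Gamma\varphi_i\psi_j)$, so that $M_\lambda$ is the mass matrix of $M_h$. Write $u=(u_1,u_2)$ for the splitting into inner and boundary nodes, $M_{ij},K_{ij}$ for the corresponding blocks of $M_u,K_u$, and $\|x\|_M^2=x^TMx$. *Semi-discrete problem.* Let $f_u,f_p$ be given functions of time and let $(u,p,\lambda)$ solve, on $[-2\tau,T]$, $$M_u\dot u+K_uu-B_u^T\lambda=f_u,\qquad M_p\dot p+K_pp+B_p^T\lambda=f_p,\qquad B_uu=B_pp,$$ with $u,p$ four times continuously differentiable. *Auxiliary scheme.* Let $t^m=m\tau$, $D x^m=\frac1{2\tau}(3x^m-4x^{m-1}+x^{m-2})$ and $\widetilde D x^{m-1}=\frac1{2\tau}(5x^{m-1}-8x^{m-2}+3x^{m-3})$. Let $(\hat u^m,p^m)_{m\ge-2}$ and $(\lambda^m)_{m\ge1}$, where $\hat u^m=u^m$ and $p^m$ for $m=-2,-1,0$ are given and consistent, i.e. $B_u u^m=B_p p^m$, satisfy, for all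 $m\ge1$ with $t^m\le T$, $$M_{11}D\hat u_1^m+K_{11}\hat u_1^m=f_1(t^m)-M_{12}M_\lambda^{-1}B_p\widetilde D p^{m-1}-K_{12}M_\lambda^{-1}B_p(2p^{m-1}-p^{m-2}),$$ $$M_{21}D\hat u_1^m+K_{21}\hat u_1^m-M_\lambda\lambda^m=f_2(t^m)-M_{22}M_\lambda^{-1}B_p\widetilde D p^{m-1}-K_{22}M_\lambda^{-1}B_p(2p^{m-1}-p^{m-2}),$$ $$M_pDp^m+K_pp^m+B_p^T\lambda^m=f_p(t^m),\qquad M_\lambda\hat u_2^m=B_pp^m .$$ *Claim.* There are $h_0,c_0>0$, depending only on $d,\Omega,\alpha,\kappa,T,k,\rho$, such that for all $A,R$ there is a constant $C$, depending only on these data and on $A,R$ (in particular not on $h$, $\tau$, the meshes or $Q_h$), for which the following holds. If $h\le h_0$, $0<\tau\le c_0h$, the regularity bound $$\int_{-2\tau}^{T}\Big(\|u^{(3)}\|_{M_u}^2+\|u^{(4)}\|_{M_u}^2+\|p^{(3)}\|_{M_p}^2+\|p^{(4)}\|_{M_p}^2+\|\ddot u_2\|_{K_{22}}^2+\|u_2^{(3)}\|_{K_{22}}^2\Big)\,dt\le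 R$$ holds, and $$\|u^j-u(t^j)\|_{M_u}^2+\|p^j-p(t^j)\|_{M_p}^2+\tau\big(\|u^j-u(t^j)\|_{K_u}^2+\|p^j-p(t^j)\|_{K_p}^2\big)\le A\tau^5\qquad(j=-2,-1,0),$$ then, for every integer $n\ge0$ with $t^n\le T$, $$\|\hat u^n-u(t^n)\|_{M_u}^2+\|p^n-p(t^n)\|_{M_p}^2+\tau\sum_{j=1}^n\Big(\|\hat u^j-u(t^j)\|_{K_u}^2+\|p^j-p(t^j)\|_{K_p}^2\Big)\le C\tau^4 .$$ -/

import Mathlib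

open MeasureTheory Matrix
open scoped NNReal ENNReal Gradient

noncomputable section

namespace BulkSurface

/-- The Euclidean space `ℝ^d`. -/
abbrev E (d : ℕ) := EuclideanSpace ℝ (Fin d)

/-! ### Domain and meshes -/

/-- Bounded Lipschitz domain: a bounded, open, connected, nonempty set which, near each boundary
point and in suitable orthogonal coordinates with vertical direction `ν`, is the strict subgraph of
a Lipschitz function `g` of the horizontal part `y - ⟪ν, y⟫ ν`. -/
structure IsLipschitzDomain {d : ℕ} (Ω : Set (E d)) : Prop where
  isOpen : IsOpen Ω
  isConnected : IsConnected Ω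
  isBounded : Bornology.IsBounded Ω
  lipschitz : ∀ x ∈ frontier Ω, ∃ ν : E d, ‖ν‖ = 1 ∧ ∃ (g : E d → ℝ) (L : ℝ≥0),
    LipschitzWith L g ∧ ∃ r > 0, ∀ y ∈ Metric.ball x r,
      (y ∈ Ω ↔ inner ℝ ν y < g (y - inner ℝ ν y • ν))

/-- The closed simplex (as a set) spanned by a finite set of vertices. -/
abbrev hull {d : ℕ} (s : Finset (E d)) : Set (E d) := convexHull ℝ (s : Set (E d))

/-- A conforming triangulation of the domain `Ω` into `d`-simplices. -/
structure BulkMesh {d : ℕ} (Ω : Set (E d)) where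
  complex : Geometry.SimplicialComplex ℝ (E d)
  finite : complex.faces.Finite
  space_eq : complex.space = closure Ω
  pure : ∀ s ∈ complex.faces, ∃ t ∈ complex.faces, s ⊆ t ∧ t.card = d + 1

/-- A conforming triangulation of the boundary `Γ = frontier Ω` into `(d-1)`-simplices which
refines the restriction to `Γ` of the bulk mesh `𝒯`. -/
structure SurfaceMesh {d : ℕ} {Ω : Set (E d)} (𝒯 : BulkMesh Ω) where
  complex : Geometry.SimplicialComplex ℝ (E d)
  finite : complex.faces.Finite
  space_eq : complex.space = frontier Ω
  pure : ∀ s ∈ complex.faces, ∃ t ∈ complex.faces, s ⊆ t ∧ t.card = d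
  refines : ∀ s ∈ complex.faces, ∃ F ∈ 𝒯.complex.faces,
    F.card = d ∧ hull F ⊆ frontier Ω ∧ hull s ⊆ hull F

/-- The `(d-1)`-dimensional simplices of a surface mesh. -/
def SurfaceMesh.facets {d : ℕ} {Ω : Set (E d)} {𝒯 : BulkMesh Ω} (𝒢 : SurfaceMesh 𝒯) :
    Finset (Finset (E d)) :=
  (𝒢.finite.subset (Set.sep_subset 𝒢.complex.faces (fun s => s.card = d))).toFinset

namespace BulkMesh

variable {d : ℕ} {Ω : Set (E d)} (𝒯 : BulkMesh Ω)

/-- The maximal mesh width `h`. -/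
def meshWidth : ℝ := sSup ((fun s => Metric.diam (hull s)) '' 𝒯.complex.faces)

/-- Quasi-uniformity with parameter `ρ`: every simplex of the triangulation contains a closed ball
of radius `h / ρ`. -/
def IsQuasiUniform (ρ : ℝ) : Prop :=
  ∀ s ∈ 𝒯.complex.faces, s.card = d + 1 →
    ∃ c : E d, Metric.closedBall c (𝒯.meshWidth / ρ) ⊆ hull s

/-- `w` is the family of barycentric coordinates of the point `x`: `x` is the convex combination
with weights `w` of the vertices of a simplex of the mesh. -/
def IsBarycentric (x : E d) (w : E d →₀ ℝ) : Prop :=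
  w.support ∈ 𝒯.complex.faces ∧ (∀ v, 0 ≤ w v) ∧
    (w.sum fun _ c => c) = 1 ∧ (w.sum fun v c => c • v) = x

open Classical in
/-- The barycentric coordinates of `x` with respect to the mesh (zero outside the mesh);
`x ↦ bary 𝒯 x v` is the piecewise linear hat function of the vertex `v`. -/
def bary (x : E d) : E d →₀ ℝ :=
  if h : ∃ w, 𝒯.IsBarycentric x w then h.choose else 0

/-- The Lagrange nodes of degree `k`, indexed by multi-indices: the node of `a` is
`∑ v, (a v / k) v`, where `a` has total degree `k` and is supported on the vertices of a simplex. -/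
def NodeIndex (k : ℕ) : Type :=
  {a : E d →₀ ℕ // a.support ∈ 𝒯.complex.faces ∧ (a.sum fun _ n => n) = k}

/-- The position of a Lagrange node. -/
def nodePos {k : ℕ} (a : 𝒯.NodeIndex k) : E d :=
  (k : ℝ)⁻¹ • a.1.sum fun v n => (n : ℝ) • v

/-- The nodal (Lagrange) basis function of degree `k` of a node; on each simplex it is a polynomial
of degree `k` in the barycentric coordinates, equal to `1` at the node and to `0` at the others. -/
def shape {k : ℕ} (a : 𝒯.NodeIndex k) (x : E d) : ℝ :=
  ∏ v ∈ a.1.support, ∏ j ∈ Finset.range (a.1 v), ((k : ℝ) * 𝒯.bary x v - j) / (j + 1)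

/-- Indices of the nodes that do not lie on `Γ`. -/
def InnerNode (k : ℕ) : Type := {a : 𝒯.NodeIndex k // 𝒯.nodePos a ∉ frontier Ω}

/-- Indices of the nodes on `Γ`. -/
def BoundaryNode (k : ℕ) : Type := {a : 𝒯.NodeIndex k // 𝒯.nodePos a ∈ frontier Ω}

/-- Degrees of freedom of `V_h = P_k(𝒯)`, ordered with the boundary nodes last. -/
abbrev Dof (k : ℕ) : Type := 𝒯.InnerNode k ⊕ 𝒯.BoundaryNode k

/-- The nodal basis of `V_h`. -/
def basis (k : ℕ) : 𝒯.Dof k → E d → ℝ :=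
  Sum.elim (fun a => 𝒯.shape a.1) (fun a => 𝒯.shape a.1)

theorem finite_nodeIndex (k : ℕ) : Finite (𝒯.NodeIndex k) := by
  classical
  let V : Finset (E d) := 𝒯.finite.toFinset.biUnion id
  have hfin : Set.Finite {a : E d →₀ ℕ | a.support ∈ 𝒯.complex.faces ∧ (a.sum fun _ n => n) = k} := by
    refine (Finset.finite_toSet (Finset.finsuppAntidiag V k)).subset ?_
    rintro a ⟨ha, hk⟩
    have hs : a.support ⊆ V := fun v hv =>
      Finset.mem_biUnion.2 ⟨a.support, by simpa using ha, hv⟩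
    rw [Finset.mem_coe, Finset.mem_finsuppAntidiag]
    exact ⟨by rw [← hk, Finsupp.sum]; exact (Finset.sum_subset hs (by simp)).symm, hs⟩
  exact hfin.to_subtype

instance (k : ℕ) : Fintype (𝒯.InnerNode k) :=
  haveI := 𝒯.finite_nodeIndex k
  haveI : Finite (𝒯.InnerNode k) := inferInstanceAs (Finite (Subtype _))
  Fintype.ofFinite _

instance (k : ℕ) : Fintype (𝒯.BoundaryNode k) :=
  haveI := 𝒯.finite_nodeIndex k
  haveI : Finite (𝒯.BoundaryNode k) := inferInstanceAs (Finite (Subtype _))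
  Fintype.ofFinite _

instance (k : ℕ) : DecidableEq (𝒯.BoundaryNode k) := Classical.decEq _

end BulkMesh

/-- `ψ` is a basis of a conforming finite element space `Q_h` on the surface mesh `𝒢`: linearly
independent continuous functions on `Γ`, polynomial on every simplex of the mesh. -/
structure IsSurfaceFEBasis {d : ℕ} {Ω : Set (E d)} {𝒯 : BulkMesh Ω} (𝒢 : SurfaceMesh 𝒯)
    {N : ℕ} (ψ : Fin N → E d → ℝ) : Prop where
  continuousOn : ∀ j, ContinuousOn (ψ j) (frontier Ω)
  polynomial : ∀ j, ∀ s ∈ 𝒢.complex.faces, ∃ P : MvPolynomial (Fin d) ℝ,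
    ∀ x ∈ hull s, ψ j x = MvPolynomial.eval (fun i => x i) P
  linearIndependent : LinearIndependent ℝ (fun j => (frontier Ω).domRestrict (ψ j))

/-! ### Finite element matrices -/

/-- The surface measure on `Γ = frontier Ω`. -/
def surfaceMeasure {d : ℕ} (Ω : Set (E d)) : Measure (E d) :=
  (μHE[d - 1] : Measure (E d)).restrict (frontier Ω)

/-- The tangential gradient at `x` along the linear subspace `W` of `ℝ^d`. -/
def tangentialGradient {d : ℕ} (W : Submodule ℝ (E d)) (q : E d → ℝ) (x : E d) : W :=
  ∇ (fun w : W => q (x + (w : E d))) 0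

/-- The matrices of a bulk-surface discretization, with indices `I` for the inner bulk nodes, `B`
for the boundary nodes of the bulk mesh (also used for the multiplier), `P` for the surface space. -/
structure FEMatrices (I B P : Type) where
  Mu : Matrix (I ⊕ B) (I ⊕ B) ℝ
  Ku : Matrix (I ⊕ B) (I ⊕ B) ℝ
  Mp : Matrix P P ℝ
  Kp : Matrix P P ℝ
  Bu : Matrix B (I ⊕ B) ℝ
  Bp : Matrix B P ℝ
  Ml : Matrix B B ℝ

/-- Mass, stiffness and coupling matrices of the spaces `V_h = P_k(𝒯)`, `M_h = V_h|_Γ` (with the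
traces of the boundary nodal functions as basis), and `Q_h = span ψ`. -/
def feMatrices {d : ℕ} {Ω : Set (E d)} (α κ : E d → ℝ) (k : ℕ) (𝒯 : BulkMesh Ω)
    (𝒢 : SurfaceMesh 𝒯) {N : ℕ} (ψ : Fin N → E d → ℝ) :
    FEMatrices (𝒯.InnerNode k) (𝒯.BoundaryNode k) (Fin N) where
  Mu := .of fun i j => ∫ x in Ω, 𝒯.basis k i x * 𝒯.basis k j x
  Ku := .of fun i j => ∫ x in Ω, α x * inner ℝ (∇ (𝒯.basis k i) x) (∇ (𝒯.basis k j) x)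
  Mp := .of fun i j => ∫ x, ψ i x * ψ j x ∂surfaceMeasure Ω
  Kp := .of fun i j => ∑ s ∈ 𝒢.facets, ∫ x in hull s,
    κ x * inner ℝ (tangentialGradient (vectorSpan ℝ (s : Set (E d))) (ψ i) x)
      (tangentialGradient (vectorSpan ℝ (s : Set (E d))) (ψ j) x) ∂surfaceMeasure Ω
  Bu := .of fun i j => ∫ x, 𝒯.basis k (Sum.inr i) x * 𝒯.basis k j x ∂surfaceMeasure Ω
  Bp := .of fun i j => ∫ x, 𝒯.basis k (Sum.inr i) x * ψ j x ∂surfaceMeasure Ω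
  Ml := .of fun i j => ∫ x, 𝒯.basis k (Sum.inr i) x * 𝒯.basis k (Sum.inr j) x ∂surfaceMeasure Ω

/-- The squared (semi-)norm `‖x‖_M² = xᵀ M x`. -/
def sqNorm {ι : Type} [Fintype ι] (M : Matrix ι ι ℝ) (x : ι → ℝ) : ℝ := x ⬝ᵥ (M *ᵥ x)

/-! ### Semi-discrete problem and time stepping -/

section Schemes

variable {I B P : Type} [Fintype I] [Fintype B] [DecidableEq B] [Fintype P]

/-- `(u, p, lam)` solves the semi-discrete system with right-hand sides `fu, fp` on the time
set `J`. -/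
structure IsSemidiscreteSolution (S : FEMatrices I B P) (fu : ℝ → I ⊕ B → ℝ) (fp : ℝ → P → ℝ)
    (J : Set ℝ) (u : ℝ → I ⊕ B → ℝ) (p : ℝ → P → ℝ) (lam : ℝ → B → ℝ) : Prop where
  bulk : ∀ t ∈ J, S.Mu *ᵥ deriv u t + S.Ku *ᵥ u t - S.Buᵀ *ᵥ lam t = fu t
  surface : ∀ t ∈ J, S.Mp *ᵥ deriv p t + S.Kp *ᵥ p t + S.Bpᵀ *ᵥ lam t = fp t
  coupling : ∀ t ∈ J, S.Bu *ᵥ u t = S.Bp *ᵥ p t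

/-- The BDF-2 difference quotient `(3 x^m - 4 x^(m-1) + x^(m-2)) / (2τ)`. -/
def bdf {ι : Type} (τ : ℝ) (x : ℤ → ι → ℝ) (m : ℤ) : ι → ℝ :=
  (2 * τ)⁻¹ • ((3 : ℝ) • x m - (4 : ℝ) • x (m - 1) + x (m - 2))

/-- The delayed difference quotient `(5 x^m - 8 x^(m-1) + 3 x^(m-2)) / (2τ)`. -/
def delayed {ι : Type} (τ : ℝ) (x : ℤ → ι → ℝ) (m : ℤ) : ι → ℝ :=
  (2 * τ)⁻¹ • ((5 : ℝ) • x m - (8 : ℝ) • x (m - 1) + (3 : ℝ) • x (m - 2))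

/-- One step of the auxiliary splitting scheme with step size `τ`, producing the iterates with
index `m` (at time `m τ`) from those with index `m-1`, `m-2`, `m-3`. -/
structure IsAuxiliaryStep (S : FEMatrices I B P) (fu : ℝ → I ⊕ B → ℝ) (fp : ℝ → P → ℝ)
    (τ : ℝ) (u : ℤ → I ⊕ B → ℝ) (p : ℤ → P → ℝ) (lam : ℤ → B → ℝ) (m : ℤ) : Prop where
  inner : S.Mu.toBlocks₁₁ *ᵥ bdf τ (fun j => u j ∘ Sum.inl) m
        + S.Ku.toBlocks₁₁ *ᵥ (u m ∘ Sum.inl)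
      = fu (m * τ) ∘ Sum.inl
        - S.Mu.toBlocks₁₂ *ᵥ (S.Ml⁻¹ *ᵥ (S.Bp *ᵥ delayed τ p (m - 1)))
        - S.Ku.toBlocks₁₂ *ᵥ (S.Ml⁻¹ *ᵥ (S.Bp *ᵥ ((2 : ℝ) • p (m - 1) - p (m - 2))))
  multiplier : S.Mu.toBlocks₂₁ *ᵥ bdf τ (fun j => u j ∘ Sum.inl) m
        + S.Ku.toBlocks₂₁ *ᵥ (u m ∘ Sum.inl) - S.Ml *ᵥ lam m
      = fu (m * τ) ∘ Sum.inr
        - S.Mu.toBlocks₂₂ *ᵥ (S.Ml⁻¹ *ᵥ (S.Bp *ᵥ delayed τ p (m - 1)))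
        - S.Ku.toBlocks₂₂ *ᵥ (S.Ml⁻¹ *ᵥ (S.Bp *ᵥ ((2 : ℝ) • p (m - 1) - p (m - 2))))
  surface : S.Mp *ᵥ bdf τ p m + S.Kp *ᵥ p m + S.Bpᵀ *ᵥ lam m = fp (m * τ)
  boundary : S.Ml *ᵥ (u m ∘ Sum.inr) = S.Bp *ᵥ p m

/-- The regularity functional on the time interval `[a, b]`: squared `L²`-in-time norms of the
third and fourth time derivatives of `u, p` in the mass norms, and of the second and third time
derivatives of the boundary part `u₂` in the seminorm of the block `K₂₂`. -/
def regularity (S : FEMatrices I B P) (a b : ℝ) (u : ℝ → I ⊕ B → ℝ) (p : ℝ → P → ℝ) : ℝ :=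
  ∫ t in a..b,
    (sqNorm S.Mu (iteratedDeriv 3 u t) + sqNorm S.Mu (iteratedDeriv 4 u t)
      + sqNorm S.Mp (iteratedDeriv 3 p t) + sqNorm S.Mp (iteratedDeriv 4 p t)
      + sqNorm S.Ku.toBlocks₂₂ (iteratedDeriv 2 u t ∘ Sum.inr)
      + sqNorm S.Ku.toBlocks₂₂ (iteratedDeriv 3 u t ∘ Sum.inr))

/-- Squared error `‖û^n - u(t^n)‖² + ‖p^n - p(t^n)‖²`, `t^n = n τ`, in the norms of the matrices
`X` (bulk) and `Y` (surface). -/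
def sqError (X : Matrix (I ⊕ B) (I ⊕ B) ℝ) (Y : Matrix P P ℝ) (τ : ℝ)
    (uh : ℤ → I ⊕ B → ℝ) (ph : ℤ → P → ℝ) (u : ℝ → I ⊕ B → ℝ) (p : ℝ → P → ℝ) (n : ℤ) : ℝ :=
  sqNorm X (uh n - u (n * τ)) + sqNorm Y (ph n - p (n * τ))

end Schemes

end BulkSurface

end

open BulkSurface

/-!
The proof combines an energy estimate for the errors, which uses only the matrices, with inverse
estimates for nodal functions at the boundary, which put the finite element matrices within reach
of the energy estimate.

**Energy estimate.** Let `eu, ep` be the errors and `δ` the backward difference. The boundary values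
`v` of `eu` satisfy `Ml v = Bp ep`, also at the negative time levels, because the initial data are
consistent. In terms of the errors the scheme replaces the boundary part of the BDF-2 quotient by
one that differs from it by `3/2 δ³ v / τ`, and the boundary value by its extrapolation
`v - δ² v`. The multiplier disappears when the bulk equation is tested with a vector whose boundary
part is `v` and the surface equation with `ep` (`tested_error_equation`). The inner part of the
test vector is `e₁ + 3/2 δ² e₁`, where `e₁` is the inner part of `eu`; written as
`eu + 3/2 δ² eu - 3/2 (0, δ² v)`, it turns the mass and stiffness terms into telescoping energies
plus squares, up to terms in `(0, δ² v)` (`mass_identity`, `stiff_identity`). These remaining terms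
are absorbed by the dissipation `‖δ² ep‖²` of BDF-2 on the surface (`bdf_identity`), provided that
`‖(0, δ² v)‖²` in the bulk mass norm and `τ ‖(0, δ² v)‖²` in the bulk stiffness norm are small
multiples of `‖δ² ep‖²` in the surface mass norm. `IsStableCoupling` records this condition, and
`energy_estimate` draws the conclusion without a Gronwall argument. Taylor expansion bounds the
defects by the regularity functional, and `IsStableCoupling.convergence` follows.

**Inverse estimates.** A bulk function with boundary values `x` that vanishes at the inner nodes is
supported in the simplices touching `Γ`. Its squared `L²(Ω)` norm is at most a multiple of
`h^d ∑ x_b²`, and its squared energy norm at most a multiple of `h^(d-2) ∑ x_b²`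
(`integral_sq_shape_le`, `integral_sq_gradient_shape_le`); a volume packing argument bounds the
number of simplices at a node (`IsQuasiUniform.card_le`). Conversely `h^(d-1) ∑ x_b²` is at most a
multiple of the squared `L²(Γ)` norm of the trace (`exists_sum_sq_le`), by a compactness argument on
a reference simplex (`exists_ref_lower`) that is transported to the faces by maps stretching
distances by at least a multiple of `h` (`map_simplexMap_le`). If `Ml x = Bp y`, the trace is the
`L²(Γ)` projection of the surface function with coefficients `y`, so its norm is at most that of
`y`. Together the mass and stiffness norms squared are at most `C h` and `C / h` times the squared
surface norm of `y`, which is what `IsStableCoupling` asks for if `h` and `τ / h` are small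
(`exists_isStableCoupling`).
-/

noncomputable section

namespace BulkSurface

/-! ### Energy estimate for the error recursion -/

section EnergyStep

variable {H : Type*} [NormedAddCommGroup H] [InnerProductSpace ℝ H]

/-- Energy contributed by the mass form of the bulk: the `G`-norm of BDF-2, the energy of the first
difference, and a correction that compensates the delayed boundary values `X = δ² x`. -/
def massEnergy (a₀ a₁ X : H) : ℝ :=
  1 / 4 * (‖a₀‖ ^ 2 + ‖(2 : ℝ) • a₀ - a₁‖ ^ 2) + 3 / 4 * ‖a₀ - a₁‖ ^ 2
    - 3 / 2 * inner ℝ ((2 : ℝ) • a₀ - a₁) X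

/-- The BDF-2 `G`-norm. -/
def bdfEnergy (b₀ b₁ : H) : ℝ := 1 / 4 * (‖b₀‖ ^ 2 + ‖(2 : ℝ) • b₀ - b₁‖ ^ 2)

/-- The energy of the stiffness form that telescopes for the multiplier `1 + 3/2 δ²`. -/
def stiffEnergy (p₀ p₁ : H) : ℝ := 3 / 4 * (‖p₀‖ ^ 2 + ‖p₀ - p₁‖ ^ 2)

/-- The BDF-2 form of the bulk, with the third difference `X₀ - X₁` of the boundary values, tested
with the multiplier `1 + 3/2 δ²` acting in the interior only. -/
theorem mass_identity (a₀ a₁ a₂ X₀ X₁ : H) :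
    inner ℝ ((3 / 2 : ℝ) • a₀ - (2 : ℝ) • a₁ + (1 / 2 : ℝ) • a₂ - (3 / 2 : ℝ) • (X₀ - X₁))
        (a₀ + (3 / 2 : ℝ) • (a₀ - (2 : ℝ) • a₁ + a₂) - (3 / 2 : ℝ) • X₀)
      = massEnergy a₀ a₁ X₀ - massEnergy a₁ a₂ X₁
        + (7 / 4 * ‖a₀ - (2 : ℝ) • a₁ + a₂‖ ^ 2
          - 3 * inner ℝ (a₀ - (2 : ℝ) • a₁ + a₂) X₀
          + 15 / 4 * inner ℝ (a₀ - (2 : ℝ) • a₁ + a₂) X₁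
          + 9 / 4 * ‖X₀‖ ^ 2 - 9 / 4 * inner ℝ X₀ X₁) := by
  simp only [massEnergy, ← real_inner_self_eq_norm_sq, inner_add_left, inner_sub_left,
    inner_add_right, inner_sub_right, real_inner_smul_left, real_inner_smul_right]
  rw [real_inner_comm a₀ a₁, real_inner_comm a₀ a₂, real_inner_comm a₁ a₂, real_inner_comm a₀ X₀,
    real_inner_comm a₁ X₀, real_inner_comm a₂ X₀, real_inner_comm a₀ X₁, real_inner_comm a₁ X₁,
    real_inner_comm a₂ X₁, real_inner_comm X₀ X₁]
  ring

/-- The `G`-stability identity of BDF-2; its dissipation `‖δ² b‖²` controls the splitting error. -/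
theorem bdf_identity (b₀ b₁ b₂ : H) :
    inner ℝ ((3 / 2 : ℝ) • b₀ - (2 : ℝ) • b₁ + (1 / 2 : ℝ) • b₂) b₀
      = bdfEnergy b₀ b₁ - bdfEnergy b₁ b₂ + 1 / 4 * ‖b₀ - (2 : ℝ) • b₁ + b₂‖ ^ 2 := by
  simp only [bdfEnergy, ← real_inner_self_eq_norm_sq, inner_add_left, inner_sub_left,
    inner_add_right, inner_sub_right, real_inner_smul_left, real_inner_smul_right]
  rw [real_inner_comm b₀ b₁, real_inner_comm b₀ b₂, real_inner_comm b₁ b₂]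
  ring

theorem stiff_identity (p₀ p₁ p₂ Y : H) :
    inner ℝ (p₀ - Y) (p₀ + (3 / 2 : ℝ) • (p₀ - (2 : ℝ) • p₁ + p₂) - (3 / 2 : ℝ) • Y)
      = stiffEnergy p₀ p₁ - stiffEnergy p₁ p₂ + 1 / 4 * ‖p₀‖ ^ 2 + 3 / 4 * ‖p₀ - p₁ + p₂‖ ^ 2
        - (3 * inner ℝ (p₀ - p₁ + p₂) Y + inner ℝ p₀ Y - 3 / 2 * inner ℝ p₂ Y)
        + 3 / 2 * ‖Y‖ ^ 2 := by
  simp only [stiffEnergy, ← real_inner_self_eq_norm_sq, inner_add_left, inner_sub_left,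
    inner_add_right, inner_sub_right, real_inner_smul_right]
  rw [real_inner_comm p₀ p₁, real_inner_comm p₀ p₂, real_inner_comm p₁ p₂, real_inner_comm p₀ Y,
    real_inner_comm p₁ Y, real_inner_comm p₂ Y]
  ring

/-- Young's inequality with weight `η`. -/
theorem abs_inner_le_young (x y : H) (c η : ℝ) (hη : 0 < η) :
    |c * inner ℝ x y| ≤ η * ‖x‖ ^ 2 + c ^ 2 / (4 * η) * ‖y‖ ^ 2 := by
  have h1 : |c * inner ℝ x y| ≤ |c| * (‖x‖ * ‖y‖) := by
    rw [abs_mul]; exact mul_le_mul_of_nonneg_left (abs_real_inner_le_norm x y) (abs_nonneg c)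
  have h2 : η * ‖x‖ ^ 2 + c ^ 2 / (4 * η) * ‖y‖ ^ 2 - |c| * (‖x‖ * ‖y‖)
      = η * (‖x‖ - |c| / (2 * η) * ‖y‖) ^ 2 := by
    rw [← sq_abs c]; field_simp; ring
  have h3 : 0 ≤ η * (‖x‖ - |c| / (2 * η) * ‖y‖) ^ 2 := by positivity
  linarith

theorem inner_le_young (x y : H) (c η : ℝ) (hη : 0 < η) :
    c * inner ℝ x y ≤ η * ‖x‖ ^ 2 + c ^ 2 / (4 * η) * ‖y‖ ^ 2 :=
  (le_abs_self _).trans (abs_inner_le_young x y c η hη)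

theorem neg_inner_le_young (x y : H) (c η : ℝ) (hη : 0 < η) :
    -(c * inner ℝ x y) ≤ η * ‖x‖ ^ 2 + c ^ 2 / (4 * η) * ‖y‖ ^ 2 :=
  (neg_le_abs _).trans (abs_inner_le_young x y c η hη)

theorem le_massEnergy (a₀ a₁ X : H) : 1 / 4 * ‖a₀‖ ^ 2 - 9 / 4 * ‖X‖ ^ 2 ≤ massEnergy a₀ a₁ X := by
  have h := inner_le_young ((2 : ℝ) • a₀ - a₁) X (3 / 2) (1 / 4) (by norm_num)
  have h2 : 0 ≤ ‖a₀ - a₁‖ ^ 2 := by positivity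
  rw [massEnergy]
  linarith

theorem massEnergy_le (a₀ a₁ X : H) :
    massEnergy a₀ a₁ X ≤ 8 * (‖a₀‖ ^ 2 + ‖a₁‖ ^ 2) + 9 / 4 * ‖X‖ ^ 2 := by
  have h := neg_inner_le_young ((2 : ℝ) • a₀ - a₁) X (3 / 2) (1 / 4) (by norm_num)
  have h1 : ‖(2 : ℝ) • a₀ - a₁‖ ≤ 2 * ‖a₀‖ + ‖a₁‖ :=
    (norm_sub_le _ _).trans (by rw [norm_smul]; simp)
  have h2 : ‖a₀ - a₁‖ ≤ ‖a₀‖ + ‖a₁‖ := norm_sub_le _ _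
  have h3 := pow_le_pow_left₀ (norm_nonneg _) h1 2
  have h4 := pow_le_pow_left₀ (norm_nonneg _) h2 2
  rw [massEnergy]
  nlinarith [sq_nonneg (‖a₀‖ - ‖a₁‖), sq_nonneg (‖a₀‖ - 2 * ‖a₁‖), norm_nonneg a₀, norm_nonneg a₁]

theorem bdfEnergy_le (b₀ b₁ : H) : bdfEnergy b₀ b₁ ≤ 8 * (‖b₀‖ ^ 2 + ‖b₁‖ ^ 2) := by
  have h1 : ‖(2 : ℝ) • b₀ - b₁‖ ≤ 2 * ‖b₀‖ + ‖b₁‖ :=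
    (norm_sub_le _ _).trans (by rw [norm_smul]; simp)
  have h3 := pow_le_pow_left₀ (norm_nonneg _) h1 2
  rw [bdfEnergy]
  nlinarith [sq_nonneg (‖b₀‖ - 2 * ‖b₁‖), norm_nonneg b₀, norm_nonneg b₁]

omit [InnerProductSpace ℝ H] in
theorem stiffEnergy_le (b₀ b₁ : H) : stiffEnergy b₀ b₁ ≤ 8 * (‖b₀‖ ^ 2 + ‖b₁‖ ^ 2) := by
  have h3 := pow_le_pow_left₀ (norm_nonneg _) (norm_sub_le b₀ b₁) 2
  rw [stiffEnergy]
  nlinarith [sq_nonneg (‖b₀‖ - ‖b₁‖), norm_nonneg b₀, norm_nonneg b₁]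

theorem norm_sq_secondDiff_le (b₀ b₁ b₂ : H) :
    ‖b₀ - (2 : ℝ) • b₁ + b₂‖ ^ 2 ≤ 6 * (‖b₀‖ ^ 2 + 2 * ‖b₁‖ ^ 2 + ‖b₂‖ ^ 2) := by
  have h1 : ‖b₀ - (2 : ℝ) • b₁ + b₂‖ ≤ ‖b₀‖ + 2 * ‖b₁‖ + ‖b₂‖ :=
    (norm_add_le _ _).trans (add_le_add_left ((norm_sub_le _ _).trans (by rw [norm_smul]; simp)) _)
  have h3 := pow_le_pow_left₀ (norm_nonneg _) h1 2
  nlinarith [sq_nonneg (‖b₀‖ - ‖b₁‖), sq_nonneg (‖b₀‖ - ‖b₂‖), sq_nonneg (‖b₁‖ - ‖b₂‖),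
    sq_nonneg (‖b₀‖ - 2 * ‖b₁‖), sq_nonneg (‖b₂‖ - 2 * ‖b₁‖)]

/-- Lower bound of the mass form tested with the multiplier `1 + 3/2 δ²` (in the interior
variables), up to squares of the delayed quantities. -/
theorem mass_lower (a₀ a₁ a₂ X₀ X₁ : H) :
    massEnergy a₀ a₁ X₀ - massEnergy a₁ a₂ X₁ - 10 * (‖X₀‖ ^ 2 + ‖X₁‖ ^ 2) ≤
    inner ℝ ((3 / 2 : ℝ) • a₀ - (2 : ℝ) • a₁ + (1 / 2 : ℝ) • a₂ - (3 / 2 : ℝ) • (X₀ - X₁))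
        (a₀ + (3 / 2 : ℝ) • (a₀ - (2 : ℝ) • a₁ + a₂) - (3 / 2 : ℝ) • X₀) := by
  rw [mass_identity]
  set D := a₀ - (2 : ℝ) • a₁ + a₂
  have h1 := inner_le_young D X₀ 3 (1 / 2) (by norm_num)
  have h2 := neg_inner_le_young D X₁ (15 / 4) (1 / 2) (by norm_num)
  have h3 := inner_le_young X₀ X₁ (9 / 4) (9 / 8) (by norm_num)
  have hD : 0 ≤ ‖D‖ ^ 2 := by positivity
  have hX0 : 0 ≤ ‖X₀‖ ^ 2 := by positivity
  have hX1 : 0 ≤ ‖X₁‖ ^ 2 := by positivity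
  linarith

/-- Lower bound of the stiffness form; the multiples of `‖p₀‖²` and `‖p₂‖²` are small enough to be
absorbed, with shifted index, by the term `1/4 ‖p₀‖²`. -/
theorem stiff_lower (p₀ p₁ p₂ Y : H) :
    stiffEnergy p₀ p₁ - stiffEnergy p₁ p₂ + 1 / 4 * ‖p₀‖ ^ 2
        - 1 / 32 * (‖p₀‖ ^ 2 + ‖p₂‖ ^ 2) - 30 * ‖Y‖ ^ 2 ≤
      inner ℝ (p₀ - Y) (p₀ + (3 / 2 : ℝ) • (p₀ - (2 : ℝ) • p₁ + p₂) - (3 / 2 : ℝ) • Y) := by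
  rw [stiff_identity]
  have h1 := inner_le_young (p₀ - p₁ + p₂) Y 3 (3 / 4) (by norm_num)
  have h2 := inner_le_young p₀ Y 1 (1 / 32) (by norm_num)
  have h3 := neg_inner_le_young p₂ Y (3 / 2) (1 / 32) (by norm_num)
  have hY : 0 ≤ ‖Y‖ ^ 2 := by positivity
  linarith

/-- A defect tested with the multiplier. -/
theorem defect_le (ρ a₀ a₁ a₂ X : H) (η : ℝ) (hη : 0 < η) :
    -inner ℝ ρ (a₀ + (3 / 2 : ℝ) • (a₀ - (2 : ℝ) • a₁ + a₂) - (3 / 2 : ℝ) • X)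
      ≤ η * (‖a₀‖ ^ 2 + ‖a₁‖ ^ 2 + ‖a₂‖ ^ 2 + ‖X‖ ^ 2) + 5 / η * ‖ρ‖ ^ 2 := by
  have h1 := neg_inner_le_young a₀ ρ (5 / 2) η hη
  have h2 := inner_le_young a₁ ρ 3 η hη
  have h3 := neg_inner_le_young a₂ ρ (3 / 2) η hη
  have h4 := inner_le_young X ρ (3 / 2) η hη
  have hρ : 0 ≤ ‖ρ‖ ^ 2 / η := by positivity
  have e : -inner ℝ ρ (a₀ + (3 / 2 : ℝ) • (a₀ - (2 : ℝ) • a₁ + a₂) - (3 / 2 : ℝ) • X)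
      = -(5 / 2 * inner ℝ a₀ ρ) + 3 * inner ℝ a₁ ρ + -(3 / 2 * inner ℝ a₂ ρ)
        + 3 / 2 * inner ℝ X ρ := by
    simp only [inner_add_right, inner_sub_right, real_inner_smul_right]
    rw [real_inner_comm ρ a₀, real_inner_comm ρ a₁, real_inner_comm ρ a₂, real_inner_comm ρ X]
    ring
  have e2 : ∀ c : ℝ, c ^ 2 / (4 * η) * ‖ρ‖ ^ 2 = c ^ 2 / 4 * (‖ρ‖ ^ 2 / η) := by
    intro c; field_simp
  have e3 : 5 / η * ‖ρ‖ ^ 2 = 5 * (‖ρ‖ ^ 2 / η) := by ring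
  rw [e2] at h1 h2 h3 h4
  rw [e, e3]
  linarith

end EnergyStep

section EnergySum

/-- A telescoping energy inequality whose right-hand side contains `η`-small multiples of the energy
is closed by evaluating it at a time level where the energy is maximal; no exponential growth
occurs since the total weight `n τ η` is small. -/
theorem energy_bound_of_step {n : ℕ} {A G d Z D : ℤ → ℝ} {J κ : ℝ} (hJ : 0 ≤ J)
    (hA : ∀ j, 0 ≤ A j) (hG : ∀ j, 0 ≤ G j) (hD : ∀ j, 0 ≤ D j) (hd : ∀ j, 0 ≤ d j)
    (hinit : ∀ j : ℤ, -2 ≤ j → j ≤ 0 → A j ≤ J) (hZ0 : Z 0 ≤ 2000 * J)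
    (hlow : ∀ j : ℤ, 1 ≤ j → j ≤ n → 1 / 4 * A j - 1 / 8 * d j ≤ Z j)
    (hκ : 0 ≤ κ) (hκn : n * κ ≤ 1 / 24)
    (hstep : ∀ m : ℤ, 1 ≤ m → m ≤ n → Z m + 1 / 8 * d m + D m
      ≤ Z (m - 1) + κ * (A m + A (m - 1) + A (m - 2)) + G m) :
    1 ≤ n → A n + ∑ j ∈ Finset.Icc 1 n, D j ≤ 20000 * J + 20 * ∑ j ∈ Finset.Icc 1 n, G j := by
  intro hn
  obtain ⟨s, hs, hmax⟩ := Finset.exists_max_image (Finset.Icc (-2 : ℤ) n) A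
    ⟨0, by simp⟩
  set S := A s
  have hSb : ∀ j : ℤ, -2 ≤ j → j ≤ n → A j ≤ S := fun j h1 h2 => hmax j (by simp [h1, h2])
  have hS0 : 0 ≤ S := hA s
  set g : ℝ := ∑ j ∈ Finset.Icc 1 n, G j
  have hsum : ∀ j : ℕ, j ≤ n → Z j + (∑ i ∈ Finset.Icc 1 j, (1 / 8 * d i + D i))
      ≤ Z 0 + j * (3 * κ * S) + ∑ i ∈ Finset.Icc 1 j, G i := by
    intro j
    induction j with
    | zero => intro _; simp
    | succ j ih =>
      intro hj
      have h1 := ih (by omega)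
      have h2 := hstep ((j + 1 : ℕ) : ℤ) (by push_cast; omega) (by exact_mod_cast hj)
      have e1 : ((j + 1 : ℕ) : ℤ) - 1 = j := by push_cast; ring
      rw [e1] at h2
      have b0 := hSb ((j + 1 : ℕ) : ℤ) (by omega) (by exact_mod_cast hj)
      have b1 := hSb (j : ℤ) (by omega) (by omega)
      have b2 := hSb (((j + 1 : ℕ) : ℤ) - 2) (by push_cast; omega) (by push_cast; omega)
      rw [Finset.sum_Icc_succ_top (by omega), Finset.sum_Icc_succ_top (by omega)]
      have b3 : κ * (A ((j + 1 : ℕ) : ℤ) + A j + A (((j + 1 : ℕ) : ℤ) - 2)) ≤ κ * (3 * S) :=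
        mul_le_mul_of_nonneg_left (by linarith) hκ
      push_cast at *
      linarith
  have hgmono : ∀ j : ℕ, j ≤ n → ∑ i ∈ Finset.Icc 1 j, G i ≤ g := fun j hj =>
    Finset.sum_le_sum_of_subset_of_nonneg (Finset.Icc_subset_Icc_right hj) (fun _ _ _ => hG _)
  -- the dissipation at the last level pays for the lower bound of `Z`
  have hkey : ∀ j : ℕ, 1 ≤ j → j ≤ n → 1 / 4 * A j + ∑ i ∈ Finset.Icc 1 j, D i
      ≤ 2000 * J + 1 / 8 * S + g := by
    intro j h1 hj
    have h2 := hsum j hj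
    have h3 := hgmono j hj
    have h4 := hlow j (by exact_mod_cast h1) (by exact_mod_cast hj)
    have h5 : 1 / 8 * d j ≤ ∑ i ∈ Finset.Icc 1 j, 1 / 8 * d i :=
      Finset.single_le_sum (f := fun i : ℕ => 1 / 8 * d i)
        (fun i _ => mul_nonneg (by norm_num) (hd i)) (Finset.mem_Icc.2 ⟨h1, le_rfl⟩)
    rw [Finset.sum_add_distrib] at h2
    have h6 : (j : ℝ) * (3 * κ * S) ≤ 1 / 8 * S := by
      have : (j : ℝ) * κ ≤ 1 / 24 :=
        (mul_le_mul_of_nonneg_right (by exact_mod_cast hj) hκ).trans hκn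
      nlinarith
    linarith
  have hg0 : 0 ≤ g := Finset.sum_nonneg fun _ _ => hG _
  have hSle : S ≤ 16000 * J + 8 * g := by
    rw [Finset.mem_Icc] at hs
    rcases le_or_gt s 0 with h | h
    · have := hinit s hs.1 h
      change A s ≤ _
      linarith
    · obtain ⟨j, rfl⟩ := Int.eq_ofNat_of_zero_le h.le
      have h1 := hkey j (by omega) (by exact_mod_cast hs.2)
      have h2 : 0 ≤ ∑ i ∈ Finset.Icc 1 j, D i := Finset.sum_nonneg fun _ _ => hD _
      change 1 / 4 * S + _ ≤ _ at h1
      linarith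
  have h1 := hkey n hn le_rfl
  have h2 : 0 ≤ ∑ i ∈ Finset.Icc 1 n, D i := Finset.sum_nonneg fun _ _ => hD _
  have h3 := hA n
  linarith

end EnergySum

section EnergyEstimate

variable {H₁ H₂ H₃ H₄ : Type*} [NormedAddCommGroup H₁] [InnerProductSpace ℝ H₁]
  [NormedAddCommGroup H₂] [InnerProductSpace ℝ H₂] [NormedAddCommGroup H₃] [InnerProductSpace ℝ H₃]
  [NormedAddCommGroup H₄]

/-- The second backward difference. -/
def secondDiff {V : Type*} [AddCommGroup V] [Module ℝ V] (x : ℤ → V) (m : ℤ) : V :=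
  x m - (2 : ℝ) • x (m - 1) + x (m - 2)

/-- The stability estimate of the scheme, for the images `a, b, p, r` of the errors in the mass and
stiffness norms, and `X, Y` of the second differences of the boundary errors. -/
theorem energy_estimate {τ T J : ℝ} (hτ : 0 < τ) (hT : 0 < T) {n : ℕ} (hnT : n * τ ≤ T)
    (a X ρ : ℤ → H₁) (b ρp : ℤ → H₂) (p Y σ : ℤ → H₃) (r : ℤ → H₄)
    (hinit : ∀ j : ℤ, -2 ≤ j → j ≤ 0 → ‖a j‖ ^ 2 + ‖b j‖ ^ 2 + τ * (‖p j‖ ^ 2) ≤ J)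
    (hX : ∀ j : ℤ, 0 ≤ j → j ≤ n → ‖X j‖ ^ 2 ≤ 1 / 1000 * ‖secondDiff b j‖ ^ 2)
    (hY : ∀ j : ℤ, 1 ≤ j → j ≤ n → τ * ‖Y j‖ ^ 2 ≤ 1 / 1000 * ‖secondDiff b j‖ ^ 2)
    (heq : ∀ m : ℤ, 1 ≤ m → m ≤ n →
      inner ℝ ((3 / 2 : ℝ) • a m - (2 : ℝ) • a (m - 1) + (1 / 2 : ℝ) • a (m - 2)
          - (3 / 2 : ℝ) • (X m - X (m - 1)))
          (a m + (3 / 2 : ℝ) • (a m - (2 : ℝ) • a (m - 1) + a (m - 2)) - (3 / 2 : ℝ) • X m)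
        + inner ℝ ((3 / 2 : ℝ) • b m - (2 : ℝ) • b (m - 1) + (1 / 2 : ℝ) • b (m - 2)) (b m)
        + τ * inner ℝ (p m - Y m)
          (p m + (3 / 2 : ℝ) • (p m - (2 : ℝ) • p (m - 1) + p (m - 2)) - (3 / 2 : ℝ) • Y m)
        + τ * ‖r m‖ ^ 2
      = -(τ * inner ℝ (ρ m)
          (a m + (3 / 2 : ℝ) • (a m - (2 : ℝ) • a (m - 1) + a (m - 2)) - (3 / 2 : ℝ) • X m))
        - τ * inner ℝ (ρp m) (b m)
        - τ * inner ℝ (σ m)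
          (p m + (3 / 2 : ℝ) • (p m - (2 : ℝ) • p (m - 1) + p (m - 2)) - (3 / 2 : ℝ) • Y m)) :
    1 ≤ n → ‖a n‖ ^ 2 + ‖b n‖ ^ 2 + τ * ∑ j ∈ Finset.Icc 1 n, (‖p j‖ ^ 2 + ‖r j‖ ^ 2)
      ≤ 320000 * J + 60000 * (1 + T) *
        (τ * ∑ j ∈ Finset.Icc 1 n, (‖ρ j‖ ^ 2 + ‖ρp j‖ ^ 2 + ‖σ j‖ ^ 2)) := by
  intro hn
  have hJ : 0 ≤ J := le_trans (by positivity) (hinit 0 (by norm_num) le_rfl)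
  have hn1 : (1 : ℝ) ≤ n := by exact_mod_cast hn
  have hτT : τ ≤ T := by nlinarith
  -- with this weight in Young's inequality the total weight `n τ η` is at most `1 / 24`
  set η : ℝ := 1 / (24 * T) with hη
  have hη0 : 0 < η := by positivity
  have hητ : η * τ ≤ 1 / 24 := by
    rw [hη, div_mul_eq_mul_div, div_le_div_iff₀ (by positivity) (by norm_num)]; linarith
  have h5η : 5 / η = 120 * T := by rw [hη]; field_simp; norm_num
  have main := energy_bound_of_step (n := n) (A := fun j => ‖a j‖ ^ 2 + ‖b j‖ ^ 2)
    (G := fun j => τ * (160 * (1 + T) * (‖ρ j‖ ^ 2 + ‖ρp j‖ ^ 2 + ‖σ j‖ ^ 2)))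
    (d := fun j => ‖secondDiff b j‖ ^ 2)
    -- the additional terms telescope the contributions of earlier levels in the step inequality
    (Z := fun j => massEnergy (a j) (a (j - 1)) (X j) + bdfEnergy (b j) (b (j - 1))
      + τ * stiffEnergy (p j) (p (j - 1)) + 10 * ‖X j‖ ^ 2
      + τ * (1 / 8 * ‖p j‖ ^ 2 + 1 / 16 * ‖p (j - 1)‖ ^ 2))
    (D := fun j => 1 / 16 * (τ * (‖p j‖ ^ 2 + ‖r j‖ ^ 2))) (J := J) (κ := η * τ) hJ
    (fun j => by positivity) (fun j => by positivity) (fun j => by positivity)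
    (fun j => by positivity)
    (fun j h1 h2 => by
      have := hinit j h1 h2
      have h : 0 ≤ τ * ‖p j‖ ^ 2 := by positivity
      linarith) ?_ ?_ (by positivity) ?_ ?_ hn
  · rw [← Finset.mul_sum, ← Finset.mul_sum, ← Finset.mul_sum, ← Finset.mul_sum] at main
    have hA : 0 ≤ ‖a n‖ ^ 2 + ‖b n‖ ^ 2 := by positivity
    have hmul := mul_le_mul_of_nonneg_left main (by norm_num : (0 : ℝ) ≤ 16)
    have : 0 ≤ τ * ∑ j ∈ Finset.Icc 1 n, (‖ρ j‖ ^ 2 + ‖ρp j‖ ^ 2 + ‖σ j‖ ^ 2) := by positivity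
    nlinarith [mul_nonneg hT.le this]
  · have i0 := hinit 0 (by norm_num) le_rfl
    have i1 := hinit (-1) (by norm_num) (by norm_num)
    have i2 := hinit (-2) (by norm_num) (by norm_num)
    have hX0 := hX 0 le_rfl (by positivity)
    have e1 := massEnergy_le (a 0) (a (-1)) (X 0)
    have e2 := bdfEnergy_le (b 0) (b (-1))
    have e3 := mul_le_mul_of_nonneg_left (stiffEnergy_le (p 0) (p (-1))) hτ.le
    have e4 := norm_sq_secondDiff_le (b 0) (b (-1)) (b (-2))
    change ‖X 0‖ ^ 2 ≤ 1 / 1000 * ‖b 0 - (2 : ℝ) • b (-1) + b (-2)‖ ^ 2 at hX0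
    change massEnergy (a 0) (a (-1)) (X 0) + bdfEnergy (b 0) (b (-1))
      + τ * stiffEnergy (p 0) (p (-1)) + 10 * ‖X 0‖ ^ 2
      + τ * (1 / 8 * ‖p 0‖ ^ 2 + 1 / 16 * ‖p (-1)‖ ^ 2) ≤ _
    have a0 := sq_nonneg ‖a 0‖
    have a1 := sq_nonneg ‖a (-1)‖
    have a2 := sq_nonneg ‖a (-2)‖
    have b0 := sq_nonneg ‖b 0‖
    have b1 := sq_nonneg ‖b (-1)‖
    have b2 := sq_nonneg ‖b (-2)‖
    have p0 := mul_nonneg hτ.le (sq_nonneg ‖p 0‖)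
    have p1 := mul_nonneg hτ.le (sq_nonneg ‖p (-1)‖)
    have p2 := mul_nonneg hτ.le (sq_nonneg ‖p (-2)‖)
    linarith
  · intro j h1 h2
    have e1 := le_massEnergy (a j) (a (j - 1)) (X j)
    have e2 : 1 / 4 * ‖b j‖ ^ 2 ≤ bdfEnergy (b j) (b (j - 1)) := by
      rw [bdfEnergy]; nlinarith [sq_nonneg ‖(2 : ℝ) • b j - b (j - 1)‖]
    have e3 : 0 ≤ τ * stiffEnergy (p j) (p (j - 1)) := by rw [stiffEnergy]; positivity
    have e4 : 0 ≤ τ * (1 / 8 * ‖p j‖ ^ 2 + 1 / 16 * ‖p (j - 1)‖ ^ 2) := by positivity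
    have e5 : 0 ≤ ‖secondDiff b j‖ ^ 2 := by positivity
    have e6 : 0 ≤ ‖X j‖ ^ 2 := by positivity
    linarith
  · have : (n : ℝ) * (η * τ) = η * (n * τ) := by ring
    rw [this, hη, div_mul_eq_mul_div, div_le_div_iff₀ (by positivity) (by norm_num)]
    linarith
  · intro m h1 h2
    have hm := heq m h1 h2
    have l1 := mass_lower (a m) (a (m - 1)) (a (m - 2)) (X m) (X (m - 1))
    have l2 := bdf_identity (b m) (b (m - 1)) (b (m - 2))
    have l3 := mul_le_mul_of_nonneg_left
      (stiff_lower (p m) (p (m - 1)) (p (m - 2)) (Y m)) hτ.le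
    have r1 := mul_le_mul_of_nonneg_left
      (defect_le (ρ m) (a m) (a (m - 1)) (a (m - 2)) (X m) η hη0) hτ.le
    have r2 := mul_le_mul_of_nonneg_left
      (defect_le (σ m) (p m) (p (m - 1)) (p (m - 2)) (Y m) (1 / 32) (by norm_num)) hτ.le
    have r3 := mul_le_mul_of_nonneg_left
      (neg_inner_le_young (b m) (ρp m) 1 η hη0) hτ.le
    have hXm := hX m (by omega) h2
    have hYm := hY m h1 h2
    have e5 : 1 ^ 2 / (4 * η) = 6 * T := by rw [hη]; field_simp; norm_num
    rw [h5η] at r1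
    rw [e5, one_mul, real_inner_comm] at r3
    rw [show m - 1 - 1 = m - 2 by ring]
    have hXτ : η * τ * ‖X m‖ ^ 2 ≤ 1 / 24 * ‖X m‖ ^ 2 :=
      mul_le_mul_of_nonneg_right hητ (sq_nonneg _)
    change _ ≤ 1 / 1000 * ‖b m - (2 : ℝ) • b (m - 1) + b (m - 2)‖ ^ 2 at hXm
    change _ ≤ 1 / 1000 * ‖b m - (2 : ℝ) • b (m - 1) + b (m - 2)‖ ^ 2 at hYm
    simp only [secondDiff]
    have q0 := mul_nonneg hτ.le (sq_nonneg ‖ρ m‖)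
    have q1 := mul_nonneg hτ.le (sq_nonneg ‖ρp m‖)
    have q2 := mul_nonneg hτ.le (sq_nonneg ‖σ m‖)
    have q3 := mul_nonneg hT.le q0
    have q4 := mul_nonneg hT.le q1
    have q5 := mul_nonneg hT.le q2
    have q6 : 0 ≤ η * τ * ‖b (m - 1)‖ ^ 2 := by positivity
    have q7 : 0 ≤ η * τ * ‖b (m - 2)‖ ^ 2 := by positivity
    have q8 : 0 ≤ ‖b m - (2 : ℝ) • b (m - 1) + b (m - 2)‖ ^ 2 := by positivity
    have q9 : 0 ≤ τ * ‖r m‖ ^ 2 := by positivity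
    have q10 : 0 ≤ τ * ‖p m‖ ^ 2 := by positivity
    have q11 : 0 ≤ τ * ‖p (m - 1)‖ ^ 2 := by positivity
    have q12 : 0 ≤ τ * ‖p (m - 2)‖ ^ 2 := by positivity
    linarith

end EnergyEstimate

/-! ### Consistency of the difference quotients -/

section Consistency

/-- Cauchy–Schwarz in time. -/
theorem sq_integral_norm_le {H : Type*} [NormedAddCommGroup H] {g : ℝ → H} (hg : Continuous g)
    {a L : ℝ} (hL : 0 < L) :
    (∫ x in (a - L)..a, ‖g x‖) ^ 2 ≤ L * ∫ x in (a - L)..a, ‖g x‖ ^ 2 := by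
  set S := ∫ x in (a - L)..a, ‖g x‖
  have h0 : 0 ≤ ∫ x in (a - L)..a, (‖g x‖ - S / L) ^ 2 :=
    intervalIntegral.integral_nonneg (by linarith) (fun _ _ => sq_nonneg _)
  have e : ∫ x in (a - L)..a, (‖g x‖ - S / L) ^ 2
      = (∫ x in (a - L)..a, ‖g x‖ ^ 2) - 2 * (S / L) * S + (S / L) ^ 2 * L := by
    have e1 : ∀ x, (‖g x‖ - S / L) ^ 2 = ‖g x‖ ^ 2 - 2 * (S / L) * ‖g x‖ + (S / L) ^ 2 := by
      intro x; ring
    simp only [e1]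
    rw [intervalIntegral.integral_add, intervalIntegral.integral_sub,
      intervalIntegral.integral_const_mul, intervalIntegral.integral_const]
    · simp [S]; ring
    all_goals apply Continuous.intervalIntegrable; fun_prop
  rw [e] at h0
  have e2 : (∫ x in (a - L)..a, ‖g x‖ ^ 2) - 2 * (S / L) * S + (S / L) ^ 2 * L
      = (∫ x in (a - L)..a, ‖g x‖ ^ 2) - S ^ 2 / L := by field_simp; ring
  rw [e2, sub_nonneg, div_le_iff₀ hL] at h0
  linarith

variable {H : Type*} [NormedAddCommGroup H] [NormedSpace ℝ H]

theorem norm_sub_le_of_hasDerivAt {V V' : ℝ → H} {t L M : ℝ} (hV : ∀ s, HasDerivAt V (V' s) s)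
    (hM : ∀ s ∈ Set.Icc (t - L) t, ‖V' s‖ ≤ M) :
    ∀ s ∈ Set.Icc (t - L) t, ‖V s - V t‖ ≤ L * M := by
  intro s hs
  have ht : t ∈ Set.Icc (t - L) t := ⟨by linarith [hs.1, hs.2], le_rfl⟩
  have h := (convex_Icc (t - L) t).norm_image_sub_le_of_norm_hasDerivWithin_le
    (fun x _ => (hV x).hasDerivWithinAt) hM ht hs
  rw [mul_comm L]
  refine h.trans (mul_le_mul_of_nonneg_left ?_ ((norm_nonneg _).trans (hM s hs)))
  rw [Real.norm_eq_abs, abs_le]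
  constructor <;> linarith [hs.1, hs.2]

variable [CompleteSpace H]

theorem norm_sub_le_integral {W W' : ℝ → H} (hW : ∀ s, HasDerivAt W (W' s) s)
    (hc : Continuous W') {t L : ℝ} :
    ∀ s ∈ Set.Icc (t - L) t, ‖W s - W t‖ ≤ ∫ x in (t - L)..t, ‖W' x‖ := by
  intro s hs
  have h1 : ∫ x in s..t, W' x = W t - W s :=
    intervalIntegral.integral_eq_sub_of_hasDerivAt (fun x _ => hW x) (hc.intervalIntegrable _ _)
  rw [norm_sub_rev, ← h1]
  refine (intervalIntegral.norm_integral_le_integral_norm hs.2).trans ?_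
  exact intervalIntegral.integral_mono_interval hs.1 hs.2 le_rfl
    (Filter.Eventually.of_forall fun _ => norm_nonneg _) (hc.norm.intervalIntegrable _ _)

/-- First-order Taylor expansion backwards in time, with the remainder in `L¹`. -/
theorem taylor_one {U U₁ U₂ : ℝ → H} (h₀ : ∀ s, HasDerivAt U (U₁ s) s)
    (h₁ : ∀ s, HasDerivAt U₁ (U₂ s) s) (hc : Continuous U₂) {t L : ℝ} :
    ∀ s ∈ Set.Icc (t - L) t, ‖U s - U t - (s - t) • U₁ t‖
      ≤ L * ∫ x in (t - L)..t, ‖U₂ x‖ := by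
  intro s hs
  have := norm_sub_le_of_hasDerivAt (V := fun s => U s - (s - t) • U₁ t)
    (V' := fun s => U₁ s - (1 : ℝ) • U₁ t) (t := t) (L := L)
    (fun s => (h₀ s).sub (((hasDerivAt_id s).sub_const t).smul_const (U₁ t)))
    (by simpa using norm_sub_le_integral h₁ hc (t := t) (L := L)) s hs
  simp only [sub_self, zero_smul, sub_zero] at this
  rwa [sub_right_comm] at this

/-- Second-order Taylor expansion backwards in time, with the remainder in `L¹`. -/
theorem taylor_two {U U₁ U₂ U₃ : ℝ → H} (h₀ : ∀ s, HasDerivAt U (U₁ s) s)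
    (h₁ : ∀ s, HasDerivAt U₁ (U₂ s) s) (h₂ : ∀ s, HasDerivAt U₂ (U₃ s) s)
    (hc : Continuous U₃) {t L : ℝ} :
    ∀ s ∈ Set.Icc (t - L) t, ‖U s - U t - (s - t) • U₁ t - ((s - t) ^ 2 / 2) • U₂ t‖
      ≤ L * (L * ∫ x in (t - L)..t, ‖U₃ x‖) := by
  intro s hs
  have := norm_sub_le_of_hasDerivAt
    (V := fun s => U s - (s - t) • U₁ t - ((s - t) ^ 2 / 2) • U₂ t)
    (V' := fun s => U₁ s - (1 : ℝ) • U₁ t - (s - t) • U₂ t) (t := t) (L := L)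
    (fun s => by
      have e : HasDerivAt (fun s : ℝ => (s - t) ^ 2 / 2) (s - t) s := by
        have := (((hasDerivAt_id s).sub_const t).pow 2).div_const 2
        simpa using this
      exact ((h₀ s).sub (((hasDerivAt_id s).sub_const t).smul_const (U₁ t))).sub
        (e.smul_const (U₂ t)))
    (by simpa using taylor_one h₁ h₂ hc (t := t) (L := L)) s hs
  simp only [sub_self, zero_smul, sub_zero] at this
  convert this using 2
  simp only [ne_eq, OfNat.ofNat_ne_zero, not_false_eq_true, zero_pow, zero_div, zero_smul]
  abel

theorem secondDiff_consistency {U U₁ U₂ : ℝ → H} (h₀ : ∀ s, HasDerivAt U (U₁ s) s)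
    (h₁ : ∀ s, HasDerivAt U₁ (U₂ s) s) (hc : Continuous U₂) {t τ : ℝ} (hτ : 0 < τ) :
    ‖U t - (2 : ℝ) • U (t - τ) + U (t - 2 * τ)‖ ^ 2
      ≤ 12000 * τ ^ 3 * ∫ x in (t - 3 * τ)..t, ‖U₂ x‖ ^ 2 := by
  have hT := taylor_one h₀ h₁ hc (t := t) (L := 3 * τ)
  have hS := sq_integral_norm_le hc (a := t) (L := 3 * τ) (by positivity)
  set S := ∫ x in (t - 3 * τ)..t, ‖U₂ x‖
  have v1 := hT (t - τ) ⟨by linarith, by linarith⟩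
  have v2 := hT (t - 2 * τ) ⟨by linarith, by linarith⟩
  set w1 := U (t - τ) - U t - (t - τ - t) • U₁ t with hw1
  set w2 := U (t - 2 * τ) - U t - (t - 2 * τ - t) • U₁ t with hw2
  have e : U t - (2 : ℝ) • U (t - τ) + U (t - 2 * τ) = w2 - (2 : ℝ) • w1 := by
    rw [hw1, hw2]; module
  rw [e]
  have n1 : ‖w2 - (2 : ℝ) • w1‖ ≤ 3 * (3 * τ * S) :=
    (norm_sub_le _ _).trans (by rw [norm_smul]; norm_num; linarith)
  have n2 := pow_le_pow_left₀ (norm_nonneg _) n1 2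
  have hI : 0 ≤ τ ^ 3 * ∫ x in (t - 3 * τ)..t, ‖U₂ x‖ ^ 2 :=
    mul_nonneg (by positivity) (intervalIntegral.integral_nonneg (by linarith)
      (fun _ _ => sq_nonneg _))
  have := mul_le_mul_of_nonneg_left hS (sq_nonneg τ)
  nlinarith

theorem thirdDiff_consistency {U U₁ U₂ U₃ : ℝ → H} (h₀ : ∀ s, HasDerivAt U (U₁ s) s)
    (h₁ : ∀ s, HasDerivAt U₁ (U₂ s) s) (h₂ : ∀ s, HasDerivAt U₂ (U₃ s) s)
    (hc : Continuous U₃) {t τ : ℝ} (hτ : 0 < τ) :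
    ‖U t - (3 : ℝ) • U (t - τ) + (3 : ℝ) • U (t - 2 * τ) - U (t - 3 * τ)‖ ^ 2
      ≤ 12000 * τ ^ 5 * ∫ x in (t - 3 * τ)..t, ‖U₃ x‖ ^ 2 := by
  have hT := taylor_two h₀ h₁ h₂ hc (t := t) (L := 3 * τ)
  have hS := sq_integral_norm_le hc (a := t) (L := 3 * τ) (by positivity)
  set S := ∫ x in (t - 3 * τ)..t, ‖U₃ x‖
  have v1 := hT (t - τ) ⟨by linarith, by linarith⟩
  have v2 := hT (t - 2 * τ) ⟨by linarith, by linarith⟩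
  have v3 := hT (t - 3 * τ) ⟨by linarith, by linarith⟩
  set w1 := U (t - τ) - U t - (t - τ - t) • U₁ t - ((t - τ - t) ^ 2 / 2) • U₂ t with hw1
  set w2 := U (t - 2 * τ) - U t - (t - 2 * τ - t) • U₁ t - ((t - 2 * τ - t) ^ 2 / 2) • U₂ t with hw2
  set w3 := U (t - 3 * τ) - U t - (t - 3 * τ - t) • U₁ t - ((t - 3 * τ - t) ^ 2 / 2) • U₂ t with hw3
  have e : U t - (3 : ℝ) • U (t - τ) + (3 : ℝ) • U (t - 2 * τ) - U (t - 3 * τ)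
      = (3 : ℝ) • w2 - (3 : ℝ) • w1 - w3 := by
    rw [hw1, hw2, hw3]; module
  rw [e]
  have n1 : ‖(3 : ℝ) • w2 - (3 : ℝ) • w1 - w3‖ ≤ 7 * (3 * τ * (3 * τ * S)) :=
    (norm_sub_le _ _).trans ((add_le_add_left (norm_sub_le _ _) _).trans
      (by rw [norm_smul, norm_smul]; norm_num; linarith))
  have n2 := pow_le_pow_left₀ (norm_nonneg _) n1 2
  have hI : 0 ≤ τ ^ 5 * ∫ x in (t - 3 * τ)..t, ‖U₃ x‖ ^ 2 :=
    mul_nonneg (by positivity) (intervalIntegral.integral_nonneg (by linarith)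
      (fun _ _ => sq_nonneg _))
  have := mul_le_mul_of_nonneg_left hS (by positivity : 0 ≤ τ ^ 4)
  nlinarith

theorem bdf_consistency {U U₁ U₂ U₃ : ℝ → H} (h₀ : ∀ s, HasDerivAt U (U₁ s) s)
    (h₁ : ∀ s, HasDerivAt U₁ (U₂ s) s) (h₂ : ∀ s, HasDerivAt U₂ (U₃ s) s)
    (hc : Continuous U₃) {t τ : ℝ} (hτ : 0 < τ) :
    ‖(3 / 2 : ℝ) • U t - (2 : ℝ) • U (t - τ) + (1 / 2 : ℝ) • U (t - 2 * τ) - τ • U₁ t‖ ^ 2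
      ≤ 12000 * τ ^ 5 * ∫ x in (t - 3 * τ)..t, ‖U₃ x‖ ^ 2 := by
  have hT := taylor_two h₀ h₁ h₂ hc (t := t) (L := 3 * τ)
  have hS := sq_integral_norm_le hc (a := t) (L := 3 * τ) (by positivity)
  set S := ∫ x in (t - 3 * τ)..t, ‖U₃ x‖
  have v1 := hT (t - τ) ⟨by linarith, by linarith⟩
  have v2 := hT (t - 2 * τ) ⟨by linarith, by linarith⟩
  set w1 := U (t - τ) - U t - (t - τ - t) • U₁ t - ((t - τ - t) ^ 2 / 2) • U₂ t with hw1
  set w2 := U (t - 2 * τ) - U t - (t - 2 * τ - t) • U₁ t - ((t - 2 * τ - t) ^ 2 / 2) • U₂ t with hw2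
  have e : (3 / 2 : ℝ) • U t - (2 : ℝ) • U (t - τ) + (1 / 2 : ℝ) • U (t - 2 * τ) - τ • U₁ t
      = (1 / 2 : ℝ) • w2 - (2 : ℝ) • w1 := by
    rw [hw1, hw2]; module
  rw [e]
  have n1 : ‖(1 / 2 : ℝ) • w2 - (2 : ℝ) • w1‖ ≤ 7 * (3 * τ * (3 * τ * S)) := by
    refine (norm_sub_le _ _).trans ?_
    rw [norm_smul, norm_smul]; norm_num
    have := norm_nonneg w1
    linarith
  have n2 := pow_le_pow_left₀ (norm_nonneg _) n1 2
  have hI : 0 ≤ τ ^ 5 * ∫ x in (t - 3 * τ)..t, ‖U₃ x‖ ^ 2 :=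
    mul_nonneg (by positivity) (intervalIntegral.integral_nonneg (by linarith)
      (fun _ _ => sq_nonneg _))
  have := mul_le_mul_of_nonneg_left hS (by positivity : 0 ≤ τ ^ 4)
  nlinarith

/-- The windows of length `3τ` ending at the time levels cover each time at most three times. -/
theorem sum_window_integral_le {g : ℝ → ℝ} (hg : Continuous g) (h0 : ∀ x, 0 ≤ g x) {τ T : ℝ}
    (hτ : 0 < τ) {n : ℕ} (hn : n * τ ≤ T) :
    ∑ m ∈ Finset.Icc 1 n, ∫ x in (m * τ - 3 * τ)..(m * τ), g x ≤ 3 * ∫ x in (-2 * τ)..T, g x := by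
  set P : ℝ → ℝ := fun y => ∫ x in (-2 * τ)..y, g x with hP
  have hi : ∀ a b, IntervalIntegrable g volume a b := fun a b => hg.intervalIntegrable a b
  have hstep : ∀ a b, ∫ x in a..b, g x = P b - P a := fun a b => by
    rw [hP]; dsimp only
    rw [intervalIntegral.integral_interval_sub_left (hi _ _) (hi _ _)]
  have hmono : ∀ y, -2 * τ ≤ y → y ≤ T → P y ≤ P T ∧ 0 ≤ P y := fun y h1 h2 =>
    ⟨intervalIntegral.integral_mono_interval le_rfl h1 h2 (Filter.Eventually.of_forall h0)
      (hi _ _), intervalIntegral.integral_nonneg h1 (fun _ _ => h0 _)⟩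
  have hsum : ∀ j : ℕ, ∑ m ∈ Finset.Icc 1 j, ∫ x in (m * τ - 3 * τ)..(m * τ), g x
      = P (j * τ) + P (j * τ - τ) + P (j * τ - 2 * τ) - (P 0 + P (-τ) + P (-2 * τ)) := by
    intro j
    induction j with
    | zero => simp [neg_mul]
    | succ j ih =>
      rw [Finset.sum_Icc_succ_top (by omega), ih, hstep]
      push_cast
      rw [show (j + 1 : ℝ) * τ - 3 * τ = j * τ - 2 * τ by ring,
        show (j + 1 : ℝ) * τ - τ = j * τ by ring,
        show (j + 1 : ℝ) * τ - 2 * τ = j * τ - τ by ring]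
      ring
  have hn0 : 0 ≤ n * τ := by positivity
  rw [hsum]
  have := hmono (n * τ) (by linarith) hn
  have := hmono (n * τ - τ) (by linarith) (by linarith)
  have := hmono (n * τ - 2 * τ) (by linarith) (by linarith)
  have := hmono 0 (by linarith) (by linarith)
  have := hmono (-τ) (by linarith) (by linarith)
  have := hmono (-2 * τ) (by linarith) (by linarith)
  change _ ≤ 3 * P T
  linarith

end Consistency

/-! ### From the matrix equations to the energy estimate -/

/-- A positive semidefinite matrix is the Gram matrix of the coordinate vectors under a linear map
into a Euclidean space. -/
theorem exists_gram_factor {ι : Type} [Fintype ι] {M : Matrix ι ι ℝ} (hM : M.PosSemidef) :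
    ∃ L : (ι → ℝ) →L[ℝ] EuclideanSpace ℝ ι, ∀ x y, inner ℝ (L x) (L y) = y ⬝ᵥ (M *ᵥ x) := by
  classical
  open scoped MatrixOrder in
  obtain ⟨A, rfl⟩ := CStarAlgebra.nonneg_iff_eq_star_mul_self.1 (Matrix.nonneg_iff_posSemidef.2 hM)
  refine ⟨LinearMap.toContinuousLinearMap
    ((WithLp.linearEquiv 2 ℝ (ι → ℝ)).symm.toLinearMap ∘ₗ Matrix.toLin' A), fun x y => ?_⟩
  have e : ∀ z : ι → ℝ, (LinearMap.toContinuousLinearMap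
    ((WithLp.linearEquiv 2 ℝ (ι → ℝ)).symm.toLinearMap ∘ₗ Matrix.toLin' A)) z
      = WithLp.toLp 2 (A *ᵥ z) := fun z => rfl
  rw [e, e, EuclideanSpace.inner_toLp_toLp, star_eq_conjTranspose,
    conjTranspose_eq_transpose_of_trivial, star_trivial,
    ← Matrix.mulVec_mulVec, Matrix.dotProduct_mulVec y, Matrix.vecMul_transpose]

section Convergence

variable {I B P : Type}

/-- Extension of boundary coefficients by zero to the inner nodes. -/
def extendZero : (B → ℝ) →ₗ[ℝ] (I ⊕ B → ℝ) where
  toFun y := Sum.elim (0 : I → ℝ) y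
  map_add' x y := by ext (i | i) <;> simp
  map_smul' c y := by ext (i | i) <;> simp

theorem extendZero_inl (y : B → ℝ) (i : I) : extendZero (I := I) y (Sum.inl i) = 0 := rfl

theorem extendZero_inr (y : B → ℝ) (i : B) : extendZero (I := I) y (Sum.inr i) = y i := rfl

/-- Restriction of bulk coefficients to the boundary nodes. -/
def boundaryPart : (I ⊕ B → ℝ) →ₗ[ℝ] (B → ℝ) := LinearMap.funLeft ℝ ℝ Sum.inr

theorem boundaryPart_apply (x : I ⊕ B → ℝ) : boundaryPart x = x ∘ Sum.inr := rfl

variable [Fintype I] [Fintype B]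

theorem mulVec_elim (M : Matrix (I ⊕ B) (I ⊕ B) ℝ) (x : I → ℝ) (y : B → ℝ) :
    M *ᵥ Sum.elim x y = Sum.elim (M.toBlocks₁₁ *ᵥ x + M.toBlocks₁₂ *ᵥ y)
      (M.toBlocks₂₁ *ᵥ x + M.toBlocks₂₂ *ᵥ y) := by
  conv_lhs => rw [← Matrix.fromBlocks_toBlocks M]
  rw [Matrix.fromBlocks_mulVec]
  rfl

theorem sqNorm_extendZero (M : Matrix (I ⊕ B) (I ⊕ B) ℝ) (y : B → ℝ) :
    sqNorm M (extendZero y) = sqNorm M.toBlocks₂₂ y := by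
  have : extendZero (I := I) y = Sum.elim (0 : I → ℝ) y := rfl
  rw [sqNorm, this, mulVec_elim, sqNorm, sumElim_dotProduct_sumElim]
  simp

variable [Fintype P]

/-- Testing the error equations eliminates the multiplier: `d` collects the bulk error in the
discrete time derivative, `z` the one in the stiffness term, and the test function `w` has the
boundary values of the surface error `ep`. -/
theorem tested_error_equation {S : FEMatrices I B P} {τ : ℝ}
    (hBu : S.Bu = Matrix.fromCols 0 S.Ml) {dh du zh zu fu w : I ⊕ B → ℝ} {eh eu ph pu fp ep : P → ℝ}
    {lh lu : B → ℝ}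
    (h₁ : S.Mu *ᵥ dh + τ • S.Ku *ᵥ zh = τ • fu + τ • S.Buᵀ *ᵥ lh)
    (h₂ : S.Mu *ᵥ du + S.Ku *ᵥ zu - S.Buᵀ *ᵥ lu = fu)
    (h₃ : S.Mp *ᵥ eh + τ • S.Kp *ᵥ ph + τ • S.Bpᵀ *ᵥ lh = τ • fp)
    (h₄ : S.Mp *ᵥ eu + S.Kp *ᵥ pu + S.Bpᵀ *ᵥ lu = fp)
    (hw : S.Ml *ᵥ boundaryPart w = S.Bp *ᵥ ep) :
    w ⬝ᵥ (S.Mu *ᵥ (dh - τ • du)) + τ * (w ⬝ᵥ (S.Ku *ᵥ (zh - zu)))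
      + ep ⬝ᵥ (S.Mp *ᵥ (eh - τ • eu)) + τ * (ep ⬝ᵥ (S.Kp *ᵥ (ph - pu))) = 0 := by
  have hw' : S.Bu *ᵥ w = S.Bp *ᵥ ep := by
    rw [← hw, hBu, ← Sum.elim_comp_inl_inr w, Matrix.fromCols_mulVec_sumElim]
    simp [boundaryPart_apply]
  have k1 : ∀ l, w ⬝ᵥ (S.Buᵀ *ᵥ l) = (S.Bu *ᵥ w) ⬝ᵥ l := fun l => by
    rw [Matrix.dotProduct_mulVec, Matrix.vecMul_transpose]
  have k2 : ∀ l, ep ⬝ᵥ (S.Bpᵀ *ᵥ l) = (S.Bu *ᵥ w) ⬝ᵥ l := fun l => by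
    rw [Matrix.dotProduct_mulVec, Matrix.vecMul_transpose, hw']
  have g1 := congrArg (w ⬝ᵥ ·) h₁
  have g2 := congrArg (w ⬝ᵥ ·) h₂
  have g3 := congrArg (ep ⬝ᵥ ·) h₃
  have g4 := congrArg (ep ⬝ᵥ ·) h₄
  simp only [dotProduct_add, dotProduct_sub, dotProduct_smul, k1, k2, smul_eq_mul] at g1 g2 g3 g4
  simp only [Matrix.mulVec_sub, Matrix.mulVec_smul, dotProduct_sub, dotProduct_smul, smul_eq_mul]
  linear_combination g1 - τ * g2 + g3 - τ * g4

variable [DecidableEq B]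

/-- The bulk equations of the scheme in terms of all unknowns: the delayed boundary values are
replaced by the boundary values of the earlier iterates. -/
theorem IsAuxiliaryStep.bulk {S : FEMatrices I B P} {fu : ℝ → I ⊕ B → ℝ} {fp : ℝ → P → ℝ}
    {τ : ℝ} (hτ : 0 < τ) {u : ℤ → I ⊕ B → ℝ} {p : ℤ → P → ℝ} {lam : ℤ → B → ℝ} {m : ℤ}
    (h : IsAuxiliaryStep S fu fp τ u p lam m) (hdet : IsUnit S.Ml.det)
    (hBu : S.Bu = Matrix.fromCols 0 S.Ml) (hsymm : S.Mlᵀ = S.Ml)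
    (hu : ∀ j, m - 3 ≤ j → j ≤ m → S.Ml *ᵥ (u j ∘ Sum.inr) = S.Bp *ᵥ p j) :
    S.Mu *ᵥ ((3 / 2 : ℝ) • u m - (2 : ℝ) • u (m - 1) + (1 / 2 : ℝ) • u (m - 2)
        - (3 / 2 : ℝ) • extendZero (boundaryPart
          (u m - (3 : ℝ) • u (m - 1) + (3 : ℝ) • u (m - 2) - u (m - 3))))
      + τ • S.Ku *ᵥ (u m - extendZero (boundaryPart (u m - (2 : ℝ) • u (m - 1) + u (m - 2))))
      = τ • fu (m * τ) + τ • S.Buᵀ *ᵥ lam m := by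
  have hinv : ∀ j, m - 3 ≤ j → j ≤ m → S.Ml⁻¹ *ᵥ (S.Bp *ᵥ p j) = u j ∘ Sum.inr := by
    intro j h1 h2
    rw [← hu j h1 h2, Matrix.mulVec_mulVec, Matrix.nonsing_inv_mul _ hdet, Matrix.one_mulVec]
  have hdel : S.Ml⁻¹ *ᵥ (S.Bp *ᵥ delayed τ p (m - 1))
      = delayed τ (fun j => u j ∘ Sum.inr) (m - 1) := by
    simp only [delayed, Matrix.mulVec_smul, Matrix.mulVec_add, Matrix.mulVec_sub]
    rw [hinv _ (by omega) (by omega), hinv _ (by omega) (by omega), hinv _ (by omega) (by omega)]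
  have hext : S.Ml⁻¹ *ᵥ (S.Bp *ᵥ ((2 : ℝ) • p (m - 1) - p (m - 2)))
      = (2 : ℝ) • (u (m - 1) ∘ Sum.inr) - u (m - 2) ∘ Sum.inr := by
    simp only [Matrix.mulVec_smul, Matrix.mulVec_sub]
    rw [hinv _ (by omega) (by omega), hinv _ (by omega) (by omega)]
  have h1 := h.inner
  have h2 := h.multiplier
  rw [hdel, hext] at h1 h2
  have e1 : (3 / 2 : ℝ) • u m - (2 : ℝ) • u (m - 1) + (1 / 2 : ℝ) • u (m - 2)
        - (3 / 2 : ℝ) • extendZero (boundaryPart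
          (u m - (3 : ℝ) • u (m - 1) + (3 : ℝ) • u (m - 2) - u (m - 3)))
      = τ • Sum.elim (bdf τ (fun j => u j ∘ Sum.inl) m)
        (delayed τ (fun j => u j ∘ Sum.inr) (m - 1)) := by
    have a1 : m - 1 - 1 = m - 2 := by ring
    have a2 : m - 1 - 2 = m - 3 := by ring
    ext (i | i)
    · simp [extendZero_inl, bdf]; field_simp; ring
    · simp [extendZero_inr, boundaryPart_apply, delayed, a1, a2]; field_simp; ring
  have e2 : u m - extendZero (boundaryPart (u m - (2 : ℝ) • u (m - 1) + u (m - 2)))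
      = Sum.elim (u m ∘ Sum.inl) ((2 : ℝ) • (u (m - 1) ∘ Sum.inr) - u (m - 2) ∘ Sum.inr) := by
    ext (i | i)
    · simp [extendZero_inl]
    · simp [extendZero_inr, boundaryPart_apply]; ring
  have e3 : S.Buᵀ *ᵥ lam m = Sum.elim (0 : I → ℝ) (S.Ml *ᵥ lam m) := by
    rw [hBu, Matrix.transpose_fromCols, Matrix.transpose_zero, hsymm, Matrix.fromRows_mulVec,
      Matrix.zero_mulVec]
  rw [e1, e2, e3, Matrix.mulVec_smul, ← smul_add, ← smul_add, mulVec_elim, mulVec_elim]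
  congr 1
  ext (i | i)
  · have := congrFun h1 i
    simp only [Pi.add_apply, Pi.sub_apply, Function.comp_apply] at this
    simp only [Pi.add_apply, Sum.elim_inl, Pi.zero_apply]
    linarith
  · have := congrFun h2 i
    simp only [Pi.add_apply, Pi.sub_apply, Function.comp_apply] at this
    simp only [Pi.add_apply, Sum.elim_inr]
    linarith

/-- The hypotheses on the matrices under which the scheme converges: positivity of the forms, the
structure of the coupling, and smallness of the lifting of surface data to the bulk. The factor
`1 / 1000` lets the dissipation of BDF-2 on the surface absorb the splitting error. -/
structure IsStableCoupling (S : FEMatrices I B P) (τ : ℝ) : Prop where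
  mass : S.Mu.PosSemidef
  stiff : S.Ku.PosSemidef
  surfaceMass : S.Mp.PosSemidef
  surfaceStiff : S.Kp.PosSemidef
  symm : S.Mlᵀ = S.Ml
  det : IsUnit S.Ml.det
  trace : S.Bu = Matrix.fromCols 0 S.Ml
  mass_le : ∀ x y, S.Ml *ᵥ x = S.Bp *ᵥ y →
    sqNorm S.Mu (extendZero x) ≤ 1 / 1000 * sqNorm S.Mp y
  stiff_le : ∀ x y, S.Ml *ᵥ x = S.Bp *ᵥ y →
    τ * sqNorm S.Ku (extendZero x) ≤ 1 / 1000 * sqNorm S.Mp y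

end Convergence

/-! ### Truncation errors -/

section Truncation

variable {I B P : Type} [Fintype I] [Fintype B] [Fintype P] [DecidableEq B]

/-- The bulk truncation error of the scheme at time `t`, multiplied by `τ`. -/
def bulkDefect (τ : ℝ) (u : ℝ → I ⊕ B → ℝ) (t : ℝ) : I ⊕ B → ℝ :=
  (3 / 2 : ℝ) • u t - (2 : ℝ) • u (t - τ) + (1 / 2 : ℝ) • u (t - 2 * τ) - τ • deriv u t
    - (3 / 2 : ℝ) • extendZero (boundaryPart
      (u t - (3 : ℝ) • u (t - τ) + (3 : ℝ) • u (t - 2 * τ) - u (t - 3 * τ)))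

/-- The surface truncation error of the scheme at time `t`, multiplied by `τ`. -/
def surfaceDefect (τ : ℝ) (p : ℝ → P → ℝ) (t : ℝ) : P → ℝ :=
  (3 / 2 : ℝ) • p t - (2 : ℝ) • p (t - τ) + (1 / 2 : ℝ) • p (t - 2 * τ) - τ • deriv p t

/-- The error of the extrapolation of the boundary values at time `t`. -/
def extrapolationDefect (τ : ℝ) (u : ℝ → I ⊕ B → ℝ) (t : ℝ) : I ⊕ B → ℝ :=
  -extendZero (boundaryPart (u t - (2 : ℝ) • u (t - τ) + u (t - 2 * τ)))

/-- The integrand of `regularity`. -/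
def regularityDensity (S : FEMatrices I B P) (u : ℝ → I ⊕ B → ℝ) (p : ℝ → P → ℝ) (t : ℝ) : ℝ :=
  sqNorm S.Mu (iteratedDeriv 3 u t) + sqNorm S.Mu (iteratedDeriv 4 u t)
      + sqNorm S.Mp (iteratedDeriv 3 p t) + sqNorm S.Mp (iteratedDeriv 4 p t)
      + sqNorm S.Ku.toBlocks₂₂ (iteratedDeriv 2 u t ∘ Sum.inr)
      + sqNorm S.Ku.toBlocks₂₂ (iteratedDeriv 3 u t ∘ Sum.inr)

theorem sqNorm_nonneg {ι : Type} [Fintype ι] {M : Matrix ι ι ℝ} (hM : M.PosSemidef) (x : ι → ℝ) :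
    0 ≤ sqNorm M x := hM.dotProduct_mulVec_nonneg x

theorem continuous_sqNorm {ι : Type} [Fintype ι] (M : Matrix ι ι ℝ) {g : ℝ → ι → ℝ}
    (hg : Continuous g) : Continuous fun t => sqNorm M (g t) := by
  unfold sqNorm
  exact hg.dotProduct (continuous_const.matrix_mulVec hg)

/-- The time derivatives commute with the linear maps that turn matrix norms into norms. -/
theorem hasDerivAt_comp_iteratedDeriv {V H : Type*} [NormedAddCommGroup V] [NormedSpace ℝ V]
    [NormedAddCommGroup H] [NormedSpace ℝ H] (L : V →L[ℝ] H) {u : ℝ → V} (hu : ContDiff ℝ 4 u)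
    {k : ℕ} (hk : k < 4) (s : ℝ) :
    HasDerivAt (fun s => L (iteratedDeriv k u s)) (L (iteratedDeriv (k + 1) u s)) s := by
  have h : HasDerivAt (iteratedDeriv k u) (iteratedDeriv (k + 1) u s) s := by
    rw [iteratedDeriv_succ]
    exact (hu.differentiable_iteratedDeriv k (by exact_mod_cast hk) s).hasDerivAt
  exact L.hasFDerivAt.comp_hasDerivAt s h

variable {S : FEMatrices I B P} {τ : ℝ}

omit [DecidableEq B] in
theorem continuous_regularityDensity {u : ℝ → I ⊕ B → ℝ} {p : ℝ → P → ℝ} (hu : ContDiff ℝ 4 u)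
    (hp : ContDiff ℝ 4 p) : Continuous (regularityDensity S u p) := by
  have cu : ∀ k : ℕ, k ≤ 4 → Continuous (iteratedDeriv k u) := fun k hk =>
    hu.continuous_iteratedDeriv k (by exact_mod_cast hk)
  have cp : ∀ k : ℕ, k ≤ 4 → Continuous (iteratedDeriv k p) := fun k hk =>
    hp.continuous_iteratedDeriv k (by exact_mod_cast hk)
  have cb : ∀ k : ℕ, k ≤ 4 → Continuous (fun t => iteratedDeriv k u t ∘ (Sum.inr : B → I ⊕ B)) :=
    fun k hk => continuous_pi fun i => (continuous_apply (Sum.inr i)).comp (cu k hk)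
  exact (((((continuous_sqNorm _ (cu 3 (by norm_num))).add
    (continuous_sqNorm _ (cu 4 le_rfl))).add (continuous_sqNorm _ (cp 3 (by norm_num)))).add
    (continuous_sqNorm _ (cp 4 le_rfl))).add (continuous_sqNorm _ (cb 2 (by norm_num)))).add
    (continuous_sqNorm _ (cb 3 (by norm_num)))

theorem IsStableCoupling.regularityDensity_bounds (h : IsStableCoupling S τ)
    (u : ℝ → I ⊕ B → ℝ) (p : ℝ → P → ℝ) (t : ℝ) :
    0 ≤ regularityDensity S u p t ∧ sqNorm S.Mu (iteratedDeriv 3 u t) ≤ regularityDensity S u p t ∧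
    sqNorm S.Mp (iteratedDeriv 3 p t) ≤ regularityDensity S u p t ∧
    sqNorm S.Ku (extendZero (boundaryPart (iteratedDeriv 2 u t))) ≤ regularityDensity S u p t := by
  have k1 := sqNorm_nonneg h.mass (iteratedDeriv 3 u t)
  have k2 := sqNorm_nonneg h.mass (iteratedDeriv 4 u t)
  have k3 := sqNorm_nonneg h.surfaceMass (iteratedDeriv 3 p t)
  have k4 := sqNorm_nonneg h.surfaceMass (iteratedDeriv 4 p t)
  have k5 := sqNorm_nonneg h.stiff (extendZero (boundaryPart (iteratedDeriv 2 u t)))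
  have k6 := sqNorm_nonneg h.stiff (extendZero (boundaryPart (iteratedDeriv 3 u t)))
  rw [sqNorm_extendZero] at k5 k6
  rw [sqNorm_extendZero]
  simp only [boundaryPart_apply] at *
  rw [regularityDensity]
  refine ⟨by linarith, by linarith, by linarith, by linarith⟩

/-- The bulk truncation error is of third order; the third differences of the boundary values are
controlled by those of the surface values. -/
theorem IsStableCoupling.bulkDefect_le (h : IsStableCoupling S τ) (hτ : 0 < τ)
    {u : ℝ → I ⊕ B → ℝ} {p : ℝ → P → ℝ} (hu : ContDiff ℝ 4 u) (hp : ContDiff ℝ 4 p) {t : ℝ}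
    (hc : ∀ s ∈ Set.Icc (t - 3 * τ) t, S.Ml *ᵥ boundaryPart (u s) = S.Bp *ᵥ p s) :
    sqNorm S.Mu (bulkDefect τ u t)
      ≤ 30000 * τ ^ 5 * ∫ s in (t - 3 * τ)..t, regularityDensity S u p s := by
  obtain ⟨LM, hLM⟩ := exists_gram_factor h.mass
  obtain ⟨LP, hLP⟩ := exists_gram_factor h.surfaceMass
  have nM : ∀ x, ‖LM x‖ ^ 2 = sqNorm S.Mu x := fun x => by
    rw [← real_inner_self_eq_norm_sq, hLM, sqNorm]
  have nP : ∀ x, ‖LP x‖ ^ 2 = sqNorm S.Mp x := fun x => by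
    rw [← real_inner_self_eq_norm_sq, hLP, sqNorm]
  have hI : ∀ g : ℝ → ℝ, Continuous g → (∀ s, g s ≤ regularityDensity S u p s) →
      ∫ s in (t - 3 * τ)..t, g s ≤ ∫ s in (t - 3 * τ)..t, regularityDensity S u p s :=
    fun g hg hle => intervalIntegral.integral_mono (by linarith) (hg.intervalIntegrable _ _)
      ((continuous_regularityDensity hu hp).intervalIntegrable _ _) hle
  have cu : Continuous fun s => LM (iteratedDeriv 3 u s) :=
    LM.continuous.comp (hu.continuous_iteratedDeriv 3 (by norm_num))
  have cp : Continuous fun s => LP (iteratedDeriv 3 p s) :=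
    LP.continuous.comp (hp.continuous_iteratedDeriv 3 (by norm_num))
  have d1 := bdf_consistency (hasDerivAt_comp_iteratedDeriv LM hu (k := 0) (by norm_num))
    (hasDerivAt_comp_iteratedDeriv LM hu (k := 1) (by norm_num))
    (hasDerivAt_comp_iteratedDeriv LM hu (k := 2) (by norm_num)) cu (t := t) hτ
  have d2 := thirdDiff_consistency (hasDerivAt_comp_iteratedDeriv LP hp (k := 0) (by norm_num))
    (hasDerivAt_comp_iteratedDeriv LP hp (k := 1) (by norm_num))
    (hasDerivAt_comp_iteratedDeriv LP hp (k := 2) (by norm_num)) cp (t := t) hτ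
  simp only [iteratedDeriv_zero, zero_add, iteratedDeriv_one, ← map_smul, ← map_sub,
    ← map_add] at d1 d2
  have i1 := hI (fun s => ‖LM (iteratedDeriv 3 u s)‖ ^ 2) (cu.norm.pow 2)
    (fun s => by rw [nM]; exact (h.regularityDensity_bounds u p s).2.1)
  have i2 := hI (fun s => ‖LP (iteratedDeriv 3 p s)‖ ^ 2) (cp.norm.pow 2)
    (fun s => by rw [nP]; exact (h.regularityDensity_bounds u p s).2.2.1)
  set Rg := ∫ s in (t - 3 * τ)..t, regularityDensity S u p s
  set x1 := (3 / 2 : ℝ) • u t - (2 : ℝ) • u (t - τ) + (1 / 2 : ℝ) • u (t - 2 * τ) - τ • deriv u t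
  set x2 := extendZero (I := I) (boundaryPart
      (u t - (3 : ℝ) • u (t - τ) + (3 : ℝ) • u (t - 2 * τ) - u (t - 3 * τ))) with hx2
  set y2 := p t - (3 : ℝ) • p (t - τ) + (3 : ℝ) • p (t - 2 * τ) - p (t - 3 * τ)
  -- the third difference is taken on the surface, where `p` has three derivatives in the mass norm
  have e2 : ‖LM x2‖ ^ 2 ≤ 1 / 1000 * ‖LP y2‖ ^ 2 := by
    rw [nM, nP]
    refine h.mass_le _ _ ?_
    simp only [map_sub, map_add, map_smul, Matrix.mulVec_sub, Matrix.mulVec_add,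
      Matrix.mulVec_smul, y2]
    rw [hc t ⟨by linarith, le_rfl⟩, hc (t - τ) ⟨by linarith, by linarith⟩,
      hc (t - 2 * τ) ⟨by linarith, by linarith⟩, hc (t - 3 * τ) ⟨le_rfl, by linarith⟩]
  have e1 : bulkDefect τ u t = x1 - (3 / 2 : ℝ) • x2 := rfl
  rw [e1, ← nM, map_sub, map_smul]
  have t1 : ‖LM x1 - (3 / 2 : ℝ) • LM x2‖ ≤ ‖LM x1‖ + 3 / 2 * ‖LM x2‖ :=
    (norm_sub_le _ _).trans (by rw [norm_smul]; norm_num)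
  have t2 := pow_le_pow_left₀ (norm_nonneg _) t1 2
  have t3 := sq_nonneg (‖LM x1‖ - 3 / 2 * ‖LM x2‖)
  have j1 := mul_le_mul_of_nonneg_left i1 (by positivity : 0 ≤ 12000 * τ ^ 5)
  have j2 := mul_le_mul_of_nonneg_left i2 (by positivity : 0 ≤ 12000 * τ ^ 5)
  have hR0 : 0 ≤ τ ^ 5 * Rg := mul_nonneg (by positivity)
    (intervalIntegral.integral_nonneg (by linarith)
      (fun s _ => (h.regularityDensity_bounds u p s).1))
  nlinarith

theorem IsStableCoupling.surfaceDefect_le (h : IsStableCoupling S τ) (hτ : 0 < τ)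
    {u : ℝ → I ⊕ B → ℝ} {p : ℝ → P → ℝ} (hu : ContDiff ℝ 4 u) (hp : ContDiff ℝ 4 p) {t : ℝ} :
    sqNorm S.Mp (surfaceDefect τ p t)
      ≤ 12000 * τ ^ 5 * ∫ s in (t - 3 * τ)..t, regularityDensity S u p s := by
  obtain ⟨LP, hLP⟩ := exists_gram_factor h.surfaceMass
  have nP : ∀ x, ‖LP x‖ ^ 2 = sqNorm S.Mp x := fun x => by
    rw [← real_inner_self_eq_norm_sq, hLP, sqNorm]
  have cp : Continuous fun s => LP (iteratedDeriv 3 p s) :=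
    LP.continuous.comp (hp.continuous_iteratedDeriv 3 (by norm_num))
  have d1 := bdf_consistency (hasDerivAt_comp_iteratedDeriv LP hp (k := 0) (by norm_num))
    (hasDerivAt_comp_iteratedDeriv LP hp (k := 1) (by norm_num))
    (hasDerivAt_comp_iteratedDeriv LP hp (k := 2) (by norm_num)) cp (t := t) hτ
  simp only [iteratedDeriv_zero, zero_add, iteratedDeriv_one, ← map_smul, ← map_sub,
    ← map_add] at d1
  rw [surfaceDefect, ← nP]
  refine d1.trans (mul_le_mul_of_nonneg_left ?_ (by positivity))
  refine intervalIntegral.integral_mono (by linarith) ((cp.norm.pow 2).intervalIntegrable _ _)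
      ((continuous_regularityDensity hu hp).intervalIntegrable _ _) fun s => ?_
  change ‖LP (iteratedDeriv 3 p s)‖ ^ 2 ≤ _
  rw [nP]; exact (h.regularityDensity_bounds u p s).2.2.1

theorem IsStableCoupling.extrapolationDefect_le (h : IsStableCoupling S τ) (hτ : 0 < τ)
    {u : ℝ → I ⊕ B → ℝ} {p : ℝ → P → ℝ} (hu : ContDiff ℝ 4 u) (hp : ContDiff ℝ 4 p) {t : ℝ} :
    sqNorm S.Ku (extrapolationDefect τ u t)
      ≤ 12000 * τ ^ 3 * ∫ s in (t - 3 * τ)..t, regularityDensity S u p s := by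
  obtain ⟨LK, hLK⟩ := exists_gram_factor h.stiff
  have nK : ∀ x, ‖LK x‖ ^ 2 = sqNorm S.Ku x := fun x => by
    rw [← real_inner_self_eq_norm_sq, hLK, sqNorm]
  let L : (I ⊕ B → ℝ) →L[ℝ] EuclideanSpace ℝ (I ⊕ B) := LK.comp (LinearMap.toContinuousLinearMap
    ((extendZero (I := I) (B := B)).comp (boundaryPart (I := I) (B := B))))
  have hL : ∀ x, L x = LK (extendZero (boundaryPart x)) := fun x => rfl
  have cu : Continuous fun s => L (iteratedDeriv 2 u s) :=
    L.continuous.comp (hu.continuous_iteratedDeriv 2 (by norm_num))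
  have d1 := secondDiff_consistency (hasDerivAt_comp_iteratedDeriv L hu (k := 0) (by norm_num))
    (hasDerivAt_comp_iteratedDeriv L hu (k := 1) (by norm_num)) cu (t := t) hτ
  simp only [iteratedDeriv_zero, ← map_smul, ← map_sub, ← map_add] at d1
  rw [extrapolationDefect, ← nK, map_neg, norm_neg, ← hL]
  refine d1.trans (mul_le_mul_of_nonneg_left ?_ (by positivity))
  refine intervalIntegral.integral_mono (by linarith) ((cu.norm.pow 2).intervalIntegrable _ _)
      ((continuous_regularityDensity hu hp).intervalIntegrable _ _) fun s => ?_
  change ‖L (iteratedDeriv 2 u s)‖ ^ 2 ≤ _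
  rw [hL, nK]; exact (h.regularityDensity_bounds u p s).2.2.2

end Truncation

/-! ### Convergence under the stability conditions -/

section Convergence

variable {I B P : Type} [Fintype I] [Fintype B] [Fintype P] [DecidableEq B]
  {S : FEMatrices I B P} {τ : ℝ}

omit [DecidableEq B] in
theorem mulVec_boundaryPart_of_trace (hBu : S.Bu = Matrix.fromCols 0 S.Ml) {x : I ⊕ B → ℝ}
    {y : P → ℝ} (h : S.Bu *ᵥ x = S.Bp *ᵥ y) : S.Ml *ᵥ boundaryPart x = S.Bp *ᵥ y := by
  rw [← h, hBu, ← Sum.elim_comp_inl_inr x, Matrix.fromCols_mulVec_sumElim]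
  simp [boundaryPart_apply]

/-- Second-order convergence of the scheme under the matrix hypotheses of `IsStableCoupling`. -/
theorem IsStableCoupling.convergence (h : IsStableCoupling S τ) {T A R : ℝ} (hT : 0 < T)
    (hτ : 0 < τ) (hτ1 : τ ≤ 1) {fu : ℝ → I ⊕ B → ℝ} {fp : ℝ → P → ℝ} {u : ℝ → I ⊕ B → ℝ}
    {p : ℝ → P → ℝ} {lam : ℝ → B → ℝ}
    (hsol : IsSemidiscreteSolution S fu fp (Set.Icc (-2 * τ) T) u p lam)
    (hu : ContDiff ℝ 4 u) (hp : ContDiff ℝ 4 p) (hR : regularity S (-2 * τ) T u p ≤ R)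
    {uh : ℤ → I ⊕ B → ℝ} {ph : ℤ → P → ℝ} {lamh : ℤ → B → ℝ}
    (hcons : ∀ j : ℤ, -2 ≤ j → j ≤ 0 → S.Bu *ᵥ uh j = S.Bp *ᵥ ph j)
    (hinit : ∀ j : ℤ, -2 ≤ j → j ≤ 0 →
      sqError S.Mu S.Mp τ uh ph u p j + τ * sqError S.Ku S.Kp τ uh ph u p j ≤ A * τ ^ 5)
    (hstep : ∀ m : ℤ, 1 ≤ m → m * τ ≤ T → IsAuxiliaryStep S fu fp τ uh ph lamh m)
    (n : ℕ) (hn : n * τ ≤ T) :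
    sqError S.Mu S.Mp τ uh ph u p n
        + τ * ∑ j ∈ Finset.Icc 1 n, sqError S.Ku S.Kp τ uh ph u p j
      ≤ (320000 * A + 10 ^ 11 * (1 + T) * R) * τ ^ 4 := by
  have sqE_nonneg : ∀ {X : Matrix (I ⊕ B) (I ⊕ B) ℝ} {Y : Matrix P P ℝ}, X.PosSemidef →
      Y.PosSemidef → ∀ j, 0 ≤ sqError X Y τ uh ph u p j := fun hX hY j =>
    add_nonneg (sqNorm_nonneg hX _) (sqNorm_nonneg hY _)
  have hτ4 : 0 < τ ^ 4 := by positivity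
  have hJ0 : ∀ j : ℤ, -2 ≤ j → j ≤ 0 →
      sqError S.Mu S.Mp τ uh ph u p j + τ * sqError S.Ku S.Kp τ uh ph u p j ≤ A * τ ^ 4 := by
    intro j h1 h2
    have h3 := hinit j h1 h2
    have h4 : 0 ≤ A * τ ^ 5 := le_trans (add_nonneg (sqE_nonneg h.mass h.surfaceMass j)
      (mul_nonneg hτ.le (sqE_nonneg h.stiff h.surfaceStiff j))) h3
    have h5 : 0 ≤ A := nonneg_of_mul_nonneg_left h4 (by positivity)
    refine h3.trans (mul_le_mul_of_nonneg_left ?_ h5)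
    rw [pow_succ]; nlinarith
  have hA : 0 ≤ A := by
    refine nonneg_of_mul_nonneg_left (le_trans ?_ (hJ0 0 (by norm_num) le_rfl)) hτ4
    exact add_nonneg (sqE_nonneg h.mass h.surfaceMass 0)
      (mul_nonneg hτ.le (sqE_nonneg h.stiff h.surfaceStiff 0))
  have hgc := continuous_regularityDensity (S := S) hu hp
  have hg0 := fun s => (h.regularityDensity_bounds u p s).1
  have hreg : ∫ s in (-2 * τ)..T, regularityDensity S u p s ≤ R := hR
  have hR0 : 0 ≤ R :=
    (intervalIntegral.integral_nonneg (by linarith) fun s _ => hg0 s).trans hreg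
  rcases Nat.eq_zero_or_pos n with rfl | hn1
  · have h1 := hJ0 0 (by norm_num) le_rfl
    have h2 := mul_nonneg hτ.le (sqE_nonneg h.stiff h.surfaceStiff 0)
    have h3 : 0 ≤ 10 ^ 11 * (1 + T) * R * τ ^ 4 := by positivity
    have h4 : 0 ≤ A * τ ^ 4 := by positivity
    simp only [Nat.cast_zero, Finset.Icc_eq_empty_of_lt zero_lt_one, Finset.sum_empty, mul_zero,
      add_zero]
    linarith
  obtain ⟨LM, hLM⟩ := exists_gram_factor h.mass
  obtain ⟨LP, hLP⟩ := exists_gram_factor h.surfaceMass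
  obtain ⟨LK, hLK⟩ := exists_gram_factor h.stiff
  obtain ⟨LQ, hLQ⟩ := exists_gram_factor h.surfaceStiff
  have nM : ∀ x, ‖LM x‖ ^ 2 = sqNorm S.Mu x := fun x => by
    rw [← real_inner_self_eq_norm_sq, hLM, sqNorm]
  have nP : ∀ x, ‖LP x‖ ^ 2 = sqNorm S.Mp x := fun x => by
    rw [← real_inner_self_eq_norm_sq, hLP, sqNorm]
  have nK : ∀ x, ‖LK x‖ ^ 2 = sqNorm S.Ku x := fun x => by
    rw [← real_inner_self_eq_norm_sq, hLK, sqNorm]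
  have nQ : ∀ x, ‖LQ x‖ ^ 2 = sqNorm S.Kp x := fun x => by
    rw [← real_inner_self_eq_norm_sq, hLQ, sqNorm]
  have time_le : ∀ j : ℤ, j ≤ n → (j : ℝ) * τ ≤ T := fun j hj =>
    (mul_le_mul_of_nonneg_right (by exact_mod_cast hj) hτ.le).trans hn
  have le_time : ∀ j : ℤ, -2 ≤ j → -2 * τ ≤ (j : ℝ) * τ := fun j hj =>
    mul_le_mul_of_nonneg_right (by exact_mod_cast hj) hτ.le
  -- the coupling condition holds for the exact solution, the iterates, and hence the errors
  have cex : ∀ s ∈ Set.Icc (-2 * τ) T, S.Ml *ᵥ boundaryPart (u s) = S.Bp *ᵥ p s := fun s hs =>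
    mulVec_boundaryPart_of_trace h.trace (hsol.coupling s hs)
  have ch : ∀ j : ℤ, -2 ≤ j → j ≤ n → S.Ml *ᵥ boundaryPart (uh j) = S.Bp *ᵥ ph j := by
    intro j h1 h2
    rcases le_or_gt j 0 with h0 | h0
    · exact mulVec_boundaryPart_of_trace h.trace (hcons j h1 h0)
    · exact (hstep j h0 (time_le j h2)).boundary
  set eu : ℤ → I ⊕ B → ℝ := fun j => uh j - u (j * τ) with heu
  set ep : ℤ → P → ℝ := fun j => ph j - p (j * τ) with hep
  have ce : ∀ j : ℤ, -2 ≤ j → j ≤ n → S.Ml *ᵥ boundaryPart (eu j) = S.Bp *ᵥ ep j := by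
    intro j h1 h2
    simp only [heu, hep, map_sub, Matrix.mulVec_sub]
    rw [ch j h1 h2, cex _ ⟨le_time j h1, time_le j h2⟩]
  set x : ℤ → I ⊕ B → ℝ := fun j =>
    extendZero (boundaryPart (eu j - (2 : ℝ) • eu (j - 1) + eu (j - 2))) with hx
  have cx : ∀ j : ℤ, 0 ≤ j → j ≤ n →
      S.Ml *ᵥ boundaryPart (eu j - (2 : ℝ) • eu (j - 1) + eu (j - 2))
        = S.Bp *ᵥ (ep j - (2 : ℝ) • ep (j - 1) + ep (j - 2)) := by
    intro j h1 h2
    simp only [map_sub, map_add, map_smul, Matrix.mulVec_sub, Matrix.mulVec_add,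
      Matrix.mulVec_smul]
    rw [ce j (by omega) h2, ce (j - 1) (by omega) (by omega), ce (j - 2) (by omega) (by omega)]
  have hsd : ∀ j, secondDiff (fun j => LP (ep j)) j
      = LP (ep j - (2 : ℝ) • ep (j - 1) + ep (j - 2)) := fun j => by
    simp only [secondDiff, map_sub, map_add, map_smul]
  have key := energy_estimate (τ := τ) (T := T) (J := A * τ ^ 4) hτ hT hn
    (fun j => LM (eu j)) (fun j => LM (x j)) (fun j => τ⁻¹ • LM (bulkDefect τ u (j * τ)))
    (fun j => LP (ep j)) (fun j => τ⁻¹ • LP (surfaceDefect τ p (j * τ)))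
    (fun j => LK (eu j)) (fun j => LK (x j)) (fun j => LK (extrapolationDefect τ u (j * τ)))
    (fun j => LQ (ep j)) ?_ ?_ ?_ ?_ hn1
  · -- the defects sum up to the regularity functional
    simp only [norm_smul, mul_pow, nM, nP, nK, nQ, Int.cast_natCast] at key
    have hdef : τ * ∑ j ∈ Finset.Icc 1 n, (‖τ⁻¹‖ ^ 2 * sqNorm S.Mu (bulkDefect τ u (j * τ))
          + ‖τ⁻¹‖ ^ 2 * sqNorm S.Mp (surfaceDefect τ p (j * τ))
          + sqNorm S.Ku (extrapolationDefect τ u (j * τ)))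
        ≤ 54000 * τ ^ 4 * ∑ j ∈ Finset.Icc 1 n,
          ∫ s in ((j : ℕ) * τ - 3 * τ)..(j * τ), regularityDensity S u p s := by
      rw [Finset.mul_sum, Finset.mul_sum]
      refine Finset.sum_le_sum fun j hj => ?_
      rw [Finset.mem_Icc] at hj
      have hj1 : (1 : ℝ) ≤ j := by exact_mod_cast hj.1
      have hjn : (j : ℝ) ≤ n := by exact_mod_cast hj.2
      have b1 := h.bulkDefect_le hτ hu hp (t := j * τ) fun s hs =>
        cex s ⟨by nlinarith [hs.1], by nlinarith [hs.2]⟩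
      have b2 := h.surfaceDefect_le hτ hu hp (t := j * τ)
      have b3 := h.extrapolationDefect_le hτ hu hp (t := j * τ)
      set Ig := ∫ s in ((j : ℕ) * τ - 3 * τ)..(j * τ), regularityDensity S u p s
      have e : ‖τ⁻¹‖ ^ 2 = (τ ^ 2)⁻¹ := by
        rw [Real.norm_eq_abs, sq_abs, inv_pow]
      rw [e]
      have c1 := mul_le_mul_of_nonneg_left b1 (by positivity : 0 ≤ (τ ^ 2)⁻¹)
      have c2 := mul_le_mul_of_nonneg_left b2 (by positivity : 0 ≤ (τ ^ 2)⁻¹)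
      have c3 := mul_le_mul_of_nonneg_left (add_le_add (add_le_add c1 c2) b3) hτ.le
      refine c3.trans_eq ?_
      field_simp
      ring
    have hwin := sum_window_integral_le hgc hg0 hτ hn
    have h2 := mul_le_mul_of_nonneg_left (hwin.trans (mul_le_mul_of_nonneg_left hreg
      (by norm_num))) (by positivity : 0 ≤ 54000 * τ ^ 4)
    have h3 := mul_le_mul_of_nonneg_left (hdef.trans h2) (by positivity : 0 ≤ 60000 * (1 + T))
    have h4 : 0 ≤ (1 + T) * R * τ ^ 4 := by positivity
    change sqNorm S.Mu (eu n) + sqNorm S.Mp (ep n)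
      + τ * ∑ j ∈ Finset.Icc 1 n, (sqNorm S.Ku (eu j) + sqNorm S.Kp (ep j)) ≤ _
    linarith
  · intro j h1 h2
    have h3 := hJ0 j h1 h2
    have h4 := sqNorm_nonneg h.surfaceStiff (ep j)
    change sqNorm S.Mu (eu j) + sqNorm S.Mp (ep j)
      + τ * (sqNorm S.Ku (eu j) + sqNorm S.Kp (ep j)) ≤ _ at h3
    rw [nM, nP, nK]
    nlinarith
  · intro j h1 h2
    rw [hsd, nM, nP]
    exact h.mass_le _ _ (cx j h1 h2)
  · intro j h1 h2
    rw [hsd, nK, nP]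
    exact h.stiff_le _ _ (cx j (by omega) h2)
  · intro m h1 h2
    have hmT := time_le m h2
    have hm0 := le_time m (by omega)
    have st := hstep m h1 hmT
    have e1 := st.bulk hτ h.det h.trace h.symm fun j k1 k2 => ch j (by omega) (by omega)
    have e2 := hsol.bulk (m * τ) ⟨hm0, hmT⟩
    have e4 := hsol.surface (m * τ) ⟨hm0, hmT⟩
    have e3 : S.Mp *ᵥ ((3 / 2 : ℝ) • ph m - (2 : ℝ) • ph (m - 1) + (1 / 2 : ℝ) • ph (m - 2))
        + τ • S.Kp *ᵥ ph m + τ • S.Bpᵀ *ᵥ lamh m = τ • fp (m * τ) := by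
      have hb : (3 / 2 : ℝ) • ph m - (2 : ℝ) • ph (m - 1) + (1 / 2 : ℝ) • ph (m - 2)
          = τ • bdf τ ph m := by
        ext i
        simp [bdf]; field_simp; ring
      rw [hb, Matrix.mulVec_smul, ← st.surface, smul_add, smul_add]
    -- the test vector has the boundary part of the error, so that the multiplier drops out
    set w : I ⊕ B → ℝ := eu m + (3 / 2 : ℝ) • (eu m - (2 : ℝ) • eu (m - 1) + eu (m - 2))
      - (3 / 2 : ℝ) • x m with hw
    have hwb : boundaryPart w = boundaryPart (eu m) := by
      ext i
      simp only [hw, hx, boundaryPart_apply, Function.comp_apply, Pi.add_apply, Pi.sub_apply,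
        Pi.smul_apply, extendZero_inr]
      ring
    have fin := tested_error_equation (w := w) (ep := ep m) h.trace e1 e2 e3 e4
      (by rw [hwb]; exact ce m (by omega) h2)
    have t1 : ((m - 1 : ℤ) : ℝ) * τ = m * τ - τ := by push_cast; ring
    have t2 : ((m - 2 : ℤ) : ℝ) * τ = m * τ - 2 * τ := by push_cast; ring
    have t3 : ((m - 3 : ℤ) : ℝ) * τ = m * τ - 3 * τ := by push_cast; ring
    have s1 : (3 / 2 : ℝ) • uh m - (2 : ℝ) • uh (m - 1) + (1 / 2 : ℝ) • uh (m - 2)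
        - (3 / 2 : ℝ) • extendZero (boundaryPart
          (uh m - (3 : ℝ) • uh (m - 1) + (3 : ℝ) • uh (m - 2) - uh (m - 3)))
        - τ • deriv u (m * τ)
        = (3 / 2 : ℝ) • eu m - (2 : ℝ) • eu (m - 1) + (1 / 2 : ℝ) • eu (m - 2)
          - (3 / 2 : ℝ) • (x m - x (m - 1)) + bulkDefect τ u (m * τ) := by
      simp only [heu, hx, bulkDefect, t1, t2, t3, show m - 1 - 1 = m - 2 by ring,
        show m - 1 - 2 = m - 3 by ring, map_sub, map_add, map_smul]
      module
    have s2 : uh m - extendZero (boundaryPart (uh m - (2 : ℝ) • uh (m - 1) + uh (m - 2)))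
        - u (m * τ) = eu m - x m + extrapolationDefect τ u (m * τ) := by
      simp only [heu, hx, extrapolationDefect, t1, t2, map_sub, map_add, map_smul]
      module
    have s3 : (3 / 2 : ℝ) • ph m - (2 : ℝ) • ph (m - 1) + (1 / 2 : ℝ) • ph (m - 2)
        - τ • deriv p (m * τ)
        = (3 / 2 : ℝ) • ep m - (2 : ℝ) • ep (m - 1) + (1 / 2 : ℝ) • ep (m - 2)
          + surfaceDefect τ p (m * τ) := by
      simp only [hep, surfaceDefect, t1, t2]
      module
    rw [s1, s2, s3] at fin
    change _ + τ * (ep m ⬝ᵥ (S.Kp *ᵥ ep m)) = 0 at fin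
    rw [← hLM, ← hLP, ← hLK, ← hLQ, map_add LM, map_add LK, map_add LP, inner_add_left,
      inner_add_left, inner_add_left, real_inner_self_eq_norm_sq] at fin
    have w1 : LM (eu m) + (3 / 2 : ℝ) • (LM (eu m) - (2 : ℝ) • LM (eu (m - 1)) + LM (eu (m - 2)))
        - (3 / 2 : ℝ) • LM (x m) = LM w := by
      simp only [hw, map_sub, map_add, map_smul]
    have w2 : LK (eu m) + (3 / 2 : ℝ) • (LK (eu m) - (2 : ℝ) • LK (eu (m - 1)) + LK (eu (m - 2)))
        - (3 / 2 : ℝ) • LK (x m) = LK w := by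
      simp only [hw, map_sub, map_add, map_smul]
    have w3 : (3 / 2 : ℝ) • LM (eu m) - (2 : ℝ) • LM (eu (m - 1)) + (1 / 2 : ℝ) • LM (eu (m - 2))
        - (3 / 2 : ℝ) • (LM (x m) - LM (x (m - 1)))
        = LM ((3 / 2 : ℝ) • eu m - (2 : ℝ) • eu (m - 1) + (1 / 2 : ℝ) • eu (m - 2)
          - (3 / 2 : ℝ) • (x m - x (m - 1))) := by
      simp only [map_sub, map_add, map_smul]
    have w4 : (3 / 2 : ℝ) • LP (ep m) - (2 : ℝ) • LP (ep (m - 1)) + (1 / 2 : ℝ) • LP (ep (m - 2))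
        = LP ((3 / 2 : ℝ) • ep m - (2 : ℝ) • ep (m - 1) + (1 / 2 : ℝ) • ep (m - 2)) := by
      simp only [map_sub, map_add, map_smul]
    rw [w1, w2, w3, w4, ← map_sub LK, real_inner_smul_left, real_inner_smul_left,
      mul_inv_cancel_left₀ hτ.ne', mul_inv_cancel_left₀ hτ.ne']
    linarith

end Convergence

/-! ### Barycentric coordinates -/

section Simplex

variable {d : ℕ}

theorem affineMap_sum_smul {ι : Type*} (f : E d →ᵃ[ℝ] ℝ) (s : Finset ι) (w : ι → ℝ) (v : ι → E d)
    (hw : ∑ i ∈ s, w i = 1) : f (∑ i ∈ s, w i • v i) = ∑ i ∈ s, w i * f (v i) := by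
  have h : ∀ x, f x = f.linear x + f 0 := fun x => by
    have := f.map_vadd 0 x
    simpa using this
  have e : ∑ i ∈ s, w i * f (v i) = ∑ i ∈ s, (w i * f.linear (v i) + w i * f 0) :=
    Finset.sum_congr rfl fun i _ => by rw [h (v i), mul_add]
  rw [h, map_sum, e, Finset.sum_add_distrib, ← Finset.sum_mul, hw, one_mul]
  simp

/-- The affine extensions of the barycentric coordinates of a simplex to the whole space. -/
structure IsCoordinateSystem (s : Finset (E d)) (c : E d → E d →ᵃ[ℝ] ℝ) : Prop where
  zero_of_notMem : ∀ v ∉ s, c v = 0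
  apply_sum : ∀ w : E d → ℝ, ∑ v ∈ s, w v = 1 → ∀ v ∈ s, c v (∑ u ∈ s, w u • u) = w v

/-- The coordinates exist since the vertices extend to an affine basis of the whole space. -/
theorem exists_isCoordinateSystem {s : Finset (E d)}
    (hs : AffineIndependent ℝ ((↑) : s → E d)) : ∃ c, IsCoordinateSystem s c := by
  classical
  obtain ⟨t, hst, ht, htop⟩ := exists_subset_affineIndependent_affineSpan_eq_top hs
  let b : AffineBasis t ℝ (E d) := ⟨(↑), ht, by rwa [Subtype.range_coe]⟩
  refine ⟨fun v => if h : v ∈ s then b.coord ⟨v, hst h⟩ else 0, fun v hv => by simp [hv], ?_⟩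
  intro w hw v hv
  simp only [hv, dif_pos]
  rw [affineMap_sum_smul _ _ _ _ hw, Finset.sum_eq_single v]
  · have := b.coord_apply_eq ⟨v, hst hv⟩
    change b.coord ⟨v, hst hv⟩ v = 1 at this
    rw [this, mul_one]
  · intro u hu huv
    have := b.coord_apply_ne (i := ⟨v, hst hv⟩) (j := ⟨u, hst hu⟩)
      (fun h => huv (congrArg Subtype.val h).symm)
    change b.coord ⟨v, hst hv⟩ u = 0 at this
    rw [this, mul_zero]
  · exact fun h => (h hv).elim

namespace IsCoordinateSystem

variable {s : Finset (E d)} {c : E d → E d →ᵃ[ℝ] ℝ} (hc : IsCoordinateSystem s c)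

include hc

theorem sum_of_mem_affineSpan {x : E d} (hx : x ∈ affineSpan ℝ (s : Set (E d))) :
    ∑ v ∈ s, c v x = 1 ∧ ∑ v ∈ s, c v x • v = x := by
  classical
  have hx' : x ∈ affineSpan ℝ (Set.range ((↑) : s → E d)) := by
    rwa [Subtype.range_coe_subtype, Finset.setOfPred_mem]
  obtain ⟨w, hw, rfl⟩ := eq_affineCombination_of_mem_affineSpan_of_fintype hx'
  set w' : E d → ℝ := fun v => if h : v ∈ s then w ⟨v, h⟩ else 0
  have e0 : ∀ i : s, w' i = w i := fun i => by simp [w']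
  have e1 : ∑ v ∈ s, w' v = 1 := by
    rw [← hw, ← Finset.sum_coe_sort]
    exact Finset.sum_congr rfl fun i _ => e0 i
  have e2 : Finset.univ.affineCombination ℝ ((↑) : s → E d) w = ∑ v ∈ s, w' v • v := by
    rw [Finset.affineCombination_eq_linear_combination _ _ _ hw, ← Finset.sum_coe_sort s]
    exact Finset.sum_congr rfl fun i _ => by rw [e0]
  rw [e2]
  have e3 := hc.apply_sum w' e1
  constructor
  · rw [Finset.sum_congr rfl e3, e1]
  · exact Finset.sum_congr rfl fun v hv => by rw [e3 v hv]

theorem mem_hull_iff {x : E d} :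
    x ∈ hull s ↔ x ∈ affineSpan ℝ (s : Set (E d)) ∧ ∀ v ∈ s, 0 ≤ c v x := by
  constructor
  · intro hx
    refine ⟨convexHull_subset_affineSpan _ hx, ?_⟩
    obtain ⟨w, h0, h1, rfl⟩ := Finset.mem_convexHull'.1 hx
    intro v hv
    rw [hc.apply_sum w h1 v hv]
    exact h0 v hv
  · rintro ⟨hx, h0⟩
    obtain ⟨h1, h2⟩ := hc.sum_of_mem_affineSpan hx
    exact Finset.mem_convexHull'.2 ⟨fun v => c v x, h0, h1, h2⟩

theorem nonneg {x : E d} (hx : x ∈ hull s) (v : E d) : 0 ≤ c v x := by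
  by_cases hv : v ∈ s
  · exact (hc.mem_hull_iff.1 hx).2 v hv
  · rw [hc.zero_of_notMem v hv]; simp

theorem le_one {x : E d} (hx : x ∈ hull s) (v : E d) : c v x ≤ 1 := by
  by_cases hv : v ∈ s
  · rw [← (hc.sum_of_mem_affineSpan (hc.mem_hull_iff.1 hx).1).1]
    exact Finset.single_le_sum (f := fun v => c v x) (fun u _ => hc.nonneg hx u) hv
  · rw [hc.zero_of_notMem v hv]; simp

/-- The coordinates of a simplex containing a ball of radius `r` are `1/r`-Lipschitz. -/
theorem abs_linear_le {z : E d} {r : ℝ} (hr : 0 < r) (hz : Metric.closedBall z r ⊆ hull s)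
    (v w : E d) : |(c v).linear w| ≤ r⁻¹ * ‖w‖ := by
  rcases eq_or_ne w 0 with rfl | hw
  · simp
  have hw' : 0 < ‖w‖ := norm_pos_iff.2 hw
  have hmem : (r / ‖w‖) • w + z ∈ hull s := hz (by
    rw [mem_closedBall_iff_norm, add_sub_cancel_right, norm_smul,
      Real.norm_of_nonneg (by positivity),
      div_mul_cancel₀ _ hw'.ne'])
  have hzm : z ∈ hull s := hz (Metric.mem_closedBall_self hr.le)
  have e : c v ((r / ‖w‖) • w + z) = (r / ‖w‖) * (c v).linear w + c v z := by
    have := (c v).map_vadd z ((r / ‖w‖) • w)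
    simpa using this
  have h1 := hc.nonneg hmem v
  have h2 := hc.le_one hmem v
  have h3 := hc.nonneg hzm v
  have h4 := hc.le_one hzm v
  have h5 : |(r / ‖w‖) * (c v).linear w| ≤ 1 := by
    rw [abs_le]; constructor <;> linarith
  rw [abs_mul, abs_of_pos (by positivity : 0 < r / ‖w‖)] at h5
  have h6 := mul_le_mul_of_nonneg_left h5 (by positivity : 0 ≤ r⁻¹ * ‖w‖)
  have h7 : r⁻¹ * ‖w‖ * (r / ‖w‖ * |(c v).linear w|) = |(c v).linear w| := by field_simp
  linarith

end IsCoordinateSystem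

end Simplex

namespace BulkMesh

variable {d : ℕ} {Ω : Set (E d)} (𝒯 : BulkMesh Ω)

variable {𝒯} in
/-- Barycentric coordinates do not depend on the simplex: two simplices of the mesh meet in the hull
of their common vertices, and the coordinates in each of them are unique. -/
theorem IsBarycentric.unique {x : E d} {w w' : E d →₀ ℝ} (h : 𝒯.IsBarycentric x w)
    (h' : 𝒯.IsBarycentric x w') : w = w' := by
  classical
  have key : ∀ {w w' : E d →₀ ℝ}, 𝒯.IsBarycentric x w → 𝒯.IsBarycentric x w' →
      ∀ g : E d → ℝ, (∑ y ∈ w.support ∩ w'.support, g y = 1) →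
        (∑ y ∈ w.support ∩ w'.support, g y • y = x) →
        ∀ v, w v = if v ∈ w.support ∩ w'.support then g v else 0 := by
    intro w w' h h' g g1 g2 v
    obtain ⟨c, hc⟩ := exists_isCoordinateSystem (𝒯.complex.indep h.1)
    by_cases hv : v ∈ w.support
    · have e1 := hc.apply_sum w h.2.2.1 v hv
      have e2 := hc.apply_sum (fun y => if y ∈ w.support ∩ w'.support then g y else 0)
        (by rw [← g1, Finset.sum_ite_mem, ← Finset.inter_assoc, Finset.inter_self]) v hv
      have e3 : ∑ u ∈ w.support, (if u ∈ w.support ∩ w'.support then g u else 0) • u = x := by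
        rw [← g2]
        simp only [ite_smul, zero_smul]
        rw [Finset.sum_ite_mem, ← Finset.inter_assoc, Finset.inter_self]
      have e4 : ∑ u ∈ w.support, w u • u = x := h.2.2.2
      rw [e3] at e2
      rw [e4] at e1
      rw [← e1, e2]
    · have : v ∉ w.support ∩ w'.support := fun h => hv (Finset.mem_inter.1 h).1
      rw [if_neg this]
      exact Finsupp.notMem_support_iff.1 hv
  have hx : ∀ {w : E d →₀ ℝ}, 𝒯.IsBarycentric x w → x ∈ hull w.support := fun h =>
    Finset.mem_convexHull'.2 ⟨_, fun v _ => h.2.1 v, h.2.2.1, h.2.2.2⟩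
  have hmem := 𝒯.complex.inter_subset_convexHull h.1 h'.1 ⟨hx h, hx h'⟩
  rw [← Finset.coe_inter] at hmem
  obtain ⟨g, -, g1, g2⟩ := Finset.mem_convexHull'.1 hmem
  ext v
  rw [key h h' g g1 g2, key h' h g (by rwa [Finset.inter_comm]) (by rwa [Finset.inter_comm]),
    Finset.inter_comm]

/-- The barycentric coordinates of a convex combination of the vertices of a simplex. -/
theorem bary_sum_smul {s : Finset (E d)} (hs : s ∈ 𝒯.complex.faces) {w : E d → ℝ}
    (h0 : ∀ v ∈ s, 0 ≤ w v) (h1 : ∑ v ∈ s, w v = 1) :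
    (∀ v ∈ s, 𝒯.bary (∑ v ∈ s, w v • v) v = w v) ∧
      ∀ v ∉ s, 𝒯.bary (∑ v ∈ s, w v • v) v = 0 := by
  classical
  set x := ∑ v ∈ s, w v • v with hx
  let w' : E d →₀ ℝ := Finsupp.onFinset s (fun v => if v ∈ s then w v else 0) (fun v hv => by
    by_contra h; simp [h] at hv)
  have e : ∀ v ∈ s, w' v = w v := fun v hv => by simp [w', hv]
  have hsub : w'.support ⊆ s := Finsupp.support_onFinset_subset
  have s1 : (w'.sum fun _ c => c) = 1 := by
    rw [Finsupp.sum_of_support_subset _ hsub _ (fun _ _ => rfl), Finset.sum_congr rfl e, h1]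
  have hb : 𝒯.IsBarycentric x w' := by
    refine ⟨𝒯.complex.down_closed hs hsub ?_, ?_, s1, ?_⟩
    · rw [Finset.nonempty_iff_ne_empty]
      intro h
      rw [Finsupp.sum, h, Finset.sum_empty] at s1
      exact zero_ne_one s1
    · intro v
      by_cases hv : v ∈ s
      · rw [e v hv]; exact h0 v hv
      · simp [w', hv]
    · rw [Finsupp.sum_of_support_subset _ hsub (fun v c => c • v) (fun _ _ => zero_smul _ _),
        Finset.sum_congr rfl fun v hv => by rw [e v hv]]
  have hbary : 𝒯.bary x = w' := by
    have hex : ∃ w, 𝒯.IsBarycentric x w := ⟨w', hb⟩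
    rw [bary, dif_pos hex]
    exact hex.choose_spec.unique hb
  rw [hbary]
  exact ⟨e, fun v hv => by simp [w', hv]⟩

/-- On a simplex of the mesh, the hat functions are the barycentric coordinates of the simplex. -/
theorem bary_eq_coord {s : Finset (E d)} (hs : s ∈ 𝒯.complex.faces) {c : E d → E d →ᵃ[ℝ] ℝ}
    (hc : IsCoordinateSystem s c) {x : E d} (hx : x ∈ hull s) (v : E d) :
    𝒯.bary x v = c v x := by
  obtain ⟨h1, h2⟩ := hc.sum_of_mem_affineSpan (hc.mem_hull_iff.1 hx).1
  have h := 𝒯.bary_sum_smul hs (w := fun v => c v x) (fun v _ => hc.nonneg hx v) h1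
  rw [h2] at h
  by_cases hv : v ∈ s
  · exact h.1 v hv
  · rw [h.2 v hv, hc.zero_of_notMem v hv]; simp

theorem bary_eq_zero {s : Finset (E d)} (hs : s ∈ 𝒯.complex.faces) {x : E d} (hx : x ∈ hull s)
    {v : E d} (hv : v ∉ s) : 𝒯.bary x v = 0 := by
  obtain ⟨c, hc⟩ := exists_isCoordinateSystem (𝒯.complex.indep hs)
  rw [𝒯.bary_eq_coord hs hc hx, hc.zero_of_notMem v hv]; simp

theorem nodePos_eq_sum {k : ℕ} (a : 𝒯.NodeIndex k) :
    𝒯.nodePos a = ∑ v ∈ a.1.support, ((a.1 v : ℝ) / k) • v := by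
  rw [nodePos, Finsupp.sum, Finset.smul_sum]
  refine Finset.sum_congr rfl fun v _ => ?_
  rw [smul_smul, div_eq_inv_mul]

theorem sum_node_weights {k : ℕ} (hk : 1 ≤ k) (a : 𝒯.NodeIndex k) :
    ∑ v ∈ a.1.support, ((a.1 v : ℝ) / k) = 1 := by
  have h : ∑ v ∈ a.1.support, a.1 v = k := a.2.2
  rw [← Finset.sum_div, ← Nat.cast_sum, h, div_self (by positivity)]

theorem nodePos_mem_hull {k : ℕ} (hk : 1 ≤ k) (a : 𝒯.NodeIndex k) :
    𝒯.nodePos a ∈ hull a.1.support :=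
  Finset.mem_convexHull'.2 ⟨_, fun _ _ => by positivity, 𝒯.sum_node_weights hk a,
    (𝒯.nodePos_eq_sum a).symm⟩

/-- A node lies in a simplex of the mesh only if its index is supported on the vertices. -/
theorem support_subset_of_nodePos_mem {k : ℕ} (hk : 1 ≤ k) (a : 𝒯.NodeIndex k) {s : Finset (E d)}
    (hs : s ∈ 𝒯.complex.faces) (h : 𝒯.nodePos a ∈ hull s) : a.1.support ⊆ s := by
  intro v hv
  by_contra hvs
  have h1 := (𝒯.bary_sum_smul a.2.1 (fun _ _ => by positivity) (𝒯.sum_node_weights hk a)).1 v hv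
  rw [← 𝒯.nodePos_eq_sum, 𝒯.bary_eq_zero hs h hvs] at h1
  have : (a.1 v : ℝ) ≠ 0 := by exact_mod_cast Finsupp.mem_support_iff.1 hv
  have hk0 : (k : ℝ) ≠ 0 := by positivity
  exact div_ne_zero this hk0 h1.symm

/-- A nodal function vanishes on the simplices that do not contain its node: for a vertex `v` of
its index outside the simplex, the factor with `j = 0` is `k` times the hat function of `v`. -/
theorem shape_eq_zero {k : ℕ} (a : 𝒯.NodeIndex k) {s : Finset (E d)}
    (hs : s ∈ 𝒯.complex.faces) {x : E d} (hx : x ∈ hull s) (h : ¬ a.1.support ⊆ s) :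
    𝒯.shape a x = 0 := by
  obtain ⟨v, hv, hvs⟩ := Finset.not_subset.1 h
  refine Finset.prod_eq_zero hv (Finset.prod_eq_zero (i := 0) ?_ ?_)
  · exact Finset.mem_range.2 (Nat.pos_of_ne_zero (Finsupp.mem_support_iff.1 hv))
  · rw [𝒯.bary_eq_zero hs hx hvs]; simp

end BulkMesh

/-! ### Local bounds for the nodal functions -/

theorem abs_prod_le_pow_card {ι : Type*} {u : Finset ι} {f : ι → ℝ} {K : ℝ}
    (hf : ∀ i ∈ u, |f i| ≤ K) : |∏ i ∈ u, f i| ≤ K ^ u.card := by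
  rw [Finset.abs_prod, ← Finset.prod_const]
  exact Finset.prod_le_prod (fun _ _ => abs_nonneg _) hf

theorem norm_fderiv_prod_le {ι F : Type*} [NormedAddCommGroup F] [NormedSpace ℝ F] [DecidableEq ι]
    {u : Finset ι} {f : ι → F → ℝ} {f' : ι → F →L[ℝ] ℝ} {x : F} {K D : ℝ} (hK : 0 ≤ K)
    (hf : ∀ i ∈ u, |f i x| ≤ K) (hf' : ∀ i ∈ u, ‖f' i‖ ≤ D) :
    ‖∑ i ∈ u, (∏ j ∈ u.erase i, f j x) • f' i‖ ≤ u.card * (K ^ (u.card - 1) * D) := by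
  refine (norm_sum_le _ _).trans ?_
  rw [← nsmul_eq_mul]
  refine Finset.sum_le_card_nsmul _ _ _ fun i hi => ?_
  rw [norm_smul]
  refine mul_le_mul ?_ (hf' i hi) (norm_nonneg _) (pow_nonneg hK _)
  rw [Real.norm_eq_abs, ← Finset.card_erase_of_mem hi]
  exact abs_prod_le_pow_card fun j hj => hf j (Finset.mem_of_mem_erase hj)

theorem norm_sq_sum_smul_le {ι F : Type*} [NormedAddCommGroup F] [NormedSpace ℝ F]
    (u : Finset ι) (x : ι → ℝ) (g : ι → F) {K : ℝ} (hg : ∀ i ∈ u, ‖g i‖ ≤ K) :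
    ‖∑ i ∈ u, x i • g i‖ ^ 2 ≤ K ^ 2 * (u.card * ∑ i ∈ u, x i ^ 2) := by
  have h1 : ‖∑ i ∈ u, x i • g i‖ ≤ ∑ i ∈ u, |x i| * K := by
    refine (norm_sum_le _ _).trans (Finset.sum_le_sum fun i hi => ?_)
    rw [norm_smul, Real.norm_eq_abs]
    exact mul_le_mul_of_nonneg_left (hg i hi) (abs_nonneg _)
  have h2 := pow_le_pow_left₀ (norm_nonneg _) h1 2
  rw [← Finset.sum_mul, mul_pow, mul_comm] at h2
  refine h2.trans (mul_le_mul_of_nonneg_left ?_ (sq_nonneg K))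
  have h3 := sq_sum_le_card_mul_sum_sq (s := u) (f := fun i => |x i|)
  simpa only [sq_abs] using h3

namespace BulkMesh

variable {d : ℕ} {Ω : Set (E d)} (𝒯 : BulkMesh Ω)

variable {𝒯} in
theorem NodeIndex.apply_le {k : ℕ} (a : 𝒯.NodeIndex k) (v : E d) : a.1 v ≤ k := by
  have h : ∑ v ∈ a.1.support, a.1 v = k := a.2.2
  by_cases hv : v ∈ a.1.support
  · exact (Finset.single_le_sum (f := fun v => a.1 v) (fun _ _ => Nat.zero_le _) hv).trans h.le
  · rw [Finsupp.notMem_support_iff.1 hv]; exact Nat.zero_le _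

theorem shape_eq_prod {k : ℕ} (a : 𝒯.NodeIndex k) {s : Finset (E d)}
    (hs : s ∈ 𝒯.complex.faces) {c : E d → E d →ᵃ[ℝ] ℝ} (hc : IsCoordinateSystem s c) {x : E d}
    (hx : x ∈ hull s) :
    𝒯.shape a x = ∏ i ∈ a.1.support.sigma (fun v => Finset.range (a.1 v)),
      ((k : ℝ) * c i.1 x - i.2) / (i.2 + 1) := by
  rw [shape, Finset.prod_sigma']
  exact Finset.prod_congr rfl fun i _ => by rw [𝒯.bary_eq_coord hs hc hx]

variable {𝒯} in
theorem NodeIndex.card_sigma {k : ℕ} (a : 𝒯.NodeIndex k) :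
    (a.1.support.sigma (fun v => Finset.range (a.1 v))).card = k := by
  rw [Finset.card_sigma]
  simp only [Finset.card_range]
  exact a.2.2

/-- The linear factors of a nodal function are at most `k` on a simplex of the mesh. -/
theorem abs_shape_factor_le {k : ℕ} {a : 𝒯.NodeIndex k} {i : (_ : E d) × ℕ}
    (hi : i ∈ a.1.support.sigma (fun v => Finset.range (a.1 v))) {z : ℝ} (h0 : 0 ≤ z)
    (h1 : z ≤ 1) : |((k : ℝ) * z - i.2) / (i.2 + 1)| ≤ k := by
  have hi2 : i.2 < a.1 i.1 := Finset.mem_range.1 (Finset.mem_sigma.1 hi).2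
  have hik : (i.2 : ℝ) ≤ k := by exact_mod_cast hi2.le.trans (a.apply_le i.1)
  have hi0 : (0 : ℝ) ≤ i.2 := Nat.cast_nonneg _
  have hk0 : (0 : ℝ) ≤ k := Nat.cast_nonneg _
  rw [abs_div, abs_of_pos (by positivity : (0 : ℝ) < i.2 + 1), div_le_iff₀ (by positivity), abs_le]
  constructor <;> nlinarith

theorem abs_shape_le {k : ℕ} (a : 𝒯.NodeIndex k) {s : Finset (E d)} (hs : s ∈ 𝒯.complex.faces)
    {x : E d} (hx : x ∈ hull s) : |𝒯.shape a x| ≤ (k : ℝ) ^ k := by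
  obtain ⟨c, hc⟩ := exists_isCoordinateSystem (𝒯.complex.indep hs)
  rw [𝒯.shape_eq_prod a hs hc hx]
  have h := abs_prod_le_pow_card (u := a.1.support.sigma fun v => Finset.range (a.1 v))
    (f := fun i => ((k : ℝ) * c i.1 x - i.2) / (i.2 + 1)) fun i hi =>
      𝒯.abs_shape_factor_le hi (hc.nonneg hx _) (hc.le_one hx _)
  rwa [a.card_sigma] at h

theorem continuousOn_shape_hull {k : ℕ} (a : 𝒯.NodeIndex k) {s : Finset (E d)}
    (hs : s ∈ 𝒯.complex.faces) : ContinuousOn (𝒯.shape a) (hull s) := by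
  obtain ⟨c, hc⟩ := exists_isCoordinateSystem (𝒯.complex.indep hs)
  refine ContinuousOn.congr (f := fun x => ∏ i ∈ a.1.support.sigma (fun v => Finset.range (a.1 v)),
      ((k : ℝ) * c i.1 x - i.2) / (i.2 + 1)) ?_ fun x hx => 𝒯.shape_eq_prod a hs hc hx
  have hcc : ∀ v, Continuous (c v) := fun v => (c v).continuous_of_finiteDimensional
  exact (continuous_finsetProd _ fun i _ =>
    ((continuous_const.mul (hcc i.1)).sub continuous_const).div_const _).continuousOn

/-- In the interior of a simplex containing a ball of radius `r`, the gradients of the nodal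
functions are bounded by a multiple of `1/r`. -/
theorem norm_gradient_shape_le {k : ℕ} (a : 𝒯.NodeIndex k) {s : Finset (E d)}
    (hs : s ∈ 𝒯.complex.faces) {z : E d} {r : ℝ} (hr : 0 < r)
    (hz : Metric.closedBall z r ⊆ hull s) {x : E d} (hx : x ∈ interior (hull s)) :
    ‖∇ (𝒯.shape a) x‖ ≤ (k : ℝ) * ((k : ℝ) ^ (k - 1) * (k * r⁻¹)) := by
  classical
  obtain ⟨c, hc⟩ := exists_isCoordinateSystem (𝒯.complex.indep hs)
  have hxs : x ∈ hull s := interior_subset hx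
  set u := a.1.support.sigma (fun v => Finset.range (a.1 v)) with hu
  set f : ((_ : E d) × ℕ) → E d → ℝ := fun i x => ((k : ℝ) * c i.1 x - i.2) / (i.2 + 1) with hf
  set L : E d → E d →L[ℝ] ℝ := fun v => LinearMap.toContinuousLinearMap (c v).linear with hL
  have hcL : ∀ v y, HasFDerivAt (c v) (L v) y := by
    intro v y
    have e : (c v : E d → ℝ) = fun x => L v x + c v 0 := by
      ext x
      have h : c v x = (c v).linear x + c v 0 := by
        have := (c v).map_vadd 0 x
        simpa using this
      exact h
    rw [e]
    exact (L v).hasFDerivAt.add_const _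
  have hLn : ∀ v, ‖L v‖ ≤ r⁻¹ := fun v =>
    ContinuousLinearMap.opNorm_le_bound _ (by positivity) fun w => hc.abs_linear_le hr hz v w
  have hder : HasFDerivAt (𝒯.shape a)
      (∑ i ∈ u, (∏ j ∈ u.erase i, f j x) • (((i.2 : ℝ) + 1)⁻¹ • ((k : ℝ) • L i.1))) x := by
    have h1 : HasFDerivAt (fun y => ∏ i ∈ u, f i y)
        (∑ i ∈ u, (∏ j ∈ u.erase i, f j x) • (((i.2 : ℝ) + 1)⁻¹ • ((k : ℝ) • L i.1))) x := by
      refine HasFDerivAt.finsetProd fun i _ => ?_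
      have h2 := ((hcL i.1 x).const_mul (k : ℝ)).sub_const (i.2 : ℝ)
      have h3 := h2.mul_const (((i.2 : ℝ) + 1)⁻¹)
      exact h3
    refine h1.congr_of_eventuallyEq ?_
    filter_upwards [mem_interior_iff_mem_nhds.1 hx] with y hy
    exact 𝒯.shape_eq_prod a hs hc hy
  have hn : ‖∇ (𝒯.shape a) x‖ = ‖fderiv ℝ (𝒯.shape a) x‖ := by
    rw [gradient, LinearIsometryEquiv.norm_map]
  rw [hn, hder.fderiv]
  have h := norm_fderiv_prod_le (u := u) (f := f) (x := x) (K := k) (D := k * r⁻¹)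
    (f' := fun i => ((i.2 : ℝ) + 1)⁻¹ • ((k : ℝ) • L i.1)) (Nat.cast_nonneg _)
    (fun i hi => 𝒯.abs_shape_factor_le hi (hc.nonneg hxs _) (hc.le_one hxs _)) (fun i _ => by
      rw [norm_smul, norm_smul, Real.norm_of_nonneg (by positivity),
        Real.norm_of_nonneg (by positivity)]
      have h1 : ((i.2 : ℝ) + 1)⁻¹ ≤ 1 := inv_le_one_of_one_le₀ (by
        have : (0 : ℝ) ≤ i.2 := Nat.cast_nonneg _
        linarith)
      calc ((i.2 : ℝ) + 1)⁻¹ * (k * ‖L i.1‖) ≤ 1 * (k * ‖L i.1‖) :=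
            mul_le_mul_of_nonneg_right h1 (by positivity)
        _ ≤ k * r⁻¹ := by rw [one_mul]; exact mul_le_mul_of_nonneg_left (hLn _) (Nat.cast_nonneg _))
  rwa [hu, a.card_sigma, ← hu] at h

theorem gradient_shape_eq_zero {k : ℕ} (a : 𝒯.NodeIndex k) {s : Finset (E d)}
    (hs : s ∈ 𝒯.complex.faces) (h : ¬ a.1.support ⊆ s) {x : E d} (hx : x ∈ interior (hull s)) :
    ∇ (𝒯.shape a) x = 0 := by
  have e : 𝒯.shape a =ᶠ[nhds x] fun _ => (0 : ℝ) := by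
    filter_upwards [mem_interior_iff_mem_nhds.1 hx] with y hy
    exact 𝒯.shape_eq_zero a hs hy h
  rw [gradient, e.fderiv_eq]
  simp

open Classical in
/-- The boundary nodes that belong to a simplex. -/
def nodesOf (k : ℕ) (s : Finset (E d)) : Finset (𝒯.BoundaryNode k) :=
  Finset.univ.filter fun b => b.1.1.support ⊆ s

theorem mem_nodesOf {k : ℕ} {s : Finset (E d)} {b : 𝒯.BoundaryNode k} :
    b ∈ 𝒯.nodesOf k s ↔ b.1.1.support ⊆ s := by
  simp [nodesOf]

theorem card_nodesOf_le (k : ℕ) (s : Finset (E d)) :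
    (𝒯.nodesOf k s).card ≤ (k + 1) ^ s.card := by
  classical
  have h : Fintype.card (𝒯.nodesOf k s) ≤ Fintype.card (s → Fin (k + 1)) := by
    refine Fintype.card_le_of_injective
      (fun b v => ⟨b.1.1.1 v, Nat.lt_succ_of_le (b.1.1.apply_le v)⟩) fun b b' hbb => ?_
    have hb := 𝒯.mem_nodesOf.1 b.2
    have hb' := 𝒯.mem_nodesOf.1 b'.2
    refine Subtype.ext (Subtype.ext (Subtype.ext (Finsupp.ext fun v => ?_)))
    by_cases hv : v ∈ s
    · have := congrFun hbb ⟨v, hv⟩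
      exact congrArg Fin.val this
    · rw [Finsupp.notMem_support_iff.1 fun h => hv (hb h),
        Finsupp.notMem_support_iff.1 fun h => hv (hb' h)]
  simpa using h

/-! ### Volumes and overlap of simplices -/

theorem diam_hull_le {s : Finset (E d)} (hs : s ∈ 𝒯.complex.faces) :
    Metric.diam (hull s) ≤ 𝒯.meshWidth :=
  le_csSup (𝒯.finite.image _).bddAbove ⟨s, hs, rfl⟩

theorem isCompact_hull (s : Finset (E d)) : IsCompact (hull s) :=
  s.finite_toSet.isCompact_convexHull (𝕜 := ℝ)

theorem hull_subset_closedBall {s : Finset (E d)} (hs : s ∈ 𝒯.complex.faces) {x : E d}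
    (hx : x ∈ hull s) : hull s ⊆ Metric.closedBall x 𝒯.meshWidth := fun _ hy =>
  (Metric.dist_le_diam_of_mem (isCompact_hull s).isBounded hy hx).trans (𝒯.diam_hull_le hs)

/-- Distinct cells overlap in a null set, as a vertex of one of them is missing in the other. -/
theorem volume_hull_inter {s t : Finset (E d)} (hs : s ∈ 𝒯.complex.faces)
    (ht : t ∈ 𝒯.complex.faces) (hsd : s.card = d + 1) (htd : t.card = d + 1) (hst : s ≠ t) :
    volume (hull s ∩ hull t) = 0 := by
  obtain ⟨v, hv, hvt⟩ : ∃ v ∈ s, v ∉ t := by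
    by_contra! h
    exact hst (Finset.eq_of_subset_of_card_le h (by omega))
  have hsub : hull s ∩ hull t ⊆ (affineSpan ℝ ((s : Set (E d)) \ {v}) : Set (E d)) := by
    refine (𝒯.complex.inter_subset_convexHull hs ht).trans ((convexHull_mono ?_).trans
      (convexHull_subset_affineSpan _))
    rintro u ⟨hu1, hu2⟩
    exact ⟨hu1, fun h => hvt (by rw [Set.mem_singleton_iff] at h; rwa [← h])⟩
  refine measure_mono_null hsub (Measure.addHaar_affineSubspace _ _ fun h => ?_)
  have := (𝒯.complex.indep hs).notMem_affineSpan_sdiff ⟨v, hv⟩ Set.univ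
  apply this
  have e : ((↑) : s → E d) '' (Set.univ \ {⟨v, hv⟩}) = (s : Set (E d)) \ {v} := by
    ext u
    constructor
    · rintro ⟨⟨u', hu'⟩, h1, rfl⟩
      exact ⟨hu', fun h => h1.2 (Subtype.ext h)⟩
    · rintro ⟨h1, h2⟩
      exact ⟨⟨u, h1⟩, ⟨trivial, fun h => h2 (congrArg Subtype.val h)⟩, rfl⟩
  rw [e, h]
  trivial

/-- The `d`-dimensional simplices of the mesh. -/
def cells : Finset (Finset (E d)) :=
  (𝒯.finite.subset (Set.sep_subset 𝒯.complex.faces (fun s => s.card = d + 1))).toFinset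

theorem mem_cells {s : Finset (E d)} : s ∈ 𝒯.cells ↔ s ∈ 𝒯.complex.faces ∧ s.card = d + 1 := by
  simp [cells]

variable {𝒯} in
/-- A point lies in at most `ρ ^ d` simplices, since disjoint balls of radius `h / ρ` inside
them fit into a ball of radius `h`. -/
theorem IsQuasiUniform.card_le {ρ : ℝ} (hq : 𝒯.IsQuasiUniform ρ) (hρ : 0 < ρ)
    (hh : 0 < 𝒯.meshWidth) {S : Finset (Finset (E d))} (hS : S ⊆ 𝒯.cells) {x : E d}
    (hx : ∀ s ∈ S, x ∈ hull s) : (S.card : ℝ) ≤ ρ ^ d := by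
  set h := 𝒯.meshWidth
  set ω := volume (Metric.ball (0 : E d) 1) with hω
  have hω0 : ω ≠ 0 := (Metric.measure_ball_pos _ _ one_pos).ne'
  have hω1 : ω ≠ ⊤ := measure_ball_lt_top.ne
  have hsum : ∑ s ∈ S, volume (hull s) ≤ volume (Metric.closedBall x h) := by
    rw [← measure_biUnion_finset₀]
    · refine measure_mono (Set.iUnion₂_subset fun s hs => ?_)
      exact 𝒯.hull_subset_closedBall (𝒯.mem_cells.1 (hS hs)).1 (hx s hs)
    · intro s hs t ht hst
      have h1 := 𝒯.mem_cells.1 (hS hs)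
      have h2 := 𝒯.mem_cells.1 (hS ht)
      exact 𝒯.volume_hull_inter h1.1 h2.1 h1.2 h2.2 hst
    · exact fun s _ => (isCompact_hull s).measurableSet.nullMeasurableSet
  have hlow : ∀ s ∈ S, ENNReal.ofReal ((h / ρ) ^ d) * ω ≤ volume (hull s) := by
    intro s hs
    have h1 := 𝒯.mem_cells.1 (hS hs)
    obtain ⟨z, hz⟩ := hq s h1.1 h1.2
    refine le_trans (le_of_eq ?_) (measure_mono hz)
    rw [Measure.addHaar_closedBall _ _ (by positivity), finrank_euclideanSpace_fin]
  have h3 : (S.card : ℝ≥0∞) * ENNReal.ofReal ((h / ρ) ^ d) ≤ ENNReal.ofReal (h ^ d) := by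
    have h4 := (Finset.card_nsmul_le_sum S _ _ hlow).trans hsum
    rw [Measure.addHaar_closedBall _ _ hh.le, finrank_euclideanSpace_fin, nsmul_eq_mul,
      ← mul_assoc] at h4
    exact (ENNReal.mul_le_mul_iff_left hω0 hω1).1 h4
  rw [← ENNReal.ofReal_natCast, ← ENNReal.ofReal_mul (Nat.cast_nonneg _),
    ENNReal.ofReal_le_ofReal_iff (by positivity), div_pow, mul_div_assoc',
    div_le_iff₀ (by positivity), mul_comm] at h3
  exact le_of_mul_le_mul_left h3 (by positivity)

theorem volume_hull_le {s : Finset (E d)} (hs : s ∈ 𝒯.complex.faces) :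
    volume.real (hull s) ≤ 𝒯.meshWidth ^ d * volume.real (Metric.ball (0 : E d) 1) := by
  obtain ⟨x, hx⟩ := 𝒯.complex.nonempty_of_mem_faces hs
  have hh : 0 ≤ 𝒯.meshWidth := Metric.diam_nonneg.trans (𝒯.diam_hull_le hs)
  have h1 : volume.real (hull s) ≤ volume.real (Metric.closedBall x 𝒯.meshWidth) :=
    measureReal_mono (𝒯.hull_subset_closedBall hs (subset_convexHull ℝ _ hx))
      measure_closedBall_lt_top.ne
  refine h1.trans_eq ?_
  rw [measureReal_def, Measure.addHaar_closedBall _ _ hh, finrank_euclideanSpace_fin,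
    ENNReal.toReal_mul, ENNReal.toReal_ofReal (by positivity), measureReal_def]

theorem closure_eq_biUnion_cells : closure Ω = ⋃ s ∈ 𝒯.cells, hull s := by
  rw [← 𝒯.space_eq]
  refine Set.Subset.antisymm (fun x hx => ?_) (Set.iUnion₂_subset fun s hs =>
    Geometry.SimplicialComplex.convexHull_subset_space (𝒯.mem_cells.1 hs).1)
  obtain ⟨s, hs, hxs⟩ := Geometry.SimplicialComplex.mem_space_iff.1 hx
  obtain ⟨t, ht, hst, htd⟩ := 𝒯.pure s hs
  exact Set.mem_biUnion (𝒯.mem_cells.2 ⟨ht, htd⟩) (convexHull_mono (by exact_mod_cast hst) hxs)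

end BulkMesh

/-! ### Lagrange functions on the reference simplex -/

/-- A continuous positive definite function that is homogeneous of degree two is bounded below by
a multiple of the squared norm. -/
theorem exists_coercive {V : Type*} [NormedAddCommGroup V] [NormedSpace ℝ V]
    [FiniteDimensional ℝ V] {q : V → ℝ} (hq : Continuous q)
    (hhom : ∀ (t : ℝ) c, q (t • c) = t ^ 2 * q c) (hpos : ∀ c, c ≠ 0 → 0 < q c) :
    ∃ γ > 0, ∀ c, γ * ‖c‖ ^ 2 ≤ q c := by
  have h0 : q 0 = 0 := by simpa using hhom 0 0
  rcases (Metric.sphere (0 : V) 1).eq_empty_or_nonempty with he | hne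
  · refine ⟨1, one_pos, fun c => ?_⟩
    have hc : c = 0 := by
      by_contra h
      have : (‖c‖⁻¹ • c) ∈ Metric.sphere (0 : V) 1 := by
        simp [norm_smul, inv_mul_cancel₀ (norm_ne_zero_iff.2 h)]
      rw [he] at this
      exact this
    simp [hc, h0]
  · obtain ⟨c₀, hc₀, hmin⟩ := (isCompact_sphere (0 : V) 1).exists_isMinOn hne hq.continuousOn
    have hc₀' : c₀ ≠ 0 := by
      rintro rfl
      simp at hc₀
    refine ⟨q c₀, hpos _ hc₀', fun c => ?_⟩
    by_cases hc : c = 0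
    · simp [hc, h0]
    have hn : ‖c‖ ≠ 0 := norm_ne_zero_iff.2 hc
    have h1 : q c₀ ≤ q (‖c‖⁻¹ • c) := hmin (by simp [norm_smul, inv_mul_cancel₀ hn])
    rw [hhom, inv_pow] at h1
    have h2 := mul_le_mul_of_nonneg_right h1 (sq_nonneg ‖c‖)
    rwa [mul_right_comm, inv_mul_cancel₀ (pow_ne_zero 2 hn), one_mul] at h2

/-- The reference simplex in `ℝ^n`. -/
def refSimplex (n : ℕ) : Set (Fin n → ℝ) := {y | (∀ i, 0 ≤ y i) ∧ ∑ i, y i ≤ 1}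

/-- The barycentric coordinates on the reference simplex; the origin is the vertex `0`. -/
def refBary {n : ℕ} (y : Fin n → ℝ) : Fin (n + 1) → ℝ := Fin.cons (1 - ∑ i, y i) y

/-- The Lagrange function of degree `k` with multi-index `α` in barycentric coordinates. -/
def refShape {n : ℕ} (k : ℕ) (α : Fin (n + 1) → ℕ) (z : Fin (n + 1) → ℝ) : ℝ :=
  ∏ i, ∏ j ∈ Finset.range (α i), ((k : ℝ) * z i - j) / (j + 1)

theorem sum_refBary {n : ℕ} (y : Fin n → ℝ) : ∑ i, refBary y i = 1 := by
  simp [refBary, Fin.sum_univ_succ]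

theorem refBary_nonneg {n : ℕ} {y : Fin n → ℝ} (hy : y ∈ refSimplex n) (i : Fin (n + 1)) :
    0 ≤ refBary y i := by
  refine Fin.cases ?_ (fun i => ?_) i
  · simpa [refBary] using hy.2
  · simpa [refBary] using hy.1 i

theorem continuous_refBary {n : ℕ} (i : Fin (n + 1)) :
    Continuous fun y : Fin n → ℝ => refBary y i := by
  refine Fin.cases ?_ (fun i => ?_) i
  · simp only [refBary, Fin.cons_zero]; fun_prop
  · simp only [refBary, Fin.cons_succ]; fun_prop

theorem continuous_refShape {n : ℕ} (k : ℕ) (α : Fin (n + 1) → ℕ) :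
    Continuous fun y : Fin n → ℝ => refShape k α (refBary y) :=
  continuous_finsetProd _ fun i _ => continuous_finsetProd _ fun _ _ =>
    ((continuous_const.mul (continuous_refBary i)).sub continuous_const).div_const _

theorem isCompact_refSimplex (n : ℕ) : IsCompact (refSimplex n) := by
  refine (isCompact_Icc (a := (0 : Fin n → ℝ)) (b := 1)).of_isClosed_subset ?_ fun y hy => ?_
  · have e : refSimplex n = (⋂ i, {y : Fin n → ℝ | 0 ≤ y i}) ∩ {y | ∑ i, y i ≤ 1} := by
      ext y; simp [refSimplex]
    rw [e]
    exact (isClosed_iInter fun i => isClosed_le continuous_const (continuous_apply i)).inter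
      (isClosed_le (by fun_prop) continuous_const)
  · exact ⟨fun i => hy.1 i, fun i =>
      (Finset.single_le_sum (fun j _ => hy.1 j) (Finset.mem_univ i)).trans hy.2⟩

theorem refSimplex_subset_closure (n : ℕ) :
    refSimplex n ⊆ closure (interior (refSimplex n)) := by
  have hconv : Convex ℝ (refSimplex n) := by
    intro x hx y hy a b ha hb hab
    refine ⟨fun i => ?_, ?_⟩
    · have := hx.1 i
      have := hy.1 i
      simp only [Pi.add_apply, Pi.smul_apply, smul_eq_mul]
      positivity
    · simp only [Pi.add_apply, Pi.smul_apply, smul_eq_mul, Finset.sum_add_distrib,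
        ← Finset.mul_sum]
      nlinarith [hx.2, hy.2]
  have hne : (interior (refSimplex n)).Nonempty := by
    have hopen : IsOpen ((⋂ i, {y : Fin n → ℝ | 0 < y i}) ∩ {y | ∑ i, y i < 1}) :=
      (isOpen_iInter_of_finite fun i => isOpen_lt continuous_const (continuous_apply i)).inter
        (isOpen_lt (by fun_prop) continuous_const)
    refine ⟨fun _ => 1 / (n + 1), ?_⟩
    refine mem_interior.2 ⟨_, ?_, hopen, ?_, ?_⟩
    · rintro y ⟨h1, h2⟩
      exact ⟨fun i => (Set.mem_iInter.1 h1 i).le, le_of_lt h2⟩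
    · refine Set.mem_iInter.2 fun i => ?_
      change (0 : ℝ) < 1 / (n + 1)
      positivity
    · change ∑ _i : Fin n, (1 : ℝ) / (n + 1) < 1
      rw [Finset.sum_const, Finset.card_univ, Fintype.card_fin, nsmul_eq_mul, mul_one_div,
        div_lt_one (by positivity)]
      linarith
  rw [hconv.closure_interior_eq_closure_of_nonempty_interior hne]
  exact subset_closure

theorem refShape_node_self {n k : ℕ} (hk : 1 ≤ k) (α : Fin (n + 1) → ℕ) :
    refShape k α (fun i => (α i : ℝ) / k) ≠ 0 := by
  have hk0 : (k : ℝ) ≠ 0 := by positivity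
  refine Finset.prod_ne_zero_iff.2 fun i _ => Finset.prod_ne_zero_iff.2 fun j hj => ?_
  have hj' : (j : ℝ) < α i := by exact_mod_cast Finset.mem_range.1 hj
  rw [mul_div_cancel₀ _ hk0]
  exact div_ne_zero (by linarith) (by positivity)

theorem refShape_node_of_ne {n k : ℕ} (hk : 1 ≤ k) {α β : Fin (n + 1) → ℕ} (hα : ∑ i, α i = k)
    (hβ : ∑ i, β i = k) (h : β ≠ α) : refShape k β (fun i => (α i : ℝ) / k) = 0 := by
  have hk0 : (k : ℝ) ≠ 0 := by positivity
  obtain ⟨i, hi⟩ : ∃ i, α i < β i := by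
    by_contra! hle
    refine h (funext fun i => ?_)
    exact (Finset.sum_eq_sum_iff_of_le fun i _ => hle i).1 (hβ.trans hα.symm) i (Finset.mem_univ i)
  refine Finset.prod_eq_zero (Finset.mem_univ i)
    (Finset.prod_eq_zero (Finset.mem_range.2 hi) ?_)
  rw [mul_div_cancel₀ _ hk0]
  simp

/-- The `L²` norm of a Lagrange interpolant on the reference simplex controls its nodal values. -/
theorem exists_ref_lower (n : ℕ) {k : ℕ} (hk : 1 ≤ k) : ∃ γ > 0, ∀ c : (Fin (n + 1) → ℕ) → ℝ,
    γ * ∑ α ∈ Finset.univ.piAntidiag k, c α ^ 2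
      ≤ ∫ y in refSimplex n,
        (∑ α ∈ Finset.univ.piAntidiag k, c α * refShape k α (refBary y)) ^ 2 := by
  classical
  set A : Finset (Fin (n + 1) → ℕ) := Finset.univ.piAntidiag k with hA
  have hk0 : (k : ℝ) ≠ 0 := by positivity
  let φ : EuclideanSpace ℝ A → (Fin n → ℝ) → ℝ := fun c y =>
    ∑ α : A, c α * refShape k α.1 (refBary y)
  have hφ : ∀ c, Continuous (φ c) := fun c =>
    continuous_finsetSum _ fun α _ => continuous_const.mul (continuous_refShape k α.1)
  have hint : ∀ g : (Fin n → ℝ) → ℝ, Continuous g → IntegrableOn g (refSimplex n) := fun g hg =>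
    hg.continuousOn.integrableOn_compact (isCompact_refSimplex n)
  have hmeas : MeasurableSet (refSimplex n) := (isCompact_refSimplex n).measurableSet
  -- `q` is a quadratic form; it is definite since a vanishing interpolant has zero nodal values
  let q : EuclideanSpace ℝ A → ℝ := fun c => ∫ y in refSimplex n, φ c y ^ 2
  have hqe : ∀ c, q c = ∑ α : A, ∑ β : A, c α * c β *
      ∫ y in refSimplex n, refShape k α.1 (refBary y) * refShape k β.1 (refBary y) := by
    intro c
    have e : ∀ y, φ c y ^ 2 = ∑ α : A, ∑ β : A,
        c α * c β * (refShape k α.1 (refBary y) * refShape k β.1 (refBary y)) := by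
      intro y
      rw [sq, Finset.sum_mul_sum]
      exact Finset.sum_congr rfl fun α _ => Finset.sum_congr rfl fun β _ => by ring
    have hI : ∀ α β : A, IntegrableOn (fun y => c α * c β *
        (refShape k α.1 (refBary y) * refShape k β.1 (refBary y))) (refSimplex n) := fun α β =>
      hint _ (continuous_const.mul ((continuous_refShape k α.1).mul (continuous_refShape k β.1)))
    simp only [q, e]
    rw [integral_finsetSum _ fun α _ => integrable_finsetSum _ fun β _ => hI α β]
    refine Finset.sum_congr rfl fun α _ => ?_
    rw [integral_finsetSum _ fun β _ => hI α β]
    exact Finset.sum_congr rfl fun β _ => integral_const_mul _ _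
  have hqc : Continuous q := by
    have : q = _ := funext hqe
    rw [this]
    fun_prop
  have hhom : ∀ (t : ℝ) c, q (t • c) = t ^ 2 * q c := by
    intro t c
    rw [hqe, hqe, Finset.mul_sum]
    refine Finset.sum_congr rfl fun α _ => ?_
    rw [Finset.mul_sum]
    refine Finset.sum_congr rfl fun β _ => ?_
    simp only [PiLp.smul_apply, smul_eq_mul]
    ring
  have hpos : ∀ c, c ≠ 0 → 0 < q c := by
    intro c hc
    refine lt_of_le_of_ne (integral_nonneg fun y => sq_nonneg _) fun h0 => hc ?_
    have hae : (fun y => φ c y ^ 2) =ᵐ[volume.restrict (refSimplex n)] 0 :=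
      (integral_eq_zero_iff_of_nonneg (fun y => sq_nonneg _) (hint _ ((hφ c).pow 2))).1 h0.symm
    have hon := Measure.eqOn_of_ae_eq hae ((hφ c).pow 2).continuousOn continuousOn_const
      (refSimplex_subset_closure n)
    ext α
    have hα : ∑ i, α.1 i = k := (Finset.mem_piAntidiag.1 α.2).1
    have hαr : ∑ i, (α.1 i : ℝ) = k := by exact_mod_cast hα
    -- evaluation at the node of `α`
    have hbary : refBary (fun i : Fin n => (α.1 i.succ : ℝ) / k) = fun i => (α.1 i : ℝ) / k := by
      funext i
      refine Fin.cases ?_ (fun i => ?_) i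
      · simp only [refBary, Fin.cons_zero]
        rw [← Finset.sum_div, eq_comm, div_eq_iff hk0, sub_mul, div_mul_cancel₀ _ hk0]
        rw [Fin.sum_univ_succ] at hαr
        linarith
      · simp [refBary]
    have hmem : (fun i : Fin n => (α.1 i.succ : ℝ) / k) ∈ refSimplex n := by
      refine ⟨fun i => by positivity, ?_⟩
      rw [← Finset.sum_div, div_le_one (by positivity)]
      rw [Fin.sum_univ_succ] at hαr
      have : (0 : ℝ) ≤ α.1 0 := Nat.cast_nonneg _
      linarith
    have h1 := pow_eq_zero_iff (two_ne_zero) |>.1 (hon hmem)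
    change ∑ β : A, c β * refShape k β.1 (refBary _) = 0 at h1
    rw [hbary, Finset.sum_eq_single α] at h1
    · exact (mul_eq_zero.1 h1).resolve_right (refShape_node_self hk _)
    · intro β _ hβ
      rw [refShape_node_of_ne hk hα (Finset.mem_piAntidiag.1 β.2).1
        fun h => hβ (Subtype.ext h), mul_zero]
    · exact fun h => (h (Finset.mem_univ _)).elim
  obtain ⟨γ, hγ, hb⟩ := exists_coercive hqc hhom hpos
  refine ⟨γ, hγ, fun c => ?_⟩
  have h := hb (WithLp.toLp 2 fun α : A => c α)
  rw [EuclideanSpace.norm_sq_eq] at h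
  simp only [Real.norm_eq_abs, sq_abs] at h
  rw [← Finset.sum_coe_sort A]
  refine h.trans_eq (integral_congr_ae (Filter.Eventually.of_forall fun y => ?_))
  dsimp only [φ]
  rw [← Finset.sum_coe_sort A]

/-! ### Parametrization of simplices -/

section SimplexMap

variable {d n : ℕ}

/-- The affine parametrization of the simplex with vertices `f i` by the reference simplex. -/
def simplexMap (f : Fin (n + 1) → E d) (y : Fin n → ℝ) : E d := ∑ i, refBary y i • f i

theorem exists_lipschitzWith_simplexMap (f : Fin (n + 1) → E d) :
    ∃ K : ℝ≥0, LipschitzWith K (simplexMap f) := by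
  let L : (Fin n → ℝ) →ₗ[ℝ] E d := Fintype.linearCombination ℝ fun i => f i.succ - f 0
  have e : simplexMap f = fun y => LinearMap.toContinuousLinearMap L y + f 0 := by
    funext y
    change _ = L y + f 0
    simp only [simplexMap, refBary, Fin.sum_univ_succ, Fin.cons_zero, Fin.cons_succ, L,
      Fintype.linearCombination_apply, smul_sub, Finset.sum_sub_distrib, sub_smul, one_smul,
      Finset.sum_smul]
    abel
  rw [e]
  exact ⟨_, (LinearMap.toContinuousLinearMap L).lipschitz.add (LipschitzWith.const (f 0))⟩

theorem continuous_simplexMap (f : Fin (n + 1) → E d) : Continuous (simplexMap f) :=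
  (exists_lipschitzWith_simplexMap f).choose_spec.continuous

/-- Every set of `n + 1` points has an enumeration. -/
theorem exists_enumeration {s : Finset (E d)} (hs : s.card = n + 1) :
    ∃ f : Fin (n + 1) ↪ E d, Finset.univ.map f = s := by
  let e := s.equivFinOfCardEq hs
  refine ⟨e.symm.toEmbedding.trans (Function.Embedding.subtype _), ?_⟩
  ext v
  simp only [Finset.mem_map, Finset.mem_univ, true_and]
  constructor
  · rintro ⟨i, rfl⟩
    exact (e.symm i).2
  · intro hv
    exact ⟨e ⟨v, hv⟩, by simp⟩

variable (f : Fin (n + 1) ↪ E d)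

theorem simplexMap_eq_sum (y : Fin n → ℝ) :
    simplexMap f y = ∑ v ∈ Finset.univ.map f, Function.extend f (refBary y) 0 v • v := by
  rw [simplexMap, Finset.sum_map]
  exact Finset.sum_congr rfl fun i _ => by rw [f.injective.extend_apply]

theorem simplexMap_mem_hull {y : Fin n → ℝ} (hy : y ∈ refSimplex n) :
    simplexMap f y ∈ hull (Finset.univ.map f) := by
  refine Finset.mem_convexHull'.2 ⟨Function.extend f (refBary y) 0, ?_, ?_,
    (simplexMap_eq_sum f y).symm⟩
  · intro v hv
    obtain ⟨i, -, rfl⟩ := Finset.mem_map.1 hv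
    rw [f.injective.extend_apply]
    exact refBary_nonneg hy i
  · rw [Finset.sum_map, ← sum_refBary y]
    exact Finset.sum_congr rfl fun i _ => by rw [f.injective.extend_apply]

theorem hull_subset_image_simplexMap :
    hull (Finset.univ.map f) ⊆ simplexMap f '' refSimplex n := by
  intro x hx
  obtain ⟨w, h0, h1, rfl⟩ := Finset.mem_convexHull'.1 hx
  rw [Finset.sum_map, Fin.sum_univ_succ] at h1
  have hw : ∀ i, 0 ≤ w (f i) := fun i => h0 _ (Finset.mem_map_of_mem _ (Finset.mem_univ i))
  refine ⟨fun i => w (f i.succ), ⟨fun i => hw _, ?_⟩, ?_⟩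
  · have := hw 0
    linarith
  · rw [simplexMap, Finset.sum_map]
    refine Finset.sum_congr rfl fun i _ => ?_
    congr 1
    refine Fin.cases ?_ (fun i => ?_) i
    · simp only [refBary, Fin.cons_zero]
      linarith
    · simp only [refBary, Fin.cons_succ]

/-- Simplices with `n + 1` vertices have finite `n`-dimensional measure. -/
theorem hausdorffMeasure_hull_lt_top {s : Finset (E d)} (hs : s.card = n + 1) :
    (μHE[n] : Measure (E d)) (hull s) < ⊤ := by
  obtain ⟨f, rfl⟩ := exists_enumeration hs
  obtain ⟨K, hK⟩ := exists_lipschitzWith_simplexMap f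
  have h1 : (μH[n] : Measure (E d)) (hull (Finset.univ.map f)) < ⊤ := by
    refine (measure_mono (hull_subset_image_simplexMap f)).trans_lt
      ((hK.hausdorffMeasure_image_le (Nat.cast_nonneg n) _).trans_lt ?_)
    refine ENNReal.mul_lt_top (by simp) ?_
    have := hausdorffMeasure_pi_real (ι := Fin n)
    rw [Fintype.card_fin] at this
    rw [this]
    exact (isCompact_refSimplex n).measure_lt_top
  rw [Measure.euclideanHausdorffMeasure_def, Measure.smul_apply, ENNReal.smul_def, smul_eq_mul]
  exact ENNReal.mul_lt_top ENNReal.coe_lt_top h1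

/-- Simplices with at most `n` vertices are null sets for the `n`-dimensional measure. -/
theorem hausdorffMeasure_hull_eq_zero {s : Finset (E d)} (hs : s.card ≤ n) :
    (μHE[n] : Measure (E d)) (hull s) = 0 := by
  rw [Measure.euclideanHausdorffMeasure_def, Measure.smul_apply]
  suffices h : (μH[n] : Measure (E d)) (hull s) = 0 by rw [h]; simp
  rcases s.eq_empty_or_nonempty with rfl | hne
  · rw [hull, Finset.coe_empty, convexHull_empty, measure_empty]
  have hd := Real.Convex.dimH_eq_finrank_vectorSpan (convex_convexHull ℝ (s : Set (E d)))
    (convexHull_nonempty_iff.2 hne)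
  have hlt : Module.finrank ℝ (vectorSpan ℝ (hull s)) < n := by
    rw [← direction_affineSpan, affineSpan_convexHull, direction_affineSpan]
    have : Nonempty s := hne.coe_sort
    have h := finrank_vectorSpan_range_add_one_le ℝ ((↑) : s → E d)
    rw [Fintype.card_coe, Subtype.range_coe_subtype, Finset.setOfPred_mem] at h
    omega
  have := hausdorffMeasure_of_dimH_lt (s := hull s) (d := (n : ℝ≥0)) (by
    rw [hd]; exact_mod_cast hlt)
  simpa using this

end SimplexMap

namespace BulkMesh

variable {d n : ℕ} {Ω : Set (E d)} (𝒯 : BulkMesh Ω)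

theorem bary_simplexMap (f : Fin (n + 1) ↪ E d) (hf : Finset.univ.map f ∈ 𝒯.complex.faces)
    {y : Fin n → ℝ} (hy : y ∈ refSimplex n) (i : Fin (n + 1)) :
    𝒯.bary (simplexMap f y) (f i) = refBary y i := by
  rw [simplexMap_eq_sum, (𝒯.bary_sum_smul hf (w := Function.extend f (refBary y) 0) ?_ ?_).1 _
    (Finset.mem_map_of_mem _ (Finset.mem_univ i)), f.injective.extend_apply]
  · intro v hv
    obtain ⟨i, -, rfl⟩ := Finset.mem_map.1 hv
    rw [f.injective.extend_apply]
    exact refBary_nonneg hy i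
  · rw [Finset.sum_map, ← sum_refBary y]
    exact Finset.sum_congr rfl fun i _ => by rw [f.injective.extend_apply]

/-- Nodal functions of a face are pulled back to Lagrange functions on the reference simplex. -/
theorem shape_simplexMap {k : ℕ} (a : 𝒯.NodeIndex k) (f : Fin (n + 1) ↪ E d)
    (hf : Finset.univ.map f ∈ 𝒯.complex.faces) (ha : a.1.support ⊆ Finset.univ.map f)
    {y : Fin n → ℝ} (hy : y ∈ refSimplex n) :
    𝒯.shape a (simplexMap f y) = refShape k (fun i => a.1 (f i)) (refBary y) := by
  rw [shape, Finset.prod_subset ha, Finset.prod_map, refShape]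
  · exact Finset.prod_congr rfl fun i _ => by rw [𝒯.bary_simplexMap f hf hy]
  · intro v _ hv
    rw [Finsupp.notMem_support_iff.1 hv]
    simp

/-- The parametrization of a face of a simplex containing a ball of radius `r` stretches
distances at least by the factor `r`; hence it pushes Lebesgue measure forward to at most a
multiple `r⁻ⁿ` of the surface measure. -/
theorem map_simplexMap_le (f : Fin (n + 1) ↪ E d) {t : Finset (E d)} (ht : t ∈ 𝒯.complex.faces)
    (hft : Finset.univ.map f ⊆ t) {z : E d} {r : ℝ≥0} (hr : 0 < r)
    (hz : Metric.closedBall z r ⊆ hull t) :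
    (volume.restrict (refSimplex n)).map (simplexMap f) ≤
      (((r⁻¹ : ℝ≥0) : ℝ≥0∞) ^ n *
        ((Measure.addHaarScalarFactor (volume : Measure (EuclideanSpace ℝ (Fin n)))
          μH[n])⁻¹ : ℝ≥0)) •
      (μHE[n] : Measure (E d)).restrict (hull (Finset.univ.map f)) := by
  obtain ⟨c, hc⟩ := exists_isCoordinateSystem (𝒯.complex.indep ht)
  have hF : Finset.univ.map f ∈ 𝒯.complex.faces :=
    𝒯.complex.down_closed ht hft (by simp)
  -- the coordinates of the surrounding simplex give a Lipschitz left inverse; on `ℝ^n` with the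
  -- maximum norm, Hausdorff and Lebesgue measure agree
  set g : E d → Fin n → ℝ := fun x i => c (f i.succ) x with hg
  have hgL : LipschitzWith r⁻¹ g := by
    refine LipschitzWith.of_dist_le_mul fun x x' => ?_
    refine (dist_pi_le_iff (by positivity)).2 fun i => ?_
    have h := hc.abs_linear_le (by exact_mod_cast hr) hz (f i.succ) (x - x')
    have e : (c (f i.succ)).linear (x - x') = c (f i.succ) x - c (f i.succ) x' := by
      have := (c (f i.succ)).linearMap_vsub x x'
      simpa using this
    rw [e] at h
    rw [Real.dist_eq, dist_eq_norm, NNReal.coe_inv]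
    exact h
  have hgf : ∀ y ∈ refSimplex n, g (simplexMap f y) = y := by
    intro y hy
    funext i
    have hm : simplexMap f y ∈ hull t :=
      convexHull_mono (by exact_mod_cast hft) (simplexMap_mem_hull f hy)
    rw [hg]
    dsimp only
    rw [← 𝒯.bary_eq_coord ht hc hm, 𝒯.bary_simplexMap f hF hy]
    simp [refBary]
  have hcont := continuous_simplexMap f
  set s := Measure.addHaarScalarFactor (volume : Measure (EuclideanSpace ℝ (Fin n))) μH[n] with hs
  have hs0 : s ≠ 0 := Measure.addHaarScalarFactor_volume_hausdorffMeasure_ne_zero n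
  refine Measure.le_iff.2 fun B hB => ?_
  rw [Measure.map_apply hcont.measurable hB, Measure.restrict_apply (hcont.measurable hB),
    Measure.smul_apply, Measure.restrict_apply hB, Measure.euclideanHausdorffMeasure_def,
    Measure.smul_apply, ← hs, ENNReal.smul_def, smul_eq_mul, smul_eq_mul, mul_assoc]
  rw [← mul_assoc ((s⁻¹ : ℝ≥0) : ℝ≥0∞), ← ENNReal.coe_mul, inv_mul_cancel₀ hs0, ENNReal.coe_one,
    one_mul]
  set A := simplexMap f ⁻¹' B ∩ refSimplex n with hA
  have e1 : A = g '' (simplexMap f '' A) := by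
    rw [Set.image_image]
    ext y
    constructor
    · exact fun hy => ⟨y, hy, hgf y hy.2⟩
    · rintro ⟨y', hy', rfl⟩
      change g (simplexMap f y') ∈ A
      rwa [hgf y' hy'.2]
  have e2 := hausdorffMeasure_pi_real (ι := Fin n)
  rw [Fintype.card_fin] at e2
  have h1 : simplexMap f '' A ⊆ B ∩ hull (Finset.univ.map f) := by
    rintro _ ⟨y, hy, rfl⟩
    exact ⟨hy.1, simplexMap_mem_hull f hy.2⟩
  calc volume A = μH[n] (g '' (simplexMap f '' A)) := by rw [← e1, e2]
    _ ≤ ((r⁻¹ : ℝ≥0) : ℝ≥0∞) ^ (n : ℝ) * μH[n] (simplexMap f '' A) :=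
        hgL.hausdorffMeasure_image_le (Nat.cast_nonneg n) _
    _ ≤ _ := by
        rw [ENNReal.rpow_natCast]
        gcongr

theorem continuousOn_sum_shape_hull {k : ℕ} (x : 𝒯.BoundaryNode k → ℝ) {s : Finset (E d)}
    (hs : s ∈ 𝒯.complex.faces) :
    ContinuousOn (fun ξ => ∑ b, x b * 𝒯.shape b.1 ξ) (hull s) :=
  continuousOn_finsetSum _ fun b _ => continuousOn_const.mul (𝒯.continuousOn_shape_hull b.1 hs)

theorem sum_shape_eq_of_mem_hull {k : ℕ} (x : 𝒯.BoundaryNode k → ℝ) {s : Finset (E d)}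
    (hs : s ∈ 𝒯.complex.faces) {ξ : E d} (hξ : ξ ∈ hull s) :
    ∑ b, x b * 𝒯.shape b.1 ξ = ∑ b ∈ 𝒯.nodesOf k s, x b * 𝒯.shape b.1 ξ := by
  refine (Finset.sum_subset (Finset.subset_univ _) fun b _ hb => ?_).symm
  rw [𝒯.shape_eq_zero b.1 hs hξ fun h => hb (𝒯.mem_nodesOf.2 h), mul_zero]

/-- Scaled to a face of a simplex containing a ball of radius `r`, the lower bound of
`exists_ref_lower` controls the boundary nodal values on the face. -/
theorem sum_sq_nodesOf_le {k : ℕ} {γ : ℝ}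
    (hγ : ∀ c : (Fin (n + 1) → ℕ) → ℝ, γ * ∑ α ∈ Finset.univ.piAntidiag k, c α ^ 2
      ≤ ∫ y in refSimplex n,
        (∑ α ∈ Finset.univ.piAntidiag k, c α * refShape k α (refBary y)) ^ 2)
    {F t : Finset (E d)} (hF : F.card = n + 1) (ht : t ∈ 𝒯.complex.faces) (hFt : F ⊆ t) {z : E d}
    {r : ℝ≥0} (hr : 0 < r) (hz : Metric.closedBall z r ⊆ hull t) (x : 𝒯.BoundaryNode k → ℝ) :
    γ * ∑ b ∈ 𝒯.nodesOf k F, x b ^ 2 ≤ ((r : ℝ)⁻¹ ^ n *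
        (Measure.addHaarScalarFactor (volume : Measure (EuclideanSpace ℝ (Fin n))) μH[n] : ℝ)⁻¹) *
      ∫ ξ in hull F, (∑ b, x b * 𝒯.shape b.1 ξ) ^ 2 ∂μHE[n] := by
  classical
  have hFin := hausdorffMeasure_hull_lt_top hF
  have hFf : F ∈ 𝒯.complex.faces := 𝒯.complex.down_closed ht hFt
    (Finset.card_pos.1 (by omega))
  obtain ⟨f, rfl⟩ := exists_enumeration hF
  set N := 𝒯.nodesOf k (Finset.univ.map f) with hN
  -- the multi-index of a node with respect to the enumeration of the vertices
  let ι : N → Fin (n + 1) → ℕ := fun b i => b.1.1.1 (f i)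
  have hι : Function.Injective ι := by
    intro b b' hbb
    refine Subtype.ext (Subtype.ext (Subtype.ext (Finsupp.ext fun v => ?_)))
    have hb := 𝒯.mem_nodesOf.1 b.2
    have hb' := 𝒯.mem_nodesOf.1 b'.2
    by_cases hv : v ∈ Finset.univ.map f
    · obtain ⟨i, -, rfl⟩ := Finset.mem_map.1 hv
      exact congrFun hbb i
    · rw [Finsupp.notMem_support_iff.1 fun h => hv (hb h),
        Finsupp.notMem_support_iff.1 fun h => hv (hb' h)]
  have hιm : ∀ b, ι b ∈ (Finset.univ : Finset (Fin (n + 1))).piAntidiag k := by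
    intro b
    refine Finset.mem_piAntidiag.2 ⟨?_, fun _ _ => Finset.mem_univ _⟩
    have h1 : ∑ v ∈ b.1.1.1.support, b.1.1.1 v = k := b.1.1.2.2
    rw [Finset.sum_subset (𝒯.mem_nodesOf.1 b.2) fun v _ hv => Finsupp.notMem_support_iff.1 hv,
      Finset.sum_map] at h1
    exact h1
  let c : (Fin (n + 1) → ℕ) → ℝ := Function.extend ι (fun b => x b.1) 0
  -- sums against `c` only see the multi-indices of the nodes of the face
  have key : ∀ G : (Fin (n + 1) → ℕ) → ℝ → ℝ, (∀ α, G α 0 = 0) →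
      ∑ α ∈ Finset.univ.piAntidiag k, G α (c α) = ∑ b : N, G (ι b) (x b.1) := by
    intro G hG
    rw [← Finset.sum_subset (s₁ := Finset.univ.map ⟨ι, hι⟩), Finset.sum_map]
    · exact Finset.sum_congr rfl fun b _ => by
        simp only [Function.Embedding.coeFn_mk, c, hι.extend_apply]
    · intro α hα
      obtain ⟨b, -, rfl⟩ := Finset.mem_map.1 hα
      exact hιm b
    · intro α _ hα
      have : c α = 0 := Function.extend_apply' _ _ _ fun ⟨b, hb⟩ =>
        hα (Finset.mem_map.2 ⟨b, Finset.mem_univ _, hb⟩)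
      rw [this, hG]
  have h := hγ c
  rw [key (fun _ z => z ^ 2) (by simp), Finset.sum_coe_sort N fun b => x b ^ 2] at h
  refine h.trans ?_
  have e1 : ∀ y ∈ refSimplex n,
      (∑ α ∈ Finset.univ.piAntidiag k, c α * refShape k α (refBary y)) ^ 2
        = (∑ b, x b * 𝒯.shape b.1 (simplexMap f y)) ^ 2 := by
    intro y hy
    rw [𝒯.sum_shape_eq_of_mem_hull x hFf (simplexMap_mem_hull f hy),
      key (fun α z => z * refShape k α (refBary y)) (by simp), ← Finset.sum_coe_sort N]
    congr 1
    refine Finset.sum_congr rfl fun b _ => ?_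
    rw [𝒯.shape_simplexMap b.1.1 f hFf (𝒯.mem_nodesOf.1 b.2) hy]
  rw [setIntegral_congr_fun (isCompact_refSimplex n).measurableSet e1]
  set s := Measure.addHaarScalarFactor (volume : Measure (EuclideanSpace ℝ (Fin n))) μH[n]
  have hle := 𝒯.map_simplexMap_le f ht hFt hr hz
  set C : ℝ≥0∞ := ((r⁻¹ : ℝ≥0) : ℝ≥0∞) ^ n * ((s⁻¹ : ℝ≥0) : ℝ≥0∞) with hC
  have hCt : C ≠ ⊤ := ENNReal.mul_ne_top (by simp) (by simp)
  have hφ : IntegrableOn (fun ξ => (∑ b, x b * 𝒯.shape b.1 ξ) ^ 2) (hull (Finset.univ.map f))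
      (μHE[n] : Measure (E d)) := by
    have hc := (𝒯.continuousOn_sum_shape_hull x hFf).pow 2
    obtain ⟨B, hB⟩ := (isCompact_hull _).exists_bound_of_continuousOn hc
    exact IntegrableOn.of_bound hFin (hc.aestronglyMeasurable (isCompact_hull _).measurableSet) B
      ((ae_restrict_iff' (isCompact_hull _).measurableSet).2 (Filter.Eventually.of_forall hB))
  have hφC := Integrable.smul_measure hφ hCt
  have hm : AEStronglyMeasurable (fun ξ => (∑ b, x b * 𝒯.shape b.1 ξ) ^ 2)
      ((volume.restrict (refSimplex n)).map (simplexMap f)) :=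
    hφC.aestronglyMeasurable.mono_measure hle
  rw [← integral_map (continuous_simplexMap f).aemeasurable hm]
  refine (integral_mono_measure hle (Filter.Eventually.of_forall fun _ => sq_nonneg _)
    hφC).trans_eq ?_
  rw [integral_smul_measure, smul_eq_mul, hC]
  simp

end BulkMesh

/-! ### Gram matrices and integrals over overlapping sets -/

section Gram

variable {X ι : Type} [MeasurableSpace X] {μ : Measure X} [Fintype ι]

theorem sqNorm_of_integral {β : ι → ι → X → ℝ} (hβ : ∀ i j, Integrable (β i j) μ) (x : ι → ℝ) :
    sqNorm (.of fun i j => ∫ ξ, β i j ξ ∂μ) x = ∫ ξ, ∑ i, ∑ j, x i * x j * β i j ξ ∂μ := by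
  have h : ∀ i j, Integrable (fun ξ => x i * x j * β i j ξ) μ := fun i j => (hβ i j).const_mul _
  rw [integral_finsetSum _ fun i _ => integrable_finsetSum _ fun j _ => h i j, sqNorm, dotProduct]
  refine Finset.sum_congr rfl fun i _ => ?_
  rw [integral_finsetSum _ fun j _ => h i j, mulVec, dotProduct, Finset.mul_sum]
  refine Finset.sum_congr rfl fun j _ => ?_
  rw [integral_const_mul, of_apply]
  ring

theorem posSemidef_of_integral {β : ι → ι → X → ℝ} (hβ : ∀ i j, Integrable (β i j) μ)
    (hsymm : ∀ i j ξ, β i j ξ = β j i ξ)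
    (hpos : ∀ x : ι → ℝ, ∀ᵐ ξ ∂μ, 0 ≤ ∑ i, ∑ j, x i * x j * β i j ξ) :
    (Matrix.of fun i j => ∫ ξ, β i j ξ ∂μ).PosSemidef := by
  refine .of_dotProduct_mulVec_nonneg ?_ fun x => ?_
  · ext i j
    simp only [conjTranspose_apply, of_apply, star_trivial, hsymm i j]
  · have h := sqNorm_of_integral hβ x
    rw [star_trivial]
    change 0 ≤ sqNorm _ x
    rw [h]
    exact integral_nonneg_of_ae (hpos x)

theorem sum_sum_mul_eq_sq {x : ι → ℝ} (g : ι → ℝ) :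
    ∑ i, ∑ j, x i * x j * (g i * g j) = (∑ i, x i * g i) ^ 2 := by
  rw [sq, Finset.sum_mul_sum]
  exact Finset.sum_congr rfl fun i _ => Finset.sum_congr rfl fun j _ => by ring

theorem sum_sum_inner_eq_norm_sq {H : Type*} [NormedAddCommGroup H] [InnerProductSpace ℝ H]
    {x : ι → ℝ} (w : ℝ) (g : ι → H) :
    ∑ i, ∑ j, x i * x j * (w * inner ℝ (g i) (g j)) = w * ‖∑ i, x i • g i‖ ^ 2 := by
  rw [← real_inner_self_eq_norm_sq, sum_inner, Finset.mul_sum]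
  refine Finset.sum_congr rfl fun i _ => ?_
  rw [inner_sum, Finset.mul_sum]
  refine Finset.sum_congr rfl fun j _ => ?_
  rw [real_inner_smul_left, real_inner_smul_right]
  ring

open Classical in
/-- If at most `M` of the sets `A i` meet at each point, the integrals over them add up to at most
`M` times the whole integral. -/
theorem sum_setIntegral_le {κ : Type*} {I : Finset κ} {A : κ → Set X}
    (hA : ∀ i ∈ I, MeasurableSet (A i)) {f : X → ℝ} (hf : Integrable f μ) (hf0 : 0 ≤ f) {M : ℝ}
    (hM : ∀ ξ, ((I.filter fun i => ξ ∈ A i).card : ℝ) ≤ M) :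
    ∑ i ∈ I, ∫ ξ in A i, f ξ ∂μ ≤ M * ∫ ξ, f ξ ∂μ := by
  have h1 : ∑ i ∈ I, ∫ ξ in A i, f ξ ∂μ = ∫ ξ, ∑ i ∈ I, (A i).indicator f ξ ∂μ := by
    rw [integral_finsetSum _ fun i hi => hf.indicator (hA i hi)]
    exact Finset.sum_congr rfl fun i hi => (integral_indicator (hA i hi)).symm
  rw [h1, ← integral_const_mul]
  refine integral_mono (integrable_finsetSum _ fun i hi => hf.indicator (hA i hi))
    (hf.const_mul M) fun ξ => ?_
  dsimp only
  have h2 : ∑ i ∈ I, (A i).indicator f ξ = ((I.filter fun i => ξ ∈ A i).card : ℝ) * f ξ := by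
    rw [← nsmul_eq_mul, ← Finset.sum_const, Finset.sum_filter]
    exact Finset.sum_congr rfl fun i _ => by rw [Set.indicator_apply]
  rw [h2]
  exact mul_le_mul_of_nonneg_right (hM ξ) (hf0 ξ)

end Gram

theorem integrableOn_of_continuousOn_compact {X : Type*} [TopologicalSpace X] [T2Space X]
    [MeasurableSpace X] [BorelSpace X] [TopologicalSpace.PseudoMetrizableSpace X]
    {μ : Measure X} {K : Set X} {f : X → ℝ}
    (hK : IsCompact K) (hμ : μ K < ⊤) (hf : ContinuousOn f K) : IntegrableOn f K μ := by
  obtain ⟨B, hB⟩ := hK.exists_bound_of_continuousOn hf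
  exact IntegrableOn.of_bound hμ (hf.aestronglyMeasurable hK.measurableSet) B
    ((ae_restrict_iff' hK.measurableSet).2 (Filter.Eventually.of_forall hB))

namespace BulkMesh

variable {d n : ℕ} {Ω : Set (E d)} (𝒯 : BulkMesh Ω)

/-! ### The boundary faces -/

/-- The `(d-1)`-dimensional simplices of the bulk mesh that lie on `Γ`. -/
def boundaryFaces : Finset (Finset (E d)) :=
  (𝒯.finite.subset (t := {s | s ∈ 𝒯.complex.faces ∧ s.card = d ∧ hull s ⊆ frontier Ω})
    fun _ h => h.1).toFinset

theorem mem_boundaryFaces {s : Finset (E d)} :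
    s ∈ 𝒯.boundaryFaces ↔ s ∈ 𝒯.complex.faces ∧ s.card = d ∧ hull s ⊆ frontier Ω := by
  simp only [boundaryFaces, Set.Finite.mem_toFinset]
  exact Iff.rfl

theorem continuousOn_biUnion_hull {f : E d → ℝ} (S : Finset (Finset (E d)))
    (hf : ∀ s ∈ S, ContinuousOn f (hull s)) : ContinuousOn f (⋃ s ∈ S, hull s) := by
  have e : ⋃ s ∈ S, hull s = ⋃ s : S, hull s.1 := by
    ext; simp
  rw [e]
  exact (locallyFinite_of_finite _).continuousOn_iUnion
    (fun s => (isCompact_hull s.1).isClosed) fun s => hf s.1 s.2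

theorem continuousOn_shape_closure {k : ℕ} (a : 𝒯.NodeIndex k) :
    ContinuousOn (𝒯.shape a) (closure Ω) := by
  rw [𝒯.closure_eq_biUnion_cells]
  exact continuousOn_biUnion_hull _ fun s hs => 𝒯.continuousOn_shape_hull a (𝒯.mem_cells.1 hs).1

include 𝒯 in
theorem isCompact_closure : IsCompact (closure Ω) := by
  rw [𝒯.closure_eq_biUnion_cells]
  exact 𝒯.cells.isCompact_biUnion fun s _ => isCompact_hull s

include 𝒯 in
theorem isCompact_frontier : IsCompact (frontier Ω) :=
  𝒯.isCompact_closure.of_isClosed_subset isClosed_frontier frontier_subset_closure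

theorem integrableOn_shape_mul_shape {k : ℕ} (a b : 𝒯.NodeIndex k) :
    IntegrableOn (fun ξ => 𝒯.shape a ξ * 𝒯.shape b ξ) Ω :=
  (integrableOn_of_continuousOn_compact 𝒯.isCompact_closure 𝒯.isCompact_closure.measure_lt_top
    ((𝒯.continuousOn_shape_closure a).mul (𝒯.continuousOn_shape_closure b))).mono_set
    subset_closure

end BulkMesh

namespace SurfaceMesh

variable {d n : ℕ} {Ω : Set (E d)} {𝒯 : BulkMesh Ω} (𝒢 : SurfaceMesh 𝒯)
include 𝒢

theorem exists_boundaryFace {ξ : E d} (hξ : ξ ∈ frontier Ω) :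
    ∃ F ∈ 𝒯.boundaryFaces, ξ ∈ hull F := by
  rw [← 𝒢.space_eq] at hξ
  obtain ⟨s, hs, hξs⟩ := Geometry.SimplicialComplex.mem_space_iff.1 hξ
  obtain ⟨F, hF, hFd, hFΓ, hsF⟩ := 𝒢.refines s hs
  exact ⟨F, 𝒯.mem_boundaryFaces.2 ⟨hF, hFd, hFΓ⟩, hsF hξs⟩

/-- The boundary has finite surface measure, being covered by finitely many faces. -/
theorem isFiniteMeasure (hd : d = n + 1) :
    IsFiniteMeasure (surfaceMeasure Ω) := by
  refine ⟨?_⟩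
  rw [surfaceMeasure, Measure.restrict_apply_univ]
  refine (measure_mono (t := ⋃ F ∈ 𝒯.boundaryFaces, hull F) fun ξ hξ => ?_).trans_lt
    ((measure_biUnion_finset_le _ _).trans_lt (ENNReal.sum_lt_top.2 fun F hF => ?_))
  · obtain ⟨F, hF, h⟩ := 𝒢.exists_boundaryFace hξ
    exact Set.mem_biUnion hF h
  · have h := (𝒯.mem_boundaryFaces.1 hF).2.1
    have e : d - 1 = n := by omega
    rw [e]
    exact hausdorffMeasure_hull_lt_top (by omega)

theorem integrable (hd : d = n + 1) {f : E d → ℝ}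
    (hf : ContinuousOn f (frontier Ω)) : Integrable f (surfaceMeasure Ω) := by
  have h := 𝒢.isFiniteMeasure hd
  have := integrableOn_of_continuousOn_compact (μ := surfaceMeasure Ω) 𝒯.isCompact_frontier
    (measure_lt_top _ _) hf
  rwa [IntegrableOn, surfaceMeasure, Measure.restrict_restrict isClosed_frontier.measurableSet,
    Set.inter_self] at this

end SurfaceMesh

namespace BulkMesh

variable {d n : ℕ} {Ω : Set (E d)} {𝒯 : BulkMesh Ω} (𝒢 : SurfaceMesh 𝒯)
include 𝒢

/-- The inner nodal functions vanish on `Γ`, as a face on `Γ` contains no inner node. -/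
theorem shape_innerNode_eq_zero {k : ℕ} (hk : 1 ≤ k) (a : 𝒯.InnerNode k) {ξ : E d}
    (hξ : ξ ∈ frontier Ω) : 𝒯.shape a.1 ξ = 0 := by
  obtain ⟨F, hF, h⟩ := 𝒢.exists_boundaryFace hξ
  obtain ⟨hF1, -, hF3⟩ := 𝒯.mem_boundaryFaces.1 hF
  refine 𝒯.shape_eq_zero a.1 hF1 h fun hs => a.2 (hF3 ?_)
  exact convexHull_mono (by exact_mod_cast hs) (𝒯.nodePos_mem_hull hk a.1)

theorem exists_boundaryFace_of_boundaryNode {k : ℕ} (hk : 1 ≤ k) (b : 𝒯.BoundaryNode k) :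
    ∃ F ∈ 𝒯.boundaryFaces, b ∈ 𝒯.nodesOf k F := by
  obtain ⟨F, hF, h⟩ := 𝒢.exists_boundaryFace b.2
  exact ⟨F, hF, 𝒯.mem_nodesOf.2
    (𝒯.support_subset_of_nodePos_mem hk b.1 (𝒯.mem_boundaryFaces.1 hF).1 h)⟩

omit 𝒢

open Classical in
/-- The boundary faces at a point are subsets of the vertex sets of the cells at the point. -/
theorem IsQuasiUniform.card_boundaryFaces_le {ρ : ℝ} (hq : 𝒯.IsQuasiUniform ρ) (hρ : 0 < ρ)
    (hh : 0 < 𝒯.meshWidth) (ξ : E d) :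
    ((𝒯.boundaryFaces.filter fun F => ξ ∈ hull F).card : ℝ) ≤ 2 ^ (d + 1) * ρ ^ d := by
  set S := 𝒯.cells.filter fun t => ξ ∈ hull t with hS
  have h1 : (𝒯.boundaryFaces.filter fun F => ξ ∈ hull F) ⊆ S.biUnion Finset.powerset := by
    intro F hF
    obtain ⟨hF, hξ⟩ := Finset.mem_filter.1 hF
    obtain ⟨t, ht, hFt, htd⟩ := 𝒯.pure F (𝒯.mem_boundaryFaces.1 hF).1
    exact Finset.mem_biUnion.2 ⟨t, Finset.mem_filter.2 ⟨𝒯.mem_cells.2 ⟨ht, htd⟩,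
      convexHull_mono (by exact_mod_cast hFt) hξ⟩, Finset.mem_powerset.2 hFt⟩
  have h2 : (S.biUnion Finset.powerset).card ≤ S.card * 2 ^ (d + 1) := by
    refine Finset.card_biUnion_le_card_mul _ _ _ fun t ht => ?_
    rw [Finset.card_powerset, (𝒯.mem_cells.1 (Finset.mem_filter.1 ht).1).2]
  have h3 : (S.card : ℝ) ≤ ρ ^ d := hq.card_le hρ hh (Finset.filter_subset _ _)
    fun t ht => (Finset.mem_filter.1 ht).2
  calc ((𝒯.boundaryFaces.filter fun F => ξ ∈ hull F).card : ℝ) ≤ (S.card * 2 ^ (d + 1) : ℕ) := by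
        exact_mod_cast (Finset.card_le_card h1).trans h2
    _ = 2 ^ (d + 1) * S.card := by push_cast; ring
    _ ≤ _ := mul_le_mul_of_nonneg_left h3 (by positivity)

/-- The `L²(Γ)` norm of a trace controls its nodal values, with the scaling `h^(d-1)`. -/
theorem exists_sum_sq_le {ρ : ℝ} (hρ : 0 < ρ) {k : ℕ} (hk : 1 ≤ k) (hd : d = n + 1)
    (Ω : Set (E d)) : ∃ C > 0, ∀ (𝒯 : BulkMesh Ω), SurfaceMesh 𝒯 → 𝒯.IsQuasiUniform ρ →
      0 < 𝒯.meshWidth → ∀ x : 𝒯.BoundaryNode k → ℝ, 𝒯.meshWidth ^ n * ∑ b, x b ^ 2 ≤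
        C * ∫ ξ, (∑ b, x b * 𝒯.shape b.1 ξ) ^ 2 ∂surfaceMeasure Ω := by
  classical
  obtain ⟨γ, hγ, hlow⟩ := exists_ref_lower n hk
  set s : ℝ≥0 := Measure.addHaarScalarFactor (volume : Measure (EuclideanSpace ℝ (Fin n))) μH[n]
  have hs : 0 < s := pos_iff_ne_zero.2
    (Measure.addHaarScalarFactor_volume_hausdorffMeasure_ne_zero n)
  have hs' : (0 : ℝ) < s := by exact_mod_cast hs
  refine ⟨γ⁻¹ * (ρ ^ n * (s : ℝ)⁻¹) * (2 ^ (d + 1) * ρ ^ d), by positivity, ?_⟩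
  intro 𝒯 𝒢 hq hh x
  set h := 𝒯.meshWidth with hh_def
  set φ : E d → ℝ := fun ξ => (∑ b, x b * 𝒯.shape b.1 ξ) ^ 2 with hφ
  have hφi : Integrable φ (surfaceMeasure Ω) := 𝒢.integrable hd (by
    refine (continuousOn_finsetSum _ fun b _ => continuousOn_const.mul ?_).pow 2
    exact (𝒯.continuousOn_shape_closure b.1).mono frontier_subset_closure)
  -- the estimate on one face
  have hface : ∀ F ∈ 𝒯.boundaryFaces, γ * h ^ n * ∑ b ∈ 𝒯.nodesOf k F, x b ^ 2 ≤
      ρ ^ n * (s : ℝ)⁻¹ * ∫ ξ in hull F, φ ξ ∂surfaceMeasure Ω := by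
    intro F hF
    obtain ⟨hF1, hF2, hF3⟩ := 𝒯.mem_boundaryFaces.1 hF
    obtain ⟨t, ht, hFt, htd⟩ := 𝒯.pure F hF1
    obtain ⟨z, hz⟩ := hq t ht htd
    have hr : 0 < h / ρ := by positivity
    have h1 := 𝒯.sum_sq_nodesOf_le hlow (hF2.trans hd) ht hFt (r := (h / ρ).toNNReal)
      (Real.toNNReal_pos.2 hr) (by rwa [Real.coe_toNNReal _ hr.le]) x
    rw [Real.coe_toNNReal _ hr.le] at h1
    have e : d - 1 = n := by omega
    have e2 : (surfaceMeasure Ω).restrict (hull F) =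
        (μHE[n] : Measure (E d)).restrict (hull F) := by
      rw [surfaceMeasure, Measure.restrict_restrict (isCompact_hull F).measurableSet,
        Set.inter_eq_left.2 hF3, e]
    rw [e2]
    have h2 := mul_le_mul_of_nonneg_left h1 (by positivity : 0 ≤ h ^ n)
    refine le_trans (le_of_eq (by ring)) (h2.trans_eq ?_)
    have e3 : h ^ n * ((h / ρ)⁻¹ ^ n) = ρ ^ n := by
      rw [← mul_pow]; congr 1; field_simp
    rw [← mul_assoc, ← mul_assoc, e3]
  have hsum : ∑ b, x b ^ 2 ≤ ∑ F ∈ 𝒯.boundaryFaces, ∑ b ∈ 𝒯.nodesOf k F, x b ^ 2 := by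
    rw [Finset.sum_comm' (t' := Finset.univ)
      (s' := fun b => 𝒯.boundaryFaces.filter fun F => b ∈ 𝒯.nodesOf k F) (by simp)]
    refine Finset.sum_le_sum fun b _ => ?_
    obtain ⟨F, hF, hb⟩ := exists_boundaryFace_of_boundaryNode 𝒢 hk b
    exact Finset.single_le_sum (f := fun _ => x b ^ 2) (fun _ _ => sq_nonneg _)
      (Finset.mem_filter.2 ⟨hF, hb⟩)
  have hover := sum_setIntegral_le (μ := surfaceMeasure Ω) (I := 𝒯.boundaryFaces)
    (A := fun F => hull F) (fun F _ => (isCompact_hull F).measurableSet) hφi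
    (fun ξ => sq_nonneg _) (hq.card_boundaryFaces_le hρ hh)
  have h4 : γ * (h ^ n * ∑ b, x b ^ 2) ≤
      ρ ^ n * (s : ℝ)⁻¹ * (2 ^ (d + 1) * ρ ^ d * ∫ ξ, φ ξ ∂surfaceMeasure Ω) := by
    calc γ * (h ^ n * ∑ b, x b ^ 2)
        ≤ γ * h ^ n * ∑ F ∈ 𝒯.boundaryFaces, ∑ b ∈ 𝒯.nodesOf k F, x b ^ 2 := by
          rw [← mul_assoc]
          exact mul_le_mul_of_nonneg_left hsum (by positivity)
      _ = ∑ F ∈ 𝒯.boundaryFaces, γ * h ^ n * ∑ b ∈ 𝒯.nodesOf k F, x b ^ 2 := Finset.mul_sum _ _ _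
      _ ≤ ∑ F ∈ 𝒯.boundaryFaces, ρ ^ n * (s : ℝ)⁻¹ * ∫ ξ in hull F, φ ξ ∂surfaceMeasure Ω :=
          Finset.sum_le_sum hface
      _ = ρ ^ n * (s : ℝ)⁻¹ * ∑ F ∈ 𝒯.boundaryFaces, ∫ ξ in hull F, φ ξ ∂surfaceMeasure Ω :=
          (Finset.mul_sum _ _ _).symm
      _ ≤ _ := mul_le_mul_of_nonneg_left hover (by positivity)
  have h5 := mul_le_mul_of_nonneg_left h4 (inv_nonneg.2 hγ.le)
  rw [← mul_assoc, inv_mul_cancel₀ hγ.ne', one_mul] at h5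
  exact h5.trans_eq (by ring)

end BulkMesh

/-! ### Upper bounds for boundary nodal functions in the bulk norms -/

theorem exists_ae_abs_le {X : Type*} [MeasurableSpace X] {μ : Measure X} {f : X → ℝ}
    (hf : MemLp f ∞ μ) : ∃ C > 0, ∀ᵐ ξ ∂μ, |f ξ| ≤ C := by
  have h := hf.eLpNorm_lt_top
  rw [eLpNorm_exponent_top] at h
  refine ⟨(eLpNormEssSup f μ).toReal + 1, by positivity, ?_⟩
  filter_upwards [ae_le_eLpNormEssSup (f := f) (μ := μ)] with ξ hξ
  have h1 := ENNReal.toReal_mono h.ne hξ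
  rw [toReal_enorm, Real.norm_eq_abs] at h1
  linarith

namespace BulkMesh

variable {d : ℕ} {Ω : Set (E d)} {𝒯 : BulkMesh Ω}

/-- Almost every point lies in the interior of a cell, as convex sets have null frontier. -/
theorem ae_mem_interior_cell (hΩ : IsOpen Ω) :
    ∀ᵐ ξ ∂volume.restrict Ω, ∃ t ∈ 𝒯.cells, ξ ∈ interior (hull t) := by
  have h1 : ∀ᵐ ξ ∂volume.restrict Ω, ∀ t ∈ 𝒯.cells, ξ ∉ frontier (hull t) := by
    refine ae_restrict_of_ae ?_
    refine (Finset.eventually_all _).2 fun t _ => ?_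
    exact measure_eq_zero_iff_ae_notMem.1 ((convex_convexHull ℝ _).addHaar_frontier volume)
  filter_upwards [h1, ae_restrict_mem hΩ.measurableSet] with ξ hξ hΩξ
  have h2 := subset_closure hΩξ
  rw [𝒯.closure_eq_biUnion_cells] at h2
  obtain ⟨t, ht, htξ⟩ := Set.mem_iUnion₂.1 h2
  refine ⟨t, ht, ?_⟩
  by_contra h
  exact hξ t ht ⟨subset_closure htξ, h⟩

theorem measurable_gradient (f : E d → ℝ) : Measurable fun ξ => ∇ f ξ :=
  (InnerProductSpace.toDual ℝ (E d)).symm.continuous.measurable.comp (measurable_fderiv ℝ f)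

/-- Summation of a cellwise bound over the bulk mesh. -/
theorem IsQuasiUniform.setIntegral_le {ρ : ℝ} (hq : 𝒯.IsQuasiUniform ρ) (hρ : 0 < ρ)
    (hh : 0 < 𝒯.meshWidth) {k : ℕ} (hk : 1 ≤ k) (x : 𝒯.BoundaryNode k → ℝ) {g : E d → ℝ} {K : ℝ}
    (hK : 0 ≤ K) (hg0 : 0 ≤ᵐ[volume.restrict Ω] g)
    (hg : ∀ᵐ ξ ∂volume.restrict Ω,
      ∃ t ∈ 𝒯.cells, ξ ∈ hull t ∧ g ξ ≤ K * ∑ b ∈ 𝒯.nodesOf k t, x b ^ 2) :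
    ∫ ξ in Ω, g ξ ≤ K * (𝒯.meshWidth ^ d * volume.real (Metric.ball (0 : E d) 1) * ρ ^ d)
      * ∑ b, x b ^ 2 := by
  classical
  set σ : Finset (E d) → ℝ := fun t => K * ∑ b ∈ 𝒯.nodesOf k t, x b ^ 2 with hσ
  have hσ0 : ∀ t, 0 ≤ σ t := fun t => mul_nonneg hK (Finset.sum_nonneg fun b _ => sq_nonneg _)
  have hint : ∀ t ∈ 𝒯.cells,
      Integrable ((hull t).indicator fun _ => σ t) (volume : Measure (E d)) :=
    fun t _ => (integrable_indicator_iff (isCompact_hull t).measurableSet).2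
      (integrableOn_const (isCompact_hull t).measure_lt_top.ne)
  have h1 : ∫ ξ in Ω, g ξ ≤ ∫ ξ in Ω, ∑ t ∈ 𝒯.cells, (hull t).indicator (fun _ => σ t) ξ := by
    refine integral_mono_of_nonneg hg0 (integrable_finsetSum _ fun t ht => (hint t ht).restrict) ?_
    filter_upwards [hg] with ξ ⟨t, ht, hξ, hle⟩
    refine hle.trans ?_
    have := Finset.single_le_sum (f := fun t => (hull t).indicator (fun _ => σ t) ξ)
      (fun t _ => Set.indicator_nonneg (fun _ _ => hσ0 t) ξ) ht
    rwa [Set.indicator_of_mem hξ] at this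
  have h2 : ∫ ξ in Ω, ∑ t ∈ 𝒯.cells, (hull t).indicator (fun _ => σ t) ξ
      ≤ ∑ t ∈ 𝒯.cells, volume.real (hull t) * σ t := by
    refine (setIntegral_le_integral (integrable_finsetSum _ hint)
      (Filter.Eventually.of_forall fun ξ => Finset.sum_nonneg fun t _ =>
        Set.indicator_nonneg (fun _ _ => hσ0 t) ξ)).trans_eq ?_
    rw [integral_finsetSum _ hint]
    refine Finset.sum_congr rfl fun t _ => ?_
    rw [integral_indicator_const _ (isCompact_hull t).measurableSet, smul_eq_mul]
  have h3 : ∑ t ∈ 𝒯.cells, ∑ b ∈ 𝒯.nodesOf k t, x b ^ 2 ≤ ρ ^ d * ∑ b, x b ^ 2 := by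
    rw [Finset.sum_comm' (t' := Finset.univ)
      (s' := fun b => 𝒯.cells.filter fun t => b ∈ 𝒯.nodesOf k t) (by simp), Finset.mul_sum]
    refine Finset.sum_le_sum fun b _ => ?_
    rw [Finset.sum_const, nsmul_eq_mul]
    refine mul_le_mul_of_nonneg_right (hq.card_le hρ hh (Finset.filter_subset _ _)
      (x := 𝒯.nodePos b.1) fun t ht => ?_) (sq_nonneg _)
    exact convexHull_mono (by exact_mod_cast 𝒯.mem_nodesOf.1 (Finset.mem_filter.1 ht).2)
      (𝒯.nodePos_mem_hull hk b.1)
  set V := 𝒯.meshWidth ^ d * volume.real (Metric.ball (0 : E d) 1) with hV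
  have hV0 : 0 ≤ V := by positivity
  calc ∫ ξ in Ω, g ξ ≤ ∑ t ∈ 𝒯.cells, volume.real (hull t) * σ t := h1.trans h2
    _ ≤ ∑ t ∈ 𝒯.cells, V * σ t := Finset.sum_le_sum fun t ht =>
        mul_le_mul_of_nonneg_right (𝒯.volume_hull_le (𝒯.mem_cells.1 ht).1) (hσ0 t)
    _ = V * (K * ∑ t ∈ 𝒯.cells, ∑ b ∈ 𝒯.nodesOf k t, x b ^ 2) := by
        rw [← Finset.mul_sum, ← Finset.mul_sum]
    _ ≤ V * (K * (ρ ^ d * ∑ b, x b ^ 2)) := by gcongr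
    _ = _ := by ring

variable {k : ℕ}

theorem integral_sq_shape_le (hΩ : IsOpen Ω) {ρ : ℝ} (hq : 𝒯.IsQuasiUniform ρ) (hρ : 0 < ρ)
    (hh : 0 < 𝒯.meshWidth) (hk : 1 ≤ k) (x : 𝒯.BoundaryNode k → ℝ) :
    ∫ ξ in Ω, (∑ b, x b * 𝒯.shape b.1 ξ) ^ 2 ≤ ((k : ℝ) ^ k) ^ 2 * (k + 1) ^ (d + 1) *
      (𝒯.meshWidth ^ d * volume.real (Metric.ball (0 : E d) 1) * ρ ^ d) * ∑ b, x b ^ 2 := by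
  refine hq.setIntegral_le hρ hh hk x (by positivity)
    (Filter.Eventually.of_forall fun ξ => sq_nonneg _) ?_
  filter_upwards [ae_restrict_mem hΩ.measurableSet] with ξ hξ
  have h2 := subset_closure hξ
  rw [𝒯.closure_eq_biUnion_cells] at h2
  obtain ⟨t, ht, htξ⟩ := Set.mem_iUnion₂.1 h2
  obtain ⟨ht1, ht2⟩ := 𝒯.mem_cells.1 ht
  refine ⟨t, ht, htξ, ?_⟩
  have h := norm_sq_sum_smul_le (𝒯.nodesOf k t) x (fun b => 𝒯.shape b.1 ξ) (K := (k : ℝ) ^ k)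
    fun b _ => 𝒯.abs_shape_le b.1 ht1 htξ
  simp only [smul_eq_mul, Real.norm_eq_abs, sq_abs] at h
  rw [𝒯.sum_shape_eq_of_mem_hull x ht1 htξ]
  refine h.trans ?_
  have hc : ((𝒯.nodesOf k t).card : ℝ) ≤ (k + 1) ^ (d + 1) := by
    rw [← ht2]; exact_mod_cast 𝒯.card_nodesOf_le k t
  rw [mul_assoc]
  gcongr

theorem IsQuasiUniform.norm_gradient_shape_le {ρ : ℝ} (hq : 𝒯.IsQuasiUniform ρ) (hρ : 0 < ρ)
    (hh : 0 < 𝒯.meshWidth) (a : 𝒯.NodeIndex k) {t : Finset (E d)} (ht : t ∈ 𝒯.cells) {ξ : E d}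
    (hξ : ξ ∈ interior (hull t)) :
    ‖∇ (𝒯.shape a) ξ‖ ≤ k * (k ^ (k - 1) * (k * (𝒯.meshWidth / ρ)⁻¹)) := by
  obtain ⟨ht1, ht2⟩ := 𝒯.mem_cells.1 ht
  obtain ⟨z, hz⟩ := hq t ht1 ht2
  exact 𝒯.norm_gradient_shape_le a ht1 (by positivity) hz hξ

theorem integrableOn_mul_inner_gradient (hΩ : IsOpen Ω) {ρ : ℝ} (hq : 𝒯.IsQuasiUniform ρ)
    (hρ : 0 < ρ) (hh : 0 < 𝒯.meshWidth) {α : E d → ℝ} (hα : MemLp α ∞ (volume.restrict Ω))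
    (a b : 𝒯.NodeIndex k) :
    IntegrableOn (fun ξ => α ξ * inner ℝ (∇ (𝒯.shape a) ξ) (∇ (𝒯.shape b) ξ)) Ω := by
  obtain ⟨C, hC, hαC⟩ := exists_ae_abs_le hα
  set G : ℝ := k * (k ^ (k - 1) * (k * (𝒯.meshWidth / ρ)⁻¹)) with hG
  have hΩt : volume Ω < ⊤ :=
    (measure_mono subset_closure).trans_lt 𝒯.isCompact_closure.measure_lt_top
  refine IntegrableOn.of_bound hΩt (hα.1.mul
    ((measurable_gradient _).inner (measurable_gradient _)).aestronglyMeasurable) (C * (G * G)) ?_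
  filter_upwards [hαC, 𝒯.ae_mem_interior_cell hΩ] with ξ h1 ⟨t, ht, h2⟩
  rw [norm_mul, Real.norm_eq_abs]
  have ha := hq.norm_gradient_shape_le hρ hh a ht h2
  have hb := hq.norm_gradient_shape_le hρ hh b ht h2
  exact mul_le_mul h1 ((norm_inner_le_norm _ _).trans
    (mul_le_mul ha hb (norm_nonneg _) (by positivity))) (norm_nonneg _) hC.le

theorem integral_sq_gradient_shape_le (hΩ : IsOpen Ω) {ρ : ℝ} (hq : 𝒯.IsQuasiUniform ρ)
    (hρ : 0 < ρ) (hh : 0 < 𝒯.meshWidth) (hk : 1 ≤ k) {α : E d → ℝ} {C : ℝ} (hC : 0 ≤ C)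
    (hα0 : ∀ᵐ ξ ∂volume.restrict Ω, 0 ≤ α ξ) (hαC : ∀ᵐ ξ ∂volume.restrict Ω, |α ξ| ≤ C)
    (x : 𝒯.BoundaryNode k → ℝ) :
    ∫ ξ in Ω, α ξ * ‖∑ b, x b • ∇ (𝒯.shape b.1) ξ‖ ^ 2 ≤
      C * ((k * (k ^ (k - 1) * (k * (𝒯.meshWidth / ρ)⁻¹))) ^ 2 * (k + 1) ^ (d + 1)) *
      (𝒯.meshWidth ^ d * volume.real (Metric.ball (0 : E d) 1) * ρ ^ d) * ∑ b, x b ^ 2 := by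
  refine hq.setIntegral_le hρ hh hk x (by positivity) ?_ ?_
  · filter_upwards [hα0] with ξ h1
    exact mul_nonneg h1 (sq_nonneg _)
  filter_upwards [hα0, hαC, 𝒯.ae_mem_interior_cell hΩ] with ξ h0 h1 ⟨t, ht, h2⟩
  obtain ⟨ht1, ht2⟩ := 𝒯.mem_cells.1 ht
  refine ⟨t, ht, interior_subset h2, ?_⟩
  have h := norm_sq_sum_smul_le (𝒯.nodesOf k t) x (fun b => ∇ (𝒯.shape b.1) ξ)
    fun b _ => hq.norm_gradient_shape_le hρ hh b.1 ht h2
  have e : ∑ b, x b • ∇ (𝒯.shape b.1) ξ = ∑ b ∈ 𝒯.nodesOf k t, x b • ∇ (𝒯.shape b.1) ξ := by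
    refine (Finset.sum_subset (Finset.subset_univ _) fun b _ hb => ?_).symm
    rw [𝒯.gradient_shape_eq_zero b.1 ht1 (fun h => hb (𝒯.mem_nodesOf.2 h)) h2, smul_zero]
  rw [e, mul_assoc]
  refine mul_le_mul ((le_abs_self _).trans h1) (h.trans ?_) (sq_nonneg _) hC
  have hc : ((𝒯.nodesOf k t).card : ℝ) ≤ (k + 1) ^ (d + 1) := by
    rw [← ht2]; exact_mod_cast 𝒯.card_nodesOf_le k t
  rw [mul_assoc]
  gcongr

end BulkMesh

/-! ### The surface stiffness matrix -/

variable {d n : ℕ}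

theorem contDiff_eval_mvPolynomial (P : MvPolynomial (Fin d) ℝ) {m : WithTop ℕ∞} :
    ContDiff ℝ m fun x : E d => MvPolynomial.eval (fun i => x i) P := by
  induction P using MvPolynomial.induction_on with
  | C a => simpa using contDiff_const
  | add p q hp hq => simpa using hp.add hq
  | mul_X p i hp =>
    simp only [map_mul, MvPolynomial.eval_X]
    exact hp.mul (contDiff_piLp_apply (p := 2))

theorem continuous_tangentialGradient (W : Submodule ℝ (E d)) {p : E d → ℝ} (hp : ContDiff ℝ 1 p) :
    Continuous fun ξ => tangentialGradient W p ξ := by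
  have e : ∀ ξ, tangentialGradient W p ξ =
      (InnerProductSpace.toDual ℝ W).symm ((fderiv ℝ p ξ).comp W.subtypeL) := by
    intro ξ
    rw [tangentialGradient, gradient]
    congr 1
    have h1 : HasFDerivAt p (fderiv ℝ p ξ) (ξ + ((0 : W) : E d)) := by
      simpa using (hp.differentiable one_ne_zero ξ).hasFDerivAt
    have h2 : HasFDerivAt (fun w : W => ξ + (w : E d)) W.subtypeL 0 :=
      (W.subtypeL.hasFDerivAt).const_add ξ
    exact (HasFDerivAt.comp (f := fun w : W => ξ + (w : E d)) 0 h1 h2).fderiv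
  simp only [e]
  exact (LinearIsometryEquiv.continuous _).comp
    ((hp.continuous_fderiv one_ne_zero).clm_comp continuous_const)

/-- At points of a simplex with positive barycentric coordinates, the tangential gradient of a
function depends only on its values on the simplex. -/
theorem tangentialGradient_congr {s : Finset (E d)} (hs : AffineIndependent ℝ ((↑) : s → E d))
    {p q : E d → ℝ} (hpq : ∀ x ∈ hull s, q x = p x) {ξ : E d} (hξ : ξ ∈ hull s)
    (hξ' : ∀ v ∈ s, ξ ∉ convexHull ℝ ((s : Set (E d)) \ {v})) :
    tangentialGradient (vectorSpan ℝ (s : Set (E d))) q ξ =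
      tangentialGradient (vectorSpan ℝ (s : Set (E d))) p ξ := by
  classical
  obtain ⟨c, hc⟩ := exists_isCoordinateSystem hs
  obtain ⟨hξs, hc0⟩ := hc.mem_hull_iff.1 hξ
  obtain ⟨h1, h2⟩ := hc.sum_of_mem_affineSpan hξs
  have hpos : ∀ v ∈ s, 0 < c v ξ := by
    intro v hv
    refine lt_of_le_of_ne (hc0 v hv) fun h0 => hξ' v hv ?_
    rw [← Finset.coe_erase]
    refine Finset.mem_convexHull'.2 ⟨fun u => c u ξ, fun u hu => hc0 u (Finset.mem_of_mem_erase hu),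
      ?_, ?_⟩
    · rw [← h1, ← Finset.add_sum_erase s _ hv, ← h0, zero_add]
    · conv_rhs => rw [← h2]
      rw [← Finset.add_sum_erase s _ hv, ← h0, zero_smul, zero_add]
  rw [tangentialGradient, tangentialGradient, gradient, gradient]
  congr 1
  refine Filter.EventuallyEq.fderiv_eq ?_
  have hnear : ∀ᶠ w : vectorSpan ℝ (s : Set (E d)) in nhds 0, ∀ v ∈ s, 0 < c v (ξ + w) := by
    refine (Finset.eventually_all _).2 fun v hv => ?_
    have hcont : Continuous fun w : vectorSpan ℝ (s : Set (E d)) => c v (ξ + w) :=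
      (c v).continuous_of_finiteDimensional.comp (continuous_const.add continuous_subtype_val)
    exact hcont.continuousAt.eventually (lt_mem_nhds (by simpa using hpos v hv))
  filter_upwards [hnear] with w hw
  refine hpq _ (hc.mem_hull_iff.2 ⟨?_, fun v hv => (hw v hv).le⟩)
  rw [add_comm]
  exact AffineSubspace.vadd_mem_of_mem_direction (by rw [direction_affineSpan]; exact w.2) hξs

namespace SurfaceMesh

variable {Ω : Set (E d)} {𝒯 : BulkMesh Ω} (𝒢 : SurfaceMesh 𝒯)

theorem mem_facets {s : Finset (E d)} :
    s ∈ 𝒢.facets ↔ s ∈ 𝒢.complex.faces ∧ s.card = d := by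
  simp [facets]

/-- On a facet, the tangential gradients of the `ψ_j` agree almost everywhere with those of
polynomials, so the entries of the surface stiffness matrix are integrals of bounded functions. -/
theorem integrableOn_mul_inner_tangentialGradient (hd : d = n + 1) {κ : E d → ℝ}
    (hκ : MemLp κ ∞ (surfaceMeasure Ω)) {N : ℕ} {ψ : Fin N → E d → ℝ}
    (hψ : IsSurfaceFEBasis 𝒢 ψ) {s : Finset (E d)} (hs : s ∈ 𝒢.facets) (i j : Fin N) :
    IntegrableOn (fun ξ => κ ξ * inner ℝ
      (tangentialGradient (vectorSpan ℝ (s : Set (E d))) (ψ i) ξ)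
      (tangentialGradient (vectorSpan ℝ (s : Set (E d))) (ψ j) ξ)) (hull s) (surfaceMeasure Ω) := by
  obtain ⟨hsf, hsd⟩ := 𝒢.mem_facets.1 hs
  have hfin := 𝒢.isFiniteMeasure hd
  set W := vectorSpan ℝ (s : Set (E d))
  obtain ⟨P, hP⟩ := hψ.polynomial i s hsf
  obtain ⟨Q, hQ⟩ := hψ.polynomial j s hsf
  set p : E d → ℝ := fun x => MvPolynomial.eval (fun i => x i) P
  set q : E d → ℝ := fun x => MvPolynomial.eval (fun i => x i) Q
  set g : E d → ℝ := fun ξ => inner ℝ (tangentialGradient W p ξ) (tangentialGradient W q ξ) with hg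
  have hgc : Continuous g :=
    (continuous_tangentialGradient W (contDiff_eval_mvPolynomial P)).inner
      (continuous_tangentialGradient W (contDiff_eval_mvPolynomial Q))
  obtain ⟨C, hC, hκC⟩ := exists_ae_abs_le hκ
  obtain ⟨B, hB⟩ := (BulkMesh.isCompact_hull s).exists_bound_of_continuousOn hgc.continuousOn
  have hmeas := (BulkMesh.isCompact_hull s).measurableSet
  have h1 : IntegrableOn (fun ξ => κ ξ * g ξ) (hull s) (surfaceMeasure Ω) := by
    refine IntegrableOn.of_bound (measure_lt_top _ _)
      (hκ.1.restrict.mul hgc.aestronglyMeasurable) (C * B) ?_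
    filter_upwards [ae_restrict_of_ae hκC, ae_restrict_mem hmeas] with ξ h1 h2
    rw [norm_mul]
    exact mul_le_mul h1 (hB ξ h2) (norm_nonneg _) hC.le
  refine h1.congr ?_
  -- the relative boundary of the simplex is a null set
  have hnull : ∀ᵐ ξ ∂(surfaceMeasure Ω).restrict (hull s), ∀ v ∈ s,
      ξ ∉ convexHull ℝ ((s : Set (E d)) \ {v}) := by
    classical
    refine ae_restrict_of_ae ((Finset.eventually_all _).2 fun v hv => ?_)
    refine measure_eq_zero_iff_ae_notMem.1 ?_
    rw [← Finset.coe_erase]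
    refine Measure.absolutelyContinuous_of_le Measure.restrict_le_self ?_
    refine hausdorffMeasure_hull_eq_zero ?_
    rw [Finset.card_erase_of_mem hv, hsd]
  filter_upwards [hnull, ae_restrict_mem hmeas] with ξ h1 h2
  rw [hg]
  dsimp only
  rw [tangentialGradient_congr (𝒢.complex.indep hsf) hP h2 h1,
    tangentialGradient_congr (𝒢.complex.indep hsf) hQ h2 h1]

end SurfaceMesh

/-! ### Stability of the finite element coupling -/

variable {d n : ℕ} {Ω : Set (E d)} {𝒯 : BulkMesh Ω}

/-- The node of a degree of freedom. -/
def BulkMesh.dofNode {k : ℕ} : 𝒯.Dof k → 𝒯.NodeIndex k := Sum.elim Subtype.val Subtype.val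

theorem BulkMesh.basis_eq_shape {k : ℕ} (i : 𝒯.Dof k) :
    𝒯.basis k i = 𝒯.shape (BulkMesh.dofNode i) := by
  cases i <;> rfl

theorem sqNorm_mass_extendZero (α κ : E d → ℝ) (k : ℕ) (𝒢 : SurfaceMesh 𝒯) {N : ℕ}
    (ψ : Fin N → E d → ℝ) (x : 𝒯.BoundaryNode k → ℝ) :
    sqNorm (feMatrices α κ k 𝒯 𝒢 ψ).Mu (extendZero x) =
      ∫ ξ in Ω, (∑ b, x b * 𝒯.shape b.1 ξ) ^ 2 := by
  have h := sqNorm_of_integral (μ := volume.restrict Ω)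
    (β := fun i j ξ => 𝒯.basis k i ξ * 𝒯.basis k j ξ) (fun i j => by
      simp only [BulkMesh.basis_eq_shape]
      exact 𝒯.integrableOn_shape_mul_shape _ _) (extendZero x)
  refine h.trans (integral_congr_ae (Filter.Eventually.of_forall fun ξ => ?_))
  dsimp only
  rw [sum_sum_mul_eq_sq (g := fun i => 𝒯.basis k i ξ), Fintype.sum_sum_type]
  simp [extendZero_inl, extendZero_inr, BulkMesh.basis]

theorem sqNorm_stiffness_extendZero (hΩ : IsOpen Ω) {ρ : ℝ} (hq : 𝒯.IsQuasiUniform ρ)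
    (hρ : 0 < ρ) (hh : 0 < 𝒯.meshWidth) {α : E d → ℝ} (hα : MemLp α ∞ (volume.restrict Ω))
    (κ : E d → ℝ) (k : ℕ) (𝒢 : SurfaceMesh 𝒯) {N : ℕ}
    (ψ : Fin N → E d → ℝ) (x : 𝒯.BoundaryNode k → ℝ) :
    sqNorm (feMatrices α κ k 𝒯 𝒢 ψ).Ku (extendZero x) =
      ∫ ξ in Ω, α ξ * ‖∑ b, x b • ∇ (𝒯.shape b.1) ξ‖ ^ 2 := by
  have h := sqNorm_of_integral (μ := volume.restrict Ω)
    (β := fun i j ξ => α ξ * inner ℝ (∇ (𝒯.basis k i) ξ) (∇ (𝒯.basis k j) ξ)) (fun i j => by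
      simp only [BulkMesh.basis_eq_shape]
      exact 𝒯.integrableOn_mul_inner_gradient hΩ hq hρ hh hα _ _) (extendZero x)
  refine h.trans (integral_congr_ae (Filter.Eventually.of_forall fun ξ => ?_))
  dsimp only
  rw [sum_sum_inner_eq_norm_sq (α ξ) (fun i => ∇ (𝒯.basis k i) ξ), Fintype.sum_sum_type]
  simp [extendZero_inl, extendZero_inr, BulkMesh.basis]

section Surface

variable (hd : d = n + 1) (α κ : E d → ℝ) (k : ℕ) (𝒢 : SurfaceMesh 𝒯) {N : ℕ}
  {ψ : Fin N → E d → ℝ} (hψ : IsSurfaceFEBasis 𝒢 ψ)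
include hd

theorem sqNorm_multiplier (ψ : Fin N → E d → ℝ) (x : 𝒯.BoundaryNode k → ℝ) :
    sqNorm (feMatrices α κ k 𝒯 𝒢 ψ).Ml x =
      ∫ ξ, (∑ b, x b * 𝒯.shape b.1 ξ) ^ 2 ∂surfaceMeasure Ω := by
  have h := sqNorm_of_integral (μ := surfaceMeasure Ω)
    (β := fun (i j : 𝒯.BoundaryNode k) ξ => 𝒯.shape i.1 ξ * 𝒯.shape j.1 ξ) (fun i j =>
      𝒢.integrable hd (((𝒯.continuousOn_shape_closure i.1).mul
        (𝒯.continuousOn_shape_closure j.1)).mono frontier_subset_closure)) x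
  refine h.trans (integral_congr_ae (Filter.Eventually.of_forall fun ξ => ?_))
  exact sum_sum_mul_eq_sq (g := fun i : 𝒯.BoundaryNode k => 𝒯.shape i.1 ξ)

include hψ

/-- The Gram matrix of the traces `φ_b` together with the `ψ_j` is positive semidefinite. -/
theorem posSemidef_fromBlocks :
    (Matrix.fromBlocks (feMatrices α κ k 𝒯 𝒢 ψ).Ml (feMatrices α κ k 𝒯 𝒢 ψ).Bp
      (feMatrices α κ k 𝒯 𝒢 ψ).Bpᵀ (feMatrices α κ k 𝒯 𝒢 ψ).Mp).PosSemidef := by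
  set g : 𝒯.BoundaryNode k ⊕ Fin N → E d → ℝ := Sum.elim (fun b => 𝒯.shape b.1) ψ with hg
  have hgc : ∀ i, ContinuousOn (g i) (frontier Ω) := by
    rintro (b | j)
    · exact (𝒯.continuousOn_shape_closure b.1).mono frontier_subset_closure
    · exact hψ.continuousOn j
  have h := posSemidef_of_integral (μ := surfaceMeasure Ω) (β := fun i j ξ => g i ξ * g j ξ)
    (fun i j => 𝒢.integrable hd ((hgc i).mul (hgc j))) (fun i j ξ => mul_comm _ _)
    (fun x => Filter.Eventually.of_forall fun ξ => by
      rw [sum_sum_mul_eq_sq (g := fun i => g i ξ)]; exact sq_nonneg _)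
  convert h using 1
  ext (b | j) (b' | j')
  · rfl
  · rfl
  · simp only [fromBlocks_apply₂₁, transpose_apply, of_apply, hg, Sum.elim_inl, Sum.elim_inr,
      mul_comm (ψ j _)]
    rfl
  · rfl

/-- The `L²(Γ)` projection onto the traces does not increase the norm. -/
theorem sqNorm_multiplier_le {x : 𝒯.BoundaryNode k → ℝ} {y : Fin N → ℝ}
    (hxy : (feMatrices α κ k 𝒯 𝒢 ψ).Ml *ᵥ x = (feMatrices α κ k 𝒯 𝒢 ψ).Bp *ᵥ y) :
    sqNorm (feMatrices α κ k 𝒯 𝒢 ψ).Ml x ≤ sqNorm (feMatrices α κ k 𝒯 𝒢 ψ).Mp y := by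
  have h := sqNorm_nonneg (posSemidef_fromBlocks hd α κ k 𝒢 hψ) (Sum.elim x (-y))
  rw [sqNorm, fromBlocks_mulVec, sumElim_dotProduct_sumElim] at h
  simp only [Sum.elim_comp_inl, Sum.elim_comp_inr, mulVec_neg, ← hxy, dotProduct_add,
    dotProduct_neg, neg_dotProduct, mulVec_transpose] at h
  have e : y ⬝ᵥ (x ᵥ* (feMatrices α κ k 𝒯 𝒢 ψ).Bp)
      = sqNorm (feMatrices α κ k 𝒯 𝒢 ψ).Ml x := by
    rw [dotProduct_comm, ← dotProduct_mulVec, ← hxy, sqNorm]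
  rw [e] at h
  rw [sqNorm, sqNorm] at *
  linarith

end Surface

/-- For fine meshes and `τ ≤ c₀ h` the finite element matrices satisfy the stability conditions:
a function in `V_h` with boundary data `x` and vanishing inner nodal values lives in a layer of
width `h`, so its bulk norms carry the factors `h` and `1 / h` relative to the norm on `Γ`. -/
theorem exists_isStableCoupling (hd : d = n + 1) (hΩ : IsOpen Ω) {α κ : E d → ℝ}
    (hα : MemLp α ∞ (volume.restrict Ω)) (hα0 : ∀ᵐ ξ ∂volume.restrict Ω, 0 ≤ α ξ)
    (hκ : MemLp κ ∞ (surfaceMeasure Ω)) (hκ0 : ∀ᵐ ξ ∂surfaceMeasure Ω, 0 ≤ κ ξ)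
    {k : ℕ} (hk : 1 ≤ k) {ρ : ℝ} (hρ : 0 < ρ) :
    ∃ h₀ > 0, ∃ c₀ > 0, c₀ * h₀ ≤ 1 ∧ ∀ (𝒯 : BulkMesh Ω) (𝒢 : SurfaceMesh 𝒯) (N : ℕ)
      (ψ : Fin N → E d → ℝ), IsSurfaceFEBasis 𝒢 ψ → 𝒯.IsQuasiUniform ρ → 𝒯.meshWidth ≤ h₀ →
      ∀ τ : ℝ, 0 < τ → τ ≤ c₀ * 𝒯.meshWidth → IsStableCoupling (feMatrices α κ k 𝒯 𝒢 ψ) τ := by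
  classical
  obtain ⟨L, hL, hlow⟩ := BulkMesh.exists_sum_sq_le (n := n) hρ hk hd Ω
  obtain ⟨C, hC, hαC⟩ := exists_ae_abs_le hα
  set ω := volume.real (Metric.ball (0 : E d) 1) with hω
  set K₁ : ℝ := ((k : ℝ) ^ k) ^ 2 * (k + 1) ^ (d + 1) * (ω * ρ ^ d) with hK₁
  set K₂ : ℝ := C * (((k : ℝ) * (k ^ (k - 1) * (k * ρ))) ^ 2 * (k + 1) ^ (d + 1)) * (ω * ρ ^ d)
    with hK₂
  have hω0 : 0 ≤ ω := measureReal_nonneg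
  have hK₁0 : 0 ≤ K₁ := by positivity
  have hK₂0 : 0 ≤ K₂ := by positivity
  refine ⟨1 / (1000 * (K₁ * L + 1)), by positivity, 1 / (1000 * (K₂ * L + 1)),
    by positivity, ?_, ?_⟩
  · have h1 : 1 / (1000 * (K₁ * L + 1)) ≤ 1 := by
      rw [div_le_one (by positivity)]
      nlinarith [mul_nonneg hK₁0 hL.le]
    have h2 : 1 / (1000 * (K₂ * L + 1)) ≤ 1 := by
      rw [div_le_one (by positivity)]
      nlinarith [mul_nonneg hK₂0 hL.le]
    exact mul_le_one₀ h2 (by positivity) h1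
  intro 𝒯 𝒢 N ψ hψ hq hh₀ τ hτ hτh
  have hh : 0 < 𝒯.meshWidth := by
    by_contra! h
    have : 1 / (1000 * (K₂ * L + 1)) * 𝒯.meshWidth ≤ 0 :=
      mul_nonpos_of_nonneg_of_nonpos (by positivity) h
    linarith
  set S := feMatrices α κ k 𝒯 𝒢 ψ with hS
  set h := 𝒯.meshWidth with hhdef
  rw [le_div_iff₀ (by positivity)] at hh₀
  rw [div_mul_eq_mul_div, one_mul, le_div_iff₀ (by positivity)] at hτh
  -- the inverse estimate for the boundary nodal values
  have hnodal : ∀ x y, S.Ml *ᵥ x = S.Bp *ᵥ y → h ^ n * ∑ b, x b ^ 2 ≤ L * sqNorm S.Mp y := by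
    intro x y hxy
    have h1 := hlow 𝒯 𝒢 hq hh x
    rw [← sqNorm_multiplier hd α κ k 𝒢 ψ x] at h1
    exact h1.trans (mul_le_mul_of_nonneg_left (sqNorm_multiplier_le hd α κ k 𝒢 hψ hxy) hL.le)
  have hMp : S.Mp.PosSemidef := posSemidef_of_integral
    (fun i j => 𝒢.integrable hd ((hψ.continuousOn i).mul (hψ.continuousOn j)))
    (fun i j ξ => mul_comm _ _) fun x => Filter.Eventually.of_forall fun ξ => by
      rw [sum_sum_mul_eq_sq (g := fun i => ψ i ξ)]; exact sq_nonneg _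
  refine ⟨?_, ?_, hMp, ?_, ?_, ?_, ?_, ?_, ?_⟩
  · refine posSemidef_of_integral (fun i j => ?_) (fun i j ξ => mul_comm _ _)
      fun x => Filter.Eventually.of_forall fun ξ => by
        rw [sum_sum_mul_eq_sq (g := fun i => 𝒯.basis k i ξ)]; exact sq_nonneg _
    simp only [BulkMesh.basis_eq_shape]
    exact 𝒯.integrableOn_shape_mul_shape _ _
  · refine posSemidef_of_integral (fun i j => ?_) (fun i j ξ => by rw [real_inner_comm]) fun x => ?_
    · simp only [BulkMesh.basis_eq_shape]
      exact 𝒯.integrableOn_mul_inner_gradient hΩ hq hρ hh hα _ _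
    · filter_upwards [hα0] with ξ hξ
      rw [sum_sum_inner_eq_norm_sq (α ξ) (fun i => ∇ (𝒯.basis k i) ξ)]
      exact mul_nonneg hξ (sq_nonneg _)
  · have e : S.Kp = ∑ s ∈ 𝒢.facets, Matrix.of fun i j => ∫ x in hull s,
        κ x * inner ℝ (tangentialGradient (vectorSpan ℝ (s : Set (E d))) (ψ i) x)
          (tangentialGradient (vectorSpan ℝ (s : Set (E d))) (ψ j) x) ∂surfaceMeasure Ω := by
      ext i j
      rw [Matrix.sum_apply]
      rfl
    rw [e]
    refine Matrix.posSemidef_sum _ fun s hs => ?_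
    refine posSemidef_of_integral
      (fun i j => 𝒢.integrableOn_mul_inner_tangentialGradient hd hκ hψ hs i j)
      (fun i j ξ => by rw [real_inner_comm]) fun x => ?_
    filter_upwards [ae_restrict_of_ae hκ0] with ξ hξ
    rw [sum_sum_inner_eq_norm_sq (κ ξ)
      (fun i => tangentialGradient (vectorSpan ℝ (s : Set (E d))) (ψ i) ξ)]
    exact mul_nonneg hξ (sq_nonneg _)
  · ext i j
    simp only [transpose_apply, hS, feMatrices, of_apply, mul_comm]
  · rw [isUnit_iff_ne_zero]
    intro h0
    obtain ⟨x, hx, hx0⟩ := Matrix.exists_mulVec_eq_zero_iff.2 h0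
    have h1 := hnodal x 0 (by rw [hx0, mulVec_zero])
    rw [sqNorm, zero_dotProduct, mul_zero] at h1
    have h2 : ∑ b, x b ^ 2 ≤ 0 := by
      by_contra! h3
      have := mul_pos (pow_pos hh n) h3
      linarith
    refine hx (funext fun b => ?_)
    have h3 := (Finset.single_le_sum (f := fun b => x b ^ 2) (fun b _ => sq_nonneg _)
      (Finset.mem_univ b)).trans h2
    exact pow_eq_zero_iff two_ne_zero |>.1 (le_antisymm h3 (sq_nonneg _))
  · ext i (a | b)
    · rw [fromCols_apply_inl, Matrix.zero_apply]
      refine setIntegral_eq_zero_of_forall_eq_zero fun ξ hξ => ?_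
      change _ * 𝒯.shape a.1 ξ = 0
      rw [BulkMesh.shape_innerNode_eq_zero 𝒢 hk a hξ, mul_zero]
    · rfl
  · intro x y hxy
    have h1 := hnodal x y hxy
    have h2 := BulkMesh.integral_sq_shape_le hΩ hq hρ hh hk x
    rw [← sqNorm_mass_extendZero α κ k 𝒢 ψ x] at h2
    have hM0 := sqNorm_nonneg hMp y
    calc sqNorm S.Mu (extendZero x) ≤ K₁ * h * (h ^ n * ∑ b, x b ^ 2) := by
          refine h2.trans_eq ?_
          rw [hK₁]
          subst hd
          ring
      _ ≤ K₁ * h * (L * sqNorm S.Mp y) := mul_le_mul_of_nonneg_left h1 (by positivity)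
      _ = (K₁ * L * h) * sqNorm S.Mp y := by ring
      _ ≤ 1 / 1000 * sqNorm S.Mp y := mul_le_mul_of_nonneg_right (by nlinarith) hM0
  · intro x y hxy
    have h1 := hnodal x y hxy
    have h2 := BulkMesh.integral_sq_gradient_shape_le hΩ hq hρ hh hk hC.le hα0 hαC x
    rw [← sqNorm_stiffness_extendZero hΩ hq hρ hh hα κ k 𝒢 ψ x] at h2
    have hM0 := sqNorm_nonneg hMp y
    have h3 : τ * h⁻¹ * (1000 * (K₂ * L + 1)) ≤ 1 := by
      rw [mul_right_comm, ← div_eq_mul_inv, div_le_one hh]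
      exact hτh
    have h4 : 0 ≤ τ * h⁻¹ := by positivity
    calc τ * sqNorm S.Ku (extendZero x) ≤ τ * (K₂ * h⁻¹ * (h ^ n * ∑ b, x b ^ 2)) := by
          refine mul_le_mul_of_nonneg_left (h2.trans_eq ?_) hτ.le
          rw [hK₂]
          subst hd
          rw [← hhdef, ← hω, pow_succ h n]
          field_simp
      _ ≤ τ * (K₂ * h⁻¹ * (L * sqNorm S.Mp y)) := by gcongr
      _ = (τ * h⁻¹ * (K₂ * L)) * sqNorm S.Mp y := by ring
      _ ≤ 1 / 1000 * sqNorm S.Mp y := mul_le_mul_of_nonneg_right (by nlinarith) hM0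

end BulkSurface

end

theorem mainTheorem2 {d : ℕ} (hd : d = 2 ∨ d = 3)
    (Ω : Set (E d)) (hΩ : IsLipschitzDomain Ω) (α κ : E d → ℝ)
    (hα : MemLp α ∞ (volume.restrict Ω)) (hα_pos : ∃ a > 0, ∀ᵐ x ∂volume.restrict Ω, a ≤ α x)
    (hκ : MemLp κ ∞ (surfaceMeasure Ω)) (hκ_pos : ∃ a > 0, ∀ᵐ x ∂surfaceMeasure Ω, a ≤ κ x)
    (T : ℝ) (hT : 0 < T) (k : ℕ) (hk : 1 ≤ k) (ρ : ℝ) (hρ : 0 < ρ) :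
    -- `h₀`: mesh width small enough; `c₀`: constant of the weak CFL condition
    ∃ h₀ > 0, ∃ c₀ > 0, ∀ A R : ℝ, ∃ C : ℝ,
      ∀ (𝒯 : BulkMesh Ω) (𝒢 : SurfaceMesh 𝒯) (N : ℕ) (ψ : Fin N → E d → ℝ),
        IsSurfaceFEBasis 𝒢 ψ → 𝒯.IsQuasiUniform ρ → 𝒯.meshWidth ≤ h₀ →
      ∀ S, S = feMatrices α κ k 𝒯 𝒢 ψ →
      ∀ τ : ℝ, 0 < τ → τ ≤ c₀ * 𝒯.meshWidth →
      -- semi-discrete solution, extended to negative times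
      ∀ (fu : ℝ → 𝒯.Dof k → ℝ) (fp : ℝ → Fin N → ℝ)
        (u : ℝ → 𝒯.Dof k → ℝ) (p : ℝ → Fin N → ℝ) (lam : ℝ → 𝒯.BoundaryNode k → ℝ),
        IsSemidiscreteSolution S fu fp (Set.Icc (-2 * τ) T) u p lam →
        ContDiff ℝ 4 u → ContDiff ℝ 4 p → regularity S (-2 * τ) T u p ≤ R →
      -- discrete solution with consistent initial data
      ∀ (uh : ℤ → 𝒯.Dof k → ℝ) (ph : ℤ → Fin N → ℝ) (lamh : ℤ → 𝒯.BoundaryNode k → ℝ),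
        (∀ j : ℤ, -2 ≤ j → j ≤ 0 → S.Bu *ᵥ uh j = S.Bp *ᵥ ph j) →
        (∀ j : ℤ, -2 ≤ j → j ≤ 0 →
          sqError S.Mu S.Mp τ uh ph u p j + τ * sqError S.Ku S.Kp τ uh ph u p j ≤ A * τ ^ 5) →
        (∀ m : ℤ, 1 ≤ m → m * τ ≤ T → IsAuxiliaryStep S fu fp τ uh ph lamh m) →
      ∀ n : ℕ, n * τ ≤ T →
        sqError S.Mu S.Mp τ uh ph u p n
          + τ * ∑ j ∈ Finset.Icc 1 n, sqError S.Ku S.Kp τ uh ph u p j ≤ C * τ ^ 4 := by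
  obtain ⟨n, hn⟩ : ∃ n, d = n + 1 := ⟨d - 1, by omega⟩
  obtain ⟨a, ha, hαa⟩ := hα_pos
  obtain ⟨b, hb, hκb⟩ := hκ_pos
  obtain ⟨h₀, hh₀, c₀, hc₀, hch, hS⟩ := exists_isStableCoupling hn hΩ.isOpen hα
    (hαa.mono fun _ h => ha.le.trans h) hκ (hκb.mono fun _ h => hb.le.trans h) hk hρ
  refine ⟨h₀, hh₀, c₀, hc₀, fun A R => ⟨320000 * A + 10 ^ 11 * (1 + T) * R, ?_⟩⟩
  intro 𝒯 𝒢 N ψ hψ hq hh S hSe τ hτ hτh fu fp u p lam hsol hu hp hR uh ph lamh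
    hcons hinit hstep m hm
  subst hSe
  have hτ1 : τ ≤ 1 := hτh.trans ((mul_le_mul_of_nonneg_left hh hc₀.le).trans hch)
  exact (hS 𝒯 𝒢 N ψ hψ hq hh τ hτ hτh).convergence hT hτ hτ1 hsol hu hp hR hcons hinit hstep m hm
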